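/- Let $N\ge 1$. A *colored $N$-space* is a graph $M$ whose vertices are partitioned into levels $\mathcal A_0,\dots,\mathcal A_N$ such that a vertex of level $i$ can be linked only to vertices of level $i-1$ or $i+1$; it is a structure for the language with unary predicates for the levels and a binary predicate for the edges. We add two imaginary vertices, $a_{-1}$ of level $-1$, linked to all vertices of level $0$, and $a_{N+1}$ of level $N+1$, linked to all vertices of level $N$; they belong to every subset. For an interval $t$ of levels (intervals are non-empty), a *$t$-path* is a path, possibly with repetitions, through real vertices with levels in $t$, and $t$-distance is the length of a shortest $t$-path. For real $a\in\mathcal A_l$, $b\in\mathcal A_r$, we say that $a$ lies beneath $b$ (and $b$ over $a$) if $l<r$ and there is a path $a=a_l,a_{l+1},\dots,a_r=b$ with $a_i\in\mathcal A_i$; moreover $a_{N+1}$ lies over all other vertices and $a_{-1}$ beneath all others. Let $M_a^b$ be the set of real vertices lying over $a$ and beneath $b$. Let $PS_N$ be the first-order theory of colored $N$-spaces $M$ such that: 1. (simple connectedness) whenever $-1\le l<r\le N+1$, $t\subseteq[l,r]$ is an interval, $a$ of level $l$ lies beneath $b$ of level $r$, and $x,y\in M_a^b$ have levels in $t$ and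 are connected by a $t$-path of length $k$ passing through neither $a$ nor $b$, then $x$ and $y$ are connected by a $t$-path of length at most $k$ all of whose vertices are in $M_a^b$; 2. for every finite set $A$ of vertices, every non-empty interval $s=(l,r)$ of levels in $\{0,\dots,N\}$, all (possibly imaginary) $a,b\in A$ of levels $l,r$ with $a$ beneath $b$, and every $n$, there is a path $a,b_{l+1},\dots,b_{r-1},b$ with $b_i\in\mathcal A_i$ such that the $s$-distance of each $b_i$ to each vertex of $A$ with level in $s$ is larger than $n$. A subset $D$ of a colored $N$-space $M$ is *nice* if, regarding $D$ as an induced subgraph, $D_a^b=D\cap M_a^b$ for all (possibly imaginary) $a,b\in D$ and, for every interval $t\subseteq\{0,\dots,N\}$, any two vertices of $D$ with levels in $t$ which have finite $t$-distance in $M$ have finite $t$-distance in $D$. **Theorem.** (i) If $M$ and $M'$ are models of $PS_N$, then every isomorphism $f:A\to A'$ between a finite nice subset $A$ of $M$ and a nice subset $A'$ of $M'$ is elementary, that is, $M\models\varphi(x_1,\dots,x_n)$ if and only if $M'\models\varphi(f(x_1),\dots,f(x_n))$ for every first-order formula $\varphi$ and all $x_1,\dots,x_n\in A$. (ii) The theory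 $PS_N$ is complete, i.e. it is consistent and, for every sentence $\varphi$, either $\varphi$ or $\neg\varphi$ follows from it. (iii) The type of a nice set is determined by its quantifier-free type: if families $(a_i)_{i\in I}$ in $M\models PS_N$ and $(a'_i)_{i\in I}$ in $M'\models PS_N$ both enumerate nice sets and satisfy the same quantifier-free formulas, then they satisfy the same formulas. -/

import Mathlib

open FirstOrder FirstOrder.Language

namespace FreePseudospace

noncomputable section

/-! ## Colored graphs as first-order structures -/

/-- The symbols of the language of graphs colored by the levels `0, …, N`:
a unary predicate for each level and a binary predicate for the edges. -/
inductive Rel (N : ℕ) : ℕ → Type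
  | level (i : Fin (N + 1)) : Rel N 1
  | adj : Rel N 2

/-- The (relational) language of graphs colored by the levels `0, …, N`. -/
def lang (N : ℕ) : Language := ⟨fun _ => Empty, Rel N⟩

instance (N : ℕ) : (lang N).IsRelational := fun _ => inferInstanceAs (IsEmpty Empty)

/-- `x` is a vertex of level `i`. Levels are integers, in order to speak about the two imaginary
levels `-1` and `N + 1`, on which there are no real vertices. -/
def Level (N : ℕ) {M : Type*} [(lang N).Structure M] (i : ℤ) (x : M) : Prop :=
  ∃ j : Fin (N + 1), (j : ℤ) = i ∧ Structure.RelMap (L := lang N) (Rel.level j) ![x]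

/-- `x` and `y` are linked by an edge. -/
def Adj (N : ℕ) {M : Type*} [(lang N).Structure M] (x y : M) : Prop :=
  Structure.RelMap (L := lang N) Rel.adj ![x, y]

/-- A colored `N`-space: a graph, each of whose vertices has exactly one level, such that linked
vertices have consecutive levels (in particular there are no loops). -/
structure IsColoredSpace (N : ℕ) (M : Type*) [(lang N).Structure M] : Prop where
  existsUnique_level : ∀ x : M, ∃! i : ℤ, Level N i x
  adj_symm : ∀ x y : M, Adj N x y → Adj N y x
  level_of_adj : ∀ x y : M, Adj N x y →
    ∃ i : ℤ, (Level N i x ∧ Level N (i + 1) y) ∨ (Level N (i + 1) x ∧ Level N i y)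

/-- The possibly imaginary vertices: the real ones, and two imaginary ones,
`bot` on level `-1` and `top` on level `N + 1`. -/
inductive Vertex (M : Type*)
  | bot : Vertex M
  | real (x : M) : Vertex M
  | top : Vertex M

namespace Vertex

/-- Functoriality of `Vertex`. -/
def map {M M' : Type*} (f : M → M') : Vertex M → Vertex M'
  | bot => bot
  | real x => real (f x)
  | top => top

/-- `a` belongs to the set `D` of real vertices; the imaginary vertices belong to every set. -/
def Mem {M : Type*} (D : Set M) : Vertex M → Prop
  | real x => x ∈ D
  | _ => True

end Vertex

section Semantics

variable (N : ℕ) {M : Type*} [(lang N).Structure M]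

/-- The possibly imaginary vertex `a` has level `i`. -/
def VLevel (i : ℤ) : Vertex M → Prop
  | .bot => i = -1
  | .real x => Level N i x
  | .top => i = N + 1

/-- Adjacency of possibly imaginary vertices: `bot` is linked to all vertices of level `0` and
`top` is linked to all vertices of level `N`. -/
def VAdj : Vertex M → Vertex M → Prop
  | .real x, .real y => Adj N x y
  | .bot, .real x => Level N 0 x
  | .real x, .bot => Level N 0 x
  | .top, .real x => Level N N x
  | .real x, .top => Level N N x
  | _, _ => False

/-- The set of real vertices whose level is in the interval `[p, q]`. -/
def Strip (p q : ℤ) : Set M := {x | ∃ i : ℤ, p ≤ i ∧ i ≤ q ∧ Level N i x}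

/-- There is a path of length `k` from `x` to `y` all of whose vertices are in `D`. -/
def PathIn (D : Set M) (k : ℕ) (x y : M) : Prop :=
  ∃ c : Fin (k + 1) → M, c 0 = x ∧ c (Fin.last k) = y ∧ (∀ i, c i ∈ D) ∧
    ∀ i : Fin k, Adj N (c i.castSucc) (c i.succ)

/-- `a` lies beneath `b` (and `b` lies over `a`) in the subgraph with set of vertices `D`: for real
vertices, there is a path `a = a_l, a_{l+1}, …, a_{l+k} = b` in `D` with `k > 0` and `a_i` of
level `i`. By convention `top` lies over all other vertices and `bot` beneath all others. -/
def Beneath (D : Set M) : Vertex M → Vertex M → Prop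
  | .real a, .real b => ∃ (l : ℤ) (k : ℕ), 0 < k ∧ ∃ c : Fin (k + 1) → M,
      c 0 = a ∧ c (Fin.last k) = b ∧ (∀ i, c i ∈ D ∧ Level N (l + (i : ℕ)) (c i)) ∧
        ∀ i : Fin k, Adj N (c i.castSucc) (c i.succ)
  | .bot, .real _ => True
  | .bot, .top => True
  | .real _, .top => True
  | _, _ => False

/-- The set `D_a^b` of the real vertices of the subgraph `D` lying between `a` and `b`. -/
def Between (D : Set M) (a b : Vertex M) : Set M :=
  {x | x ∈ D ∧ Beneath N D a (.real x) ∧ Beneath N D (.real x) b}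

variable (M) in
/-- Simple connectedness: if `a`, of level `l`, lies beneath `b`, of level `r`, and the vertices `x`
and `y`, of level in the interval `[p, q] ⊆ [l, r]`, lie between `a` and `b` and are connected by
a path of length `k` with levels in `[p, q]` passing neither through `a` nor through `b`, then they
are connected by a path of length at most `k` with levels in `[p, q]` and lying between `a` and `b`.
(An imaginary vertex of level in `[l, r]` can only be `a` or `b`, so the first path is real.) -/
def SimplyConnected : Prop :=
  ∀ l r p q : ℤ, -1 ≤ l → l < r → r ≤ N + 1 → l ≤ p → p ≤ q → q ≤ r →
    ∀ a b : Vertex M, VLevel N l a → VLevel N r b → Beneath N Set.univ a b →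
      ∀ x y : M, x ∈ Strip N p q ∩ Between N Set.univ a b →
        y ∈ Strip N p q ∩ Between N Set.univ a b →
        ∀ k : ℕ, PathIn N (Strip N p q ∩ {z | Vertex.real z ≠ a ∧ Vertex.real z ≠ b}) k x y →
          ∃ k' ≤ k, PathIn N (Strip N p q ∩ Between N Set.univ a b) k' x y

variable (M) in
/-- For every finite set `A` of vertices and every non-empty interval `s = (l, r)` of levels, where
`r = l + m + 2`, and possibly imaginary `a` and `b` in `A`, of levels `l` and `r`, with `b` over `a`,
there are, for every `n`, paths `a, c_{l+1}, …, c_{r-1}, b` with `c_i` of level `i` such that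
the distance, in the graph of the vertices of level in `s`, of each `c_i` to each vertex
in `A` of level in `s` is larger than `n`. -/
def ArbitrarilyFarPaths : Prop :=
  ∀ A : Set M, A.Finite → ∀ (l : ℤ) (m : ℕ), -1 ≤ l → l + m + 2 ≤ N + 1 →
    ∀ a b : Vertex M, a.Mem A → b.Mem A → VLevel N l a → VLevel N (l + m + 2) b →
      Beneath N Set.univ a b →
      ∀ n : ℕ, ∃ c : Fin (m + 1) → M,
        (∀ j : Fin (m + 1), Level N (l + 1 + (j : ℕ)) (c j)) ∧
        VAdj N a (.real (c 0)) ∧ VAdj N (.real (c (Fin.last m))) b ∧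
        (∀ j : Fin m, Adj N (c j.castSucc) (c j.succ)) ∧
        ∀ x ∈ A, x ∈ Strip N (l + 1) (l + m + 1) →
          ∀ j, ∀ k ≤ n, ¬ PathIn N (Strip N (l + 1) (l + m + 1)) k (c j) x

/-- A set `D` of vertices is nice if `D_a^b = D ∩ M_a^b` for all possibly imaginary `a` and `b`
in `D`, and if, for each interval `[p, q] ⊆ {0, …, N}`, any two vertices of `D` with levels in
`[p, q]` at finite `[p, q]`-distance in `M` are at finite `[p, q]`-distance in `D`. -/
structure Nice (D : Set M) : Prop where
  between_eq : ∀ a b : Vertex M, a.Mem D → b.Mem D →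
    Between N D a b = D ∩ Between N Set.univ a b
  connected : ∀ p q : ℤ, 0 ≤ p → p ≤ q → q ≤ N → ∀ x ∈ D ∩ Strip N p q, ∀ y ∈ D ∩ Strip N p q,
    (∃ k, PathIn N (Strip N p q) k x y) → ∃ k, PathIn N (D ∩ Strip N p q) k x y

end Semantics

/-! ## The axioms -/

section Formulas

variable (N : ℕ) {α : Type}

/-- The formula expressing `Level N i x`. -/
def levelF (i : ℤ) (x : α) : (lang N).Formula α :=
  Formula.iSup fun j : {j : Fin (N + 1) // (j : ℤ) = i} =>
    Relations.formula₁ (L := lang N) (Rel.level j.1) (Term.var x)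

/-- The formula expressing `Adj N x y`. -/
def adjF (x y : α) : (lang N).Formula α :=
  Relations.formula₂ (L := lang N) Rel.adj (Term.var x) (Term.var y)

/-- The formula expressing `x = y`. -/
def eqF (x y : α) : (lang N).Formula α :=
  Term.equal (Term.var x) (Term.var y)

/-- The formula expressing that there is a path `c_0, …, c_k` of length `k` from `x` to `y` such
that `θ i` holds for each index `i`; in `θ i`, the variable `Sum.inr i` stands for `c_i`. -/
def pathF (k : ℕ) (θ : Fin (k + 1) → (lang N).Formula (α ⊕ Fin (k + 1))) (x y : α) :
    (lang N).Formula α :=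
  Formula.iExs (Fin (k + 1))
    (eqF N (Sum.inr 0) (Sum.inl x) ⊓ eqF N (Sum.inr (Fin.last k)) (Sum.inl y) ⊓
      Formula.iInf θ ⊓
      Formula.iInf fun i : Fin k => adjF N (Sum.inr i.castSucc) (Sum.inr i.succ))

/-- The formula expressing `VLevel N i a`. -/
def vLevelF (i : ℤ) : Vertex α → (lang N).Formula α
  | .bot => if i = -1 then ⊤ else ⊥
  | .real x => levelF N i x
  | .top => if i = N + 1 then ⊤ else ⊥

/-- The formula expressing `VAdj N a b`. -/
def vAdjF : Vertex α → Vertex α → (lang N).Formula α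
  | .real x, .real y => adjF N x y
  | .bot, .real x => levelF N 0 x
  | .real x, .bot => levelF N 0 x
  | .top, .real x => levelF N N x
  | .real x, .top => levelF N N x
  | _, _ => ⊥

/-- The formula expressing `Vertex.real x ≠ a`. -/
def neF (x : α) : Vertex α → (lang N).Formula α
  | .real y => (eqF N x y).not
  | _ => ⊤

/-- The formula expressing `x ∈ Strip N p q`. -/
def stripF (p q : ℤ) (x : α) : (lang N).Formula α :=
  Formula.iSup fun j : {j : Fin (N + 1) // p ≤ (j : ℤ) ∧ (j : ℤ) ≤ q} => levelF N j.1 x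

/-- The formula expressing `Beneath N Set.univ a b`. -/
def beneathF : Vertex α → Vertex α → (lang N).Formula α
  | .real a, .real b =>
      Formula.iSup fun lk : Fin (N + 1) × {k : Fin (N + 1) // 0 < (k : ℕ)} =>
        pathF N lk.2.1 (fun i => levelF N ((lk.1 : ℕ) + (i : ℕ)) (Sum.inr i)) a b
  | .bot, .real _ => ⊤
  | .bot, .top => ⊤
  | .real _, .top => ⊤
  | _, _ => ⊥

/-- The formula expressing `x ∈ Between N Set.univ a b`. -/
def betweenF (a b : Vertex α) (x : α) : (lang N).Formula α :=
  beneathF N a (.real x) ⊓ beneathF N (.real x) b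

/-- The universal closure of a formula in finitely many variables. -/
def close [Finite α] (φ : (lang N).Formula α) : (lang N).Sentence :=
  Formula.iAlls α (Formula.relabel (Sum.inr : α → Empty ⊕ α) φ)

/-- The axioms of colored `N`-spaces. -/
def coloredSpaceAxioms : (lang N).Theory :=
  {close N (α := Fin 1) (Formula.iSup fun i : Fin (N + 1) =>
      levelF N i 0 ⊓ Formula.iInf fun j : {j : Fin (N + 1) // j ≠ i} => (levelF N j.1 0).not),
    close N (α := Fin 2) ((adjF N 0 1).imp (adjF N 1 0)),
    close N (α := Fin 2) ((adjF N 0 1).imp (Formula.iSup fun i : Fin (N + 1) =>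
      (levelF N i 0 ⊓ levelF N (i + 1) 1) ⊔ (levelF N (i + 1) 0 ⊓ levelF N i 1)))}

/-- The instance of simple connectedness for the parameters `l`, `r`, `p`, `q`, `k`. The variables
`2` and `3` stand for `x` and `y`. Each of `a` and `b` is imaginary or one of the variables. -/
def simplyConnectedAxiom (l r p q : ℤ) (k : ℕ) (a b : Vertex (Fin 4)) : (lang N).Sentence :=
  close N (α := Fin 4)
    ((vLevelF N l a ⊓ vLevelF N r b ⊓ beneathF N a b ⊓
        (stripF N p q 2 ⊓ betweenF N a b 2) ⊓ (stripF N p q 3 ⊓ betweenF N a b 3) ⊓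
        pathF N k (fun i => stripF N p q (Sum.inr i) ⊓
          (neF N (Sum.inr i) (a.map Sum.inl) ⊓ neF N (Sum.inr i) (b.map Sum.inl))) 2 3).imp
      (Formula.iSup fun k' : Fin (k + 1) =>
        pathF N k' (fun i => stripF N p q (Sum.inr i) ⊓
          betweenF N (a.map Sum.inl) (b.map Sum.inl) (Sum.inr i)) 2 3))

/-- The instance of the existence of far paths for the parameters `l`, `m`, `n` and sets `A`
of cardinality at most `d`. The variables enumerate `A`, and each of `a` and `b` is imaginary or one
of the variables. -/
def farPathAxiom (l : ℤ) (m n d : ℕ) (a b : Vertex (Fin d)) : (lang N).Sentence :=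
  close N (α := Fin d)
    ((vLevelF N l a ⊓ vLevelF N (l + m + 2) b ⊓ beneathF N a b).imp
      (Formula.iExs (Fin (m + 1))
        ((Formula.iInf fun j : Fin (m + 1) => levelF N (l + 1 + (j : ℕ)) (Sum.inr j)) ⊓
          vAdjF N (a.map Sum.inl) (.real (Sum.inr 0)) ⊓
          vAdjF N (.real (Sum.inr (Fin.last m))) (b.map Sum.inl) ⊓
          (Formula.iInf fun j : Fin m => adjF N (Sum.inr j.castSucc) (Sum.inr j.succ)) ⊓
          Formula.iInf fun x : Fin d => (stripF N (l + 1) (l + m + 1) (Sum.inl x)).imp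
            (Formula.iInf fun j : Fin (m + 1) => Formula.iInf fun k : Fin (n + 1) =>
              (pathF N k (fun i => stripF N (l + 1) (l + m + 1) (Sum.inr i))
                (Sum.inr j) (Sum.inl x)).not))))

/-- The theory `PS_N` of the `N`-dimensional free pseudospace. -/
def PS : (lang N).Theory :=
  coloredSpaceAxioms N ∪
  {φ | ∃ (l r p q : ℤ) (k : ℕ) (a b : Vertex (Fin 4)),
    -1 ≤ l ∧ l < r ∧ r ≤ N + 1 ∧ l ≤ p ∧ p ≤ q ∧ q ≤ r ∧
      φ = simplyConnectedAxiom N l r p q k a b} ∪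
  {φ | ∃ (l : ℤ) (m n d : ℕ) (a b : Vertex (Fin d)),
    -1 ≤ l ∧ l + m + 2 ≤ N + 1 ∧ φ = farPathAxiom N l m n d a b}

end Formulas

/-! ## The models of the axioms -/

section Realize

variable {N : ℕ} {α : Type} {M : Type*} [(lang N).Structure M] {v : α → M}

theorem realize_levelF {i : ℤ} {x : α} : (levelF N i x).Realize v ↔ Level N i (v x) := by
  simp only [levelF, Formula.realize_iSup, Level]
  constructor
  · rintro ⟨j, h⟩
    exact ⟨j.1, j.2, Formula.realize_rel₁.1 h⟩
  · rintro ⟨j, hj, h⟩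
    exact ⟨⟨j, hj⟩, Formula.realize_rel₁.2 h⟩

theorem realize_adjF {x y : α} : (adjF N x y).Realize v ↔ Adj N (v x) (v y) :=
  Formula.realize_rel₂

theorem realize_eqF {x y : α} : (eqF N x y).Realize v ↔ v x = v y := by
  simp [eqF, Formula.realize_equal]

theorem realize_pathF {k : ℕ} {θ : Fin (k + 1) → (lang N).Formula (α ⊕ Fin (k + 1))} {x y : α} :
    (pathF N k θ x y).Realize v ↔ ∃ c : Fin (k + 1) → M, c 0 = v x ∧ c (Fin.last k) = v y ∧
      (∀ i, (θ i).Realize (Sum.elim v c)) ∧ ∀ i : Fin k, Adj N (c i.castSucc) (c i.succ) := by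
  simp [pathF, Formula.realize_iExs, realize_eqF, realize_adjF, and_assoc]

theorem realize_vLevelF {i : ℤ} {a : Vertex α} :
    (vLevelF N i a).Realize v ↔ VLevel N i (a.map v) := by
  cases a <;> simp only [vLevelF, VLevel, Vertex.map, realize_levelF] <;> split_ifs <;> simp [*]

theorem realize_vAdjF {a b : Vertex α} :
    (vAdjF N a b).Realize v ↔ VAdj N (a.map v) (b.map v) := by
  cases a <;> cases b <;> simp [vAdjF, VAdj, Vertex.map, realize_levelF, realize_adjF]

theorem realize_neF {x : α} {a : Vertex α} :
    (neF N x a).Realize v ↔ Vertex.real (v x) ≠ a.map v := by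
  cases a <;> simp [neF, Vertex.map, realize_eqF]

theorem realize_stripF {p q : ℤ} {x : α} :
    (stripF N p q x).Realize v ↔ v x ∈ Strip N p q := by
  simp only [stripF, Formula.realize_iSup, realize_levelF, Strip, Set.mem_ofPred_eq]
  constructor
  · rintro ⟨j, h⟩
    exact ⟨_, j.2.1, j.2.2, h⟩
  · rintro ⟨i, h1, h2, j, rfl, h⟩
    exact ⟨⟨j, h1, h2⟩, j, rfl, h⟩

theorem realize_beneathF {a b : Vertex α} :
    (beneathF N a b).Realize v ↔ Beneath N Set.univ (a.map v) (b.map v) := by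
  cases a <;> cases b <;> simp only [beneathF, Beneath, Vertex.map, Formula.realize_top,
    Formula.realize_bot, Formula.realize_iSup, realize_pathF, realize_levelF, Sum.elim_inr,
    Set.mem_univ, true_and]
  constructor
  · rintro ⟨lk, h⟩
    exact ⟨lk.1, lk.2.1, lk.2.2, h⟩
  · rintro ⟨l, k, hk, c, h0, h1, h2, h3⟩
    obtain ⟨i, hi, -⟩ := h2 0
    obtain ⟨j, hj, -⟩ := h2 (Fin.last k)
    simp only [Fin.val_zero, Fin.val_last, Nat.cast_zero, add_zero] at hi hj
    subst hi
    have := j.2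
    exact ⟨(i, ⟨⟨k, by omega⟩, hk⟩), c, h0, h1, h2, h3⟩

theorem realize_betweenF {a b : Vertex α} {x : α} :
    (betweenF N a b x).Realize v ↔ v x ∈ Between N Set.univ (a.map v) (b.map v) := by
  simp [betweenF, Between, realize_beneathF, Vertex.map]

theorem realize_close [Finite α] {φ : (lang N).Formula α} :
    M ⊨ close N φ ↔ ∀ v : α → M, φ.Realize v := by
  simp only [close, Sentence.Realize, Formula.realize_iAlls, Formula.realize_relabel]
  rfl

theorem Vertex.map_map {α β γ : Type*} (f : α → β) (g : β → γ) (a : Vertex α) :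
    (a.map f).map g = a.map (g ∘ f) := by
  cases a <;> rfl

theorem models_coloredSpaceAxioms : M ⊨ coloredSpaceAxioms N ↔ IsColoredSpace N M := by
  simp only [coloredSpaceAxioms, Theory.model_iff, Set.mem_insert_iff, Set.mem_singleton_iff,
    forall_eq_or_imp, forall_eq, realize_close, Formula.realize_iSup, Formula.realize_inf,
    Formula.realize_iInf, Formula.realize_not, Formula.realize_imp, Formula.realize_sup,
    realize_levelF, realize_adjF]
  constructor
  · rintro ⟨h1, h2, h3⟩
    refine ⟨fun x => ?_, fun x y => h2 ![x, y], fun x y h => ?_⟩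
    · obtain ⟨i, hi, h⟩ := h1 fun _ => x
      refine ⟨i, hi, ?_⟩
      rintro _ ⟨j, rfl, hj⟩
      by_contra hne
      exact h ⟨j, fun e => hne (by rw [e])⟩ ⟨j, rfl, hj⟩
    · obtain ⟨i, hi⟩ := h3 ![x, y] h
      exact ⟨i, hi⟩
  · rintro ⟨h1, h2, h3⟩
    refine ⟨fun v => ?_, fun v => h2 _ _, fun v h => ?_⟩
    · obtain ⟨_, ⟨i, rfl, hi⟩, h⟩ := h1 (v 0)
      refine ⟨i, ⟨i, rfl, hi⟩, fun j hj => j.2 (Fin.ext ?_)⟩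
      exact_mod_cast h _ hj
    · obtain ⟨_, ⟨⟨i, rfl, hi⟩, h'⟩ | ⟨h', i, rfl, hi⟩⟩ := h3 _ _ h
      · exact ⟨i, .inl ⟨⟨i, rfl, hi⟩, h'⟩⟩
      · exact ⟨i, .inr ⟨h', i, rfl, hi⟩⟩

theorem models_simplyConnectedAxiom {l r p q : ℤ} {k : ℕ} {a b : Vertex (Fin 4)} :
    M ⊨ simplyConnectedAxiom N l r p q k a b ↔ ∀ v : Fin 4 → M,
      VLevel N l (a.map v) → VLevel N r (b.map v) → Beneath N Set.univ (a.map v) (b.map v) →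
      v 2 ∈ Strip N p q ∩ Between N Set.univ (a.map v) (b.map v) →
      v 3 ∈ Strip N p q ∩ Between N Set.univ (a.map v) (b.map v) →
      PathIn N (Strip N p q ∩ {z | Vertex.real z ≠ a.map v ∧ Vertex.real z ≠ b.map v})
        k (v 2) (v 3) →
      ∃ k' ≤ k, PathIn N (Strip N p q ∩ Between N Set.univ (a.map v) (b.map v)) k' (v 2) (v 3) := by
  simp only [simplyConnectedAxiom, realize_close, Formula.realize_imp, Formula.realize_inf,
    realize_vLevelF, realize_beneathF, realize_betweenF, realize_stripF, realize_pathF,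
    Formula.realize_iSup, realize_neF, Vertex.map_map, Sum.elim_comp_inl, Sum.elim_inr, and_imp,
    Set.mem_inter_iff, Set.mem_ofPred_eq, PathIn]
  refine forall_congr' fun v => ?_
  constructor
  · intro h h1 h2 h3 h4 h5 h6 h7 h8
    obtain ⟨k', h9⟩ := h h1 h2 h3 h4 h5 h6 h7 h8
    exact ⟨k', Nat.lt_succ_iff.1 k'.2, h9⟩
  · intro h h1 h2 h3 h4 h5 h6 h7 h8
    obtain ⟨k', hk', h9⟩ := h h1 h2 h3 h4 h5 h6 h7 h8
    exact ⟨⟨k', Nat.lt_succ_iff.2 hk'⟩, h9⟩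

theorem models_farPathAxiom {l : ℤ} {m n d : ℕ} {a b : Vertex (Fin d)} :
    M ⊨ farPathAxiom N l m n d a b ↔ ∀ v : Fin d → M,
      VLevel N l (a.map v) → VLevel N (l + m + 2) (b.map v) →
      Beneath N Set.univ (a.map v) (b.map v) →
      ∃ c : Fin (m + 1) → M,
        (∀ j : Fin (m + 1), Level N (l + 1 + (j : ℕ)) (c j)) ∧
        VAdj N (a.map v) (.real (c 0)) ∧ VAdj N (.real (c (Fin.last m))) (b.map v) ∧
        (∀ j : Fin m, Adj N (c j.castSucc) (c j.succ)) ∧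
        ∀ x, v x ∈ Strip N (l + 1) (l + m + 1) →
          ∀ j, ∀ k ≤ n, ¬ PathIn N (Strip N (l + 1) (l + m + 1)) k (c j) (v x) := by
  simp only [farPathAxiom, realize_close, Formula.realize_imp, Formula.realize_inf,
    realize_vLevelF, realize_beneathF, realize_stripF, realize_pathF, Formula.realize_iExs,
    Formula.realize_iInf, realize_levelF, realize_vAdjF, realize_adjF, Formula.realize_not,
    Vertex.map_map, Sum.elim_comp_inl, Sum.elim_inr, Sum.elim_inl, and_imp, PathIn]
  refine forall_congr' fun v => forall_congr' fun _ => forall_congr' fun _ => forall_congr' fun _ =>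
    exists_congr fun c => ?_
  simp only [Vertex.map, Sum.elim_inr, and_assoc, Fin.forall_iff, Nat.lt_succ_iff]

/-- A structure is a model of the theory if and only if it is a simply connected colored `N`-space
with arbitrarily far paths. -/
theorem models_PS_iff :
    M ⊨ PS N ↔ IsColoredSpace N M ∧ SimplyConnected N M ∧ ArbitrarilyFarPaths N M := by
  rw [PS, Theory.model_union_iff, Theory.model_union_iff, models_coloredSpaceAxioms, and_assoc]
  refine and_congr_right fun _ => and_congr ?_ ?_
  · rw [Theory.model_iff]
    constructor
    · intro h l r p q hl hlr hr hp hpq hq a b ha hb hab x y hx hy k hk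
      let a' : Vertex (Fin 4) := a.map fun _ => 0
      let b' : Vertex (Fin 4) := b.map fun _ => 1
      let va : M := match a with | .real z => z | _ => x
      let vb : M := match b with | .real z => z | _ => x
      have ea : a'.map ![va, vb, x, y] = a := by cases a <;> rfl
      have eb : b'.map ![va, vb, x, y] = b := by cases b <;> rfl
      have := models_simplyConnectedAxiom.1
        (h _ ⟨l, r, p, q, k, a', b', hl, hlr, hr, hp, hpq, hq, rfl⟩) ![va, vb, x, y]
      rw [ea, eb] at this
      exact this ha hb hab hx hy hk
    · rintro h _ ⟨l, r, p, q, k, a, b, hl, hlr, hr, hp, hpq, hq, rfl⟩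
      rw [models_simplyConnectedAxiom]
      intro v ha hb hab hx hy hk
      exact h l r p q hl hlr hr hp hpq hq _ _ ha hb hab _ _ hx hy k hk
  · rw [Theory.model_iff]
    constructor
    · intro h A hA l m hl hr a b haA hbA ha hb hab n
      obtain ⟨d, v, hv⟩ : ∃ (d : ℕ) (v : Fin d → M), Set.range v = A := by
        obtain ⟨d, e⟩ := hA.exists_finset_coe
        refine ⟨d.card, fun i => d.equivFin.symm i, ?_⟩
        rw [Set.range_comp' Subtype.val, d.equivFin.symm.surjective.range_eq, Set.image_univ,
          Subtype.range_coe_subtype]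
        exact e
      subst hv
      have key : ∀ a : Vertex M, a.Mem (Set.range v) → ∃ a' : Vertex (Fin d), a'.map v = a := by
        rintro (_ | x | _) hx
        · exact ⟨.bot, rfl⟩
        · obtain ⟨i, rfl⟩ := hx
          exact ⟨.real i, rfl⟩
        · exact ⟨.top, rfl⟩
      obtain ⟨a', rfl⟩ := key a haA
      obtain ⟨b', rfl⟩ := key b hbA
      obtain ⟨c, h1, h2, h3, h4, h5⟩ := models_farPathAxiom.1
        (h _ ⟨l, m, n, d, a', b', hl, hr, rfl⟩) v ha hb hab
      refine ⟨c, h1, h2, h3, h4, ?_⟩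
      rintro _ ⟨i, rfl⟩
      exact h5 i
    · rintro h _ ⟨l, m, n, d, a, b, hl, hr, rfl⟩
      rw [models_farPathAxiom]
      intro v ha hb hab
      have key : ∀ a : Vertex (Fin d), (a.map v).Mem (Set.range v) := by
        rintro (_ | x | _)
        exacts [trivial, ⟨x, rfl⟩, trivial]
      obtain ⟨c, h1, h2, h3, h4, h5⟩ := h _ (Set.finite_range v) l m hl hr _ _ (key a) (key b)
        ha hb hab n
      exact ⟨c, h1, h2, h3, h4, fun x => h5 _ ⟨x, rfl⟩⟩

end Realize

/-! ## Elementary partial isomorphisms -/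

/-- A partial isomorphism is elementary if it preserves the truth of all formulas. -/
def IsElementary {L : Language} {M M' : Type*} [L.Structure M] [L.Structure M']
    (f : M ≃ₚ[L] M') : Prop :=
  ∀ (n : ℕ) (φ : L.Formula (Fin n)) (x : Fin n → f.dom),
    φ.Realize (fun i => (x i : M)) ↔ φ.Realize (fun i => (f.toEquiv (x i) : M'))

end

end FreePseudospace

/-! The types of nice sets are determined because a model is built up from any nice set `D` by one
kind of step, the outcome of which is unique up to isomorphism. Let `a` lie beneath `b`, both in `D`
and possibly imaginary. A free path is a rising path from `a` to `b`, no interior vertex of which is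
connected to `D` on the levels strictly between those of `a` and `b`. Three facts carry the
argument.

(1) A vertex of `D` over an interior vertex of a free path is `b` or lies over `b`, and dually for
`a`. Hence the path is linked to `D` at its two ends only (`FreePath.adj_iff`), so that the
isomorphism type of `D` with the path depends on `D`, `a` and `b` alone, and this larger set is
again nice (`FreePath.nice`). Behind this is `UpConnected.connClosed_over`: simple connectedness
allows a path inside of `D` between vertices over `a` to be rerouted, still inside of `D`, so that
it stays over `a`.

(2) Every vertex of the model lies in an extension of `D` by finitely many free paths
(`Nice.exists_attach`), by induction on the length of the interval of levels between `a` and `b`.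

(3) If `a` lies beneath `b`, a free path between them exists in an elementary extension
(`exists_freePath`): an ultrapower turns the arbitrarily far paths of the second axiom into an
infinitely far one.

An isomorphism between nice sets can therefore be extended to any further vertex on one side, after
an elementary extension on the other side. Induction on formulas (`NiceIso.realize_iff`) gives (i)
and (iii). The empty set is nice, so any two models satisfy the same sentences.

For consistency a model is constructed from a single rising path from `bot` to `top`. Each step
adjoins, for every pair `e`, `f` with `e` beneath `f`, a new path between them. Walks between old
vertices fold back onto the old stage without becoming longer (`Node.collapse`), and a new vertex
has only one neighbour above and one below; this preserves simple connectedness. A new path is not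
connected to the old vertices on the levels strictly between its ends (`Node.New.not_walk`), which
gives the second axiom for all distances at once. -/

namespace FreePseudospace

/-! ## Walks -/

/-- There is a walk of length `k` from `x` to `y` along the relation `r`, with vertices in `S`. -/
inductive Walk {V : Type*} (r : V → V → Prop) (S : Set V) : ℕ → V → V → Prop
  | nil {x : V} : x ∈ S → Walk r S 0 x x
  | cons {k : ℕ} {x y z : V} : x ∈ S → r x y → Walk r S k y z → Walk r S (k + 1) x z

/-- `x` and `y` are connected along the relation `r` inside of `S`. -/
def Conn {V : Type*} (r : V → V → Prop) (S : Set V) (x y : V) : Prop :=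
  ∃ k, Walk r S k x y

section Walk

variable {V W : Type*} {r : V → V → Prop} {r' : W → W → Prop} {S S' : Set V} {S'' : Set W}
  {k j : ℕ} {x y z : V}

theorem Walk.left_mem (h : Walk r S k x y) : x ∈ S := by
  cases h <;> assumption

theorem Walk.right_mem (h : Walk r S k x y) : y ∈ S := by
  induction h with
  | nil h => exact h
  | cons _ _ _ ih => exact ih

theorem Walk.mono (hS : S ⊆ S') (h : Walk r S k x y) : Walk r S' k x y := by
  induction h with
  | nil h => exact .nil (hS h)
  | cons h h' _ ih => exact .cons (hS h) h' ih

theorem Walk.trans (h : Walk r S j x y) (h' : Walk r S k y z) : Walk r S (j + k) x z := by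
  induction h with
  | nil h => simpa using h'
  | @cons j x y w h1 h2 _ ih =>
    have := Walk.cons h1 h2 (ih h')
    rwa [show j + 1 + k = j + k + 1 by omega]

theorem Walk.single (hx : x ∈ S) (hy : y ∈ S) (h : r x y) : Walk r S 1 x y :=
  .cons hx h (.nil hy)

theorem Walk.symm (hr : ∀ ⦃x y⦄, r x y → r y x) (h : Walk r S k x y) : Walk r S k y x := by
  induction h with
  | nil h => exact .nil h
  | cons h1 h2 h3 ih => exact ih.trans (.single h3.left_mem h1 (hr h2))

/-- The image of a walk under a map which sends linked vertices to equal or linked vertices. -/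
theorem Walk.map (f : V → W) (hS : ∀ x ∈ S, f x ∈ S'')
    (hf : ∀ x ∈ S, ∀ y ∈ S, r x y → f x = f y ∨ r' (f x) (f y)) (h : Walk r S k x y) :
    ∃ k' ≤ k, Walk r' S'' k' (f x) (f y) := by
  induction h with
  | nil h => exact ⟨0, le_rfl, .nil (hS _ h)⟩
  | cons h1 h2 h3 ih =>
    obtain ⟨k', hk', h4⟩ := ih
    rcases hf _ h1 _ h3.left_mem h2 with h5 | h5
    · exact ⟨k', by omega, h5 ▸ h4⟩
    · exact ⟨k' + 1, by omega, .cons (hS _ h1) h5 h4⟩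

/-- The image of a walk under a map which sends linked vertices to linked vertices. -/
theorem Walk.map_hom (f : V → W) (hS : ∀ x ∈ S, f x ∈ S'')
    (hf : ∀ x ∈ S, ∀ y ∈ S, r x y → r' (f x) (f y)) (h : Walk r S k x y) :
    Walk r' S'' k (f x) (f y) := by
  induction h with
  | nil h => exact .nil (hS _ h)
  | cons h1 h2 h3 ih => exact .cons (hS _ h1) (hf _ h1 _ h3.left_mem h2) ih

/-- A walk starting in `C` either stays in `C` or leaves it at some point. -/
theorem Walk.exit (C : Set V) (h : Walk r S k x y) (hx : x ∈ C) :
    Walk r (S ∩ C) k x y ∨ ∃ u v i j, u ∈ C ∧ v ∉ C ∧ r u v ∧ i + j + 1 = k ∧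
      Walk r (S ∩ C) i x u ∧ Walk r S j v y := by
  induction h with
  | nil h => exact .inl (.nil ⟨h, hx⟩)
  | @cons k x y z h1 h2 h3 ih =>
    by_cases hy : y ∈ C
    · rcases ih hy with h4 | ⟨u, v, i, j, hu, hv, h4, h5, h6, h7⟩
      · exact .inl (.cons ⟨h1, hx⟩ h2 h4)
      · exact .inr ⟨u, v, i + 1, j, hu, hv, h4, by omega, .cons ⟨h1, hx⟩ h2 h6, h7⟩
    · exact .inr ⟨x, y, 0, k, hx, hy, h2, by omega, .nil ⟨h1, hx⟩, h3⟩

theorem Conn.left_mem (h : Conn r S x y) : x ∈ S := h.choose_spec.left_mem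

theorem Conn.right_mem (h : Conn r S x y) : y ∈ S := h.choose_spec.right_mem

theorem Conn.mono (hS : S ⊆ S') (h : Conn r S x y) : Conn r S' x y :=
  h.imp fun _ h => h.mono hS

theorem Conn.trans (h : Conn r S x y) (h' : Conn r S y z) : Conn r S x z :=
  ⟨_, h.choose_spec.trans h'.choose_spec⟩

theorem Conn.refl (h : x ∈ S) : Conn r S x x := ⟨0, .nil h⟩

theorem Conn.single (hx : x ∈ S) (hy : y ∈ S) (h : r x y) : Conn r S x y := ⟨1, .single hx hy h⟩

theorem Conn.symm (hr : ∀ ⦃x y⦄, r x y → r y x) (h : Conn r S x y) : Conn r S y x :=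
  h.imp fun _ h => h.symm hr

/-- A path from `x` to `a ≠ x` reaches a neighbour of `a` before it reaches `a`. -/
theorem Conn.before {a : V} (h : Conn r S x a) (hx : x ≠ a) :
    ∃ d, Conn r (S \ {a}) x d ∧ r d a := by
  obtain ⟨k, h⟩ := h
  rcases h.exit {a}ᶜ hx with h1 | ⟨u, v, i, j, -, hv, h1, -, h2, -⟩
  · exact absurd rfl h1.right_mem.2
  · obtain rfl : v = a := by simpa using hv
    exact ⟨u, ⟨i, h2⟩, h1⟩

/-- A path from `x` to `y` may be assumed to pass at most once through `f`. -/
theorem Conn.through (hr : ∀ ⦃x y⦄, r x y → r y x) {f : V} (h : Conn r S x y) (hx : x ≠ f)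
    (hy : y ≠ f) : Conn r (S \ {f}) x y ∨
      ∃ v w, Conn r (S \ {f}) x v ∧ r v f ∧ r w f ∧ Conn r (S \ {f}) w y := by
  obtain ⟨k, h⟩ := h
  rcases h.exit {f}ᶜ hx with h1 | ⟨u, v, i, j, -, hv, h1, -, h2, h3⟩
  · exact .inl ⟨k, h1⟩
  · obtain rfl : v = f := by simpa using hv
    obtain ⟨w, h4, h5⟩ := (Conn.symm hr ⟨j, h3⟩).before hy
    exact .inr ⟨u, w, ⟨i, h2⟩, h1, h5, h4.symm hr⟩

theorem pathIn_iff_walk {N : ℕ} {M : Type*} [(lang N).Structure M] {D : Set M} {k : ℕ} {x y : M} :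
    PathIn N D k x y ↔ Walk (Adj N) D k x y := by
  induction k generalizing x with
  | zero =>
    constructor
    · rintro ⟨c, h0, h1, h2, -⟩
      obtain rfl : x = y := by rw [← h0, ← h1]; rfl
      exact .nil (h0 ▸ h2 0)
    · intro h
      cases h with
      | nil h => exact ⟨fun _ => _, rfl, rfl, fun _ => h, fun i => i.elim0⟩
  | succ k ih =>
    constructor
    · rintro ⟨c, h0, h1, h2, h3⟩
      subst h0
      refine .cons (h2 0) (h3 0) (ih.1 ⟨fun i => c i.succ, rfl, h1, fun i => h2 _, fun i => h3 i.succ⟩)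
    · intro h
      cases h with
      | cons h1 h2 h3 =>
        obtain ⟨c, h0, h4, h5, h6⟩ := ih.2 h3
        refine ⟨Fin.cons x c, rfl, ?_, Fin.cases h1 h5, Fin.cases ?_ fun i => ?_⟩
        · rw [← h4]; rfl
        · simpa [h0] using h2
        · have := h6 i
          simpa [Fin.castSucc_succ] using this

theorem exists_pathIn_iff_conn {N : ℕ} {M : Type*} [(lang N).Structure M] {D : Set M} {x y : M} :
    (∃ k, PathIn N D k x y) ↔ Conn (Adj N) D x y :=
  exists_congr fun _ => pathIn_iff_walk

end Walk

/-! ## Graded graphs -/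

/-- A graph with levels, whose edges are directed upwards. -/
structure Graded (V : Type*) where
  /-- `y` is linked to `x` and lies on the next level. -/
  up : V → V → Prop
  /-- The level of a vertex. -/
  lev : V → ℤ
  lev_up : ∀ {x y}, up x y → lev y = lev x + 1

namespace Graded

variable {V : Type*} (G : Graded V)

/-- The graph turned upside down. -/
def dual : Graded V where
  up x y := G.up y x
  lev x := -G.lev x
  lev_up h := by rw [G.lev_up h]; ring

/-- The edges of the graph. -/
def Link (x y : V) : Prop := G.up x y ∨ G.up y x

/-- There is a rising path from `x` to `y`, of positive length, inside of `S`. -/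
def Lt (S : Set V) : V → V → Prop :=
  Relation.TransGen fun x y => x ∈ S ∧ y ∈ S ∧ G.up x y

/-- The vertices with levels in `[p, q]`. -/
def band (p q : ℤ) : Set V := {x | p ≤ G.lev x ∧ G.lev x ≤ q}

/-- The vertices of `S` strictly between `a` and `b`. -/
def Ioo (S : Set V) (a b : V) : Set V := {x | G.Lt S a x ∧ G.Lt S x b}

variable {G} {S S' : Set V} {x y z a b : V} {p q : ℤ}

theorem Link.symm ⦃x y : V⦄ (h : G.Link x y) : G.Link y x := Or.symm h

theorem dual_link : G.dual.Link = G.Link := by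
  ext x y
  exact or_comm

theorem dual_lt : G.dual.Lt S x y ↔ G.Lt S y x := by
  rw [Lt, Lt, ← Relation.transGen_swap]
  have : (fun x y => x ∈ S ∧ y ∈ S ∧ G.dual.up x y) =
      Function.swap fun x y => x ∈ S ∧ y ∈ S ∧ G.up x y := by
    ext x y
    simp only [dual, Function.swap]
    tauto
  rw [this]

theorem dual_band : G.dual.band p q = G.band (-q) (-p) := by
  ext x
  simp only [band, dual, Set.mem_ofPred_eq]
  constructor <;> rintro ⟨h1, h2⟩ <;> constructor <;> linarith

theorem dual_Ioo : G.dual.Ioo S a b = G.Ioo S b a := by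
  ext x
  simp only [Ioo, dual_lt, Set.mem_ofPred_eq, and_comm]

theorem band_mono {p' q' : ℤ} (hp : p' ≤ p) (hq : q ≤ q') : G.band p q ⊆ G.band p' q' :=
  fun _ h => ⟨hp.trans h.1, h.2.trans hq⟩

theorem Lt.trans (h : G.Lt S x y) (h' : G.Lt S y z) : G.Lt S x z := Relation.TransGen.trans h h'

theorem Lt.single (hx : x ∈ S) (hy : y ∈ S) (h : G.up x y) : G.Lt S x y :=
  Relation.TransGen.single ⟨hx, hy, h⟩

theorem Lt.mono (hS : S ⊆ S') (h : G.Lt S x y) : G.Lt S' x y :=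
  Relation.TransGen.mono (fun _ _ h => ⟨hS h.1, hS h.2.1, h.2.2⟩) _ _ h

theorem Lt.left_mem (h : G.Lt S x y) : x ∈ S := by
  induction h using Relation.TransGen.head_induction_on with
  | single h => exact h.1
  | head h _ _ => exact h.1

theorem Lt.right_mem (h : G.Lt S x y) : y ∈ S := by
  cases h with
  | single h => exact h.2.1
  | tail _ h => exact h.2.1

/-- A rising path is a walk of length the difference of the levels. -/
theorem Lt.walk (h : G.Lt S x y) : ∃ k : ℕ, 0 < k ∧ G.lev y = G.lev x + k ∧
    Walk G.Link (S ∩ G.band (G.lev x) (G.lev y)) k x y := by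
  induction h with
  | single h =>
    have := G.lev_up h.2.2
    exact ⟨1, one_pos, by simp [this], .single ⟨h.1, by constructor <;> linarith⟩
      ⟨h.2.1, by constructor <;> linarith⟩ (.inl h.2.2)⟩
  | tail _ h ih =>
    obtain ⟨k, hk, h1, h2⟩ := ih
    have := G.lev_up h.2.2
    refine ⟨k + 1, by omega, by push_cast; linarith,
      (h2.mono (Set.inter_subset_inter_right _ (band_mono le_rfl (by linarith)))).trans
      (.single ⟨h.1, ?_⟩ ⟨h.2.1, ?_⟩ (.inl h.2.2))⟩
    · constructor <;> linarith
    · constructor <;> linarith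

theorem Lt.lev_lt (h : G.Lt S x y) : G.lev x < G.lev y := by
  obtain ⟨k, hk, h1, -⟩ := h.walk
  omega

theorem Lt.conn (h : G.Lt S x y) : Conn G.Link (S ∩ G.band (G.lev x) (G.lev y)) x y := by
  obtain ⟨k, -, -, h⟩ := h.walk
  exact ⟨k, h⟩

end Graded

theorem Walk.exists_finite {V : Type*} {r : V → V → Prop} {S : Set V} {k : ℕ} {x y : V}
    (h : Walk r S k x y) : ∃ F : Set V, F.Finite ∧ Walk r (S ∩ F) k x y := by
  induction h with
  | @nil x h => exact ⟨{x}, Set.finite_singleton x, .nil ⟨h, rfl⟩⟩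
  | @cons k x y z h1 h2 _ ih =>
    obtain ⟨F, hF, h3⟩ := ih
    exact ⟨insert x F, hF.insert x, .cons ⟨h1, Set.mem_insert _ _⟩ h2
      (h3.mono (Set.inter_subset_inter_right _ (Set.subset_insert _ _)))⟩

/-! ### Simple connectedness over one vertex, and connectedly closed sets -/

namespace Graded

variable {V : Type*} {G : Graded V}

variable (G) in
/-- Vertices over `a` which are connected by a path avoiding `a` with levels in `[p, q]`, all of
them at least the level of `a`, are connected by such a path over `a`. -/
def UpConnected (hi : ℤ) : Prop :=
  ∀ (a : V) (p q : ℤ), G.lev a ≤ p → q ≤ hi → ∀ x y : V, G.Lt Set.univ a x → G.Lt Set.univ a y →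
    Conn G.Link (G.band p q \ {a}) x y →
    Conn G.Link (G.band p q ∩ {z | G.Lt Set.univ a z}) x y

variable (G) in
/-- For each interval `[p, q]` of levels between `lo` and `hi`, any two vertices of `D` which are
connected by a path with levels in `[p, q]` are connected by such a path inside of `D`. -/
def ConnClosed (lo hi : ℤ) (D : Set V) : Prop :=
  ∀ p q : ℤ, lo ≤ p → q ≤ hi → ∀ x ∈ D, ∀ y ∈ D, Conn G.Link (G.band p q) x y →
    Conn G.Link (D ∩ G.band p q) x y

variable {lo hi : ℤ} {D : Set V}

/-- The intersection of a connectedly closed set with the set of vertices over some `a` is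
connectedly closed for intervals of levels above the level of `a`. -/
theorem UpConnected.connClosed_over (hU : G.UpConnected hi) (hD : G.ConnClosed lo hi D) {a : V}
    {p q : ℤ} (ha : G.lev a < p) (hp : lo ≤ p) (hq : q ≤ hi) {x y : V} (hx : x ∈ D) (hy : y ∈ D)
    (hax : G.Lt Set.univ a x) (hay : G.Lt Set.univ a y) (h : Conn G.Link (G.band p q) x y) :
    Conn G.Link (D ∩ G.band p q ∩ {z | G.Lt Set.univ a z}) x y := by
  obtain ⟨n, hn⟩ : ∃ n : ℕ, q - p < n := ⟨(q - p + 1).toNat, by omega⟩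
  induction n generalizing p x y with
  | zero =>
    have := h.left_mem
    exact absurd (this.1.trans this.2) (by push_cast at hn; linarith)
  | succ n ih =>
    set T := D ∩ G.band p q ∩ {z | G.Lt Set.univ a z} with hT
    -- The bad vertices are those of level `p` which do not lie over `a`. `B F` admits only the bad
    -- vertices in `F`; a path contains finitely many of them, and they are removed one at a time.
    let B : Set V → Set V := fun F =>
      D ∩ G.band p q ∩ {z | G.lev z = p → G.Lt Set.univ a z ∨ z ∈ F}
    have key : ∀ F : Set V, F.Finite → Conn G.Link (B F) x y → Conn G.Link (B ∅) x y := by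
      intro F hF
      induction F, hF using Set.Finite.induction_on with
      | empty => exact id
      | @insert f F _ _ ihF =>
        intro hc
        apply ihF
        by_cases hf : G.lev f = p ∧ ¬ G.Lt Set.univ a f
        · obtain ⟨hf1, hf2⟩ := hf
          have hsub : B (insert f F) \ {f} ⊆ B F := by
            rintro z ⟨⟨h1, h2⟩, h3⟩
            refine ⟨h1, fun h4 => (h2 h4).imp_right fun h5 => ?_⟩
            exact (Set.mem_insert_iff.1 h5).resolve_left h3
          have hsub' : B (insert f F) \ {f} ⊆ G.band p q \ {f} := fun z hz => ⟨hz.1.1.2, hz.2⟩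
          have hxf : x ≠ f := by rintro rfl; exact hf2 hax
          have hyf : y ≠ f := by rintro rfl; exact hf2 hay
          rcases hc.through Link.symm hxf hyf with h1 | ⟨v, w, h1, h2, h3, h4⟩
          · exact h1.mono hsub
          · have up : ∀ v ∈ G.band p q, G.Link v f → G.up f v := by
              rintro v hv (h | h)
              · have := G.lev_up h
                have := hv.1
                omega
              · exact h
            have hv := up v h1.right_mem.1.1.2 h2
            have hw := up w h4.left_mem.1.1.2 h3
            -- Since `x` and `y` are connected over `a`, they are connected without `f`, and so are
            -- the neighbours `v` and `w` of `f`. Simple connectedness over `f` joins `v` and `w` on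
            -- levels above `p`, and `D` is closed for these levels. The resulting detour replaces
            -- `f` and brings in no new vertex of level `p`.
            have hxy : Conn G.Link (G.band p q \ {f}) x y := by
              refine Conn.mono ?_ (hU a p q ha.le hq x y hax hay (h.mono ?_))
              · rintro z ⟨h5, h6⟩
                exact ⟨h5, fun h7 => hf2 (by rwa [← show z = f from h7])⟩
              · rintro z hz
                refine ⟨hz, ?_⟩
                rintro rfl
                exact (ha.trans_le hz.1).false
            have hvw := hU f p q hf1.le hq v w (.single trivial trivial hv)
              (.single trivial trivial hw)
              (((h1.mono hsub').symm Link.symm).trans (hxy.trans ((h4.mono hsub').symm Link.symm)))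
            have hvw' := hD (p + 1) q (by omega) hq v h1.right_mem.1.1.1 w h4.left_mem.1.1.1
              (hvw.mono fun z hz => ⟨by have := Lt.lev_lt hz.2; omega, hz.1.2⟩)
            refine ((h1.mono hsub).trans (hvw'.mono ?_)).trans (h4.mono hsub)
            rintro z ⟨h5, h6⟩
            exact ⟨⟨h5, band_mono (by omega) le_rfl h6⟩, fun h7 => absurd h6.1 (by omega)⟩
        · refine hc.mono ?_
          rintro z ⟨h1, h2⟩
          refine ⟨h1, fun h3 => ?_⟩
          rcases h2 h3 with h4 | h4
          · exact .inl h4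
          · rcases Set.mem_insert_iff.1 h4 with rfl | h4
            · exact .inl (by_contra fun h5 => hf ⟨h3, h5⟩)
            · exact .inr h4
    have hB : Conn G.Link (B ∅) x y := by
      obtain ⟨k, hk⟩ := hD p q hp hq x hx y hy h
      obtain ⟨F, hF, hk⟩ := hk.exists_finite
      exact key F hF ⟨k, hk.mono fun z hz => ⟨hz.1, fun _ => .inr hz.2⟩⟩
    obtain ⟨k, hk⟩ := hB
    clear h hx key
    have hBD : ∀ z ∈ B ∅, G.lev z = p → G.Lt Set.univ a z := fun z hz h =>
      (hz.2 h).resolve_right (Set.notMem_empty z)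
    -- Segments on the levels above `p` with ends over `a` fall under the induction hypothesis for
    -- `[p + 1, q]`.
    have high : ∀ {j : ℕ} {x u : V}, Walk G.Link (B ∅ ∩ {z | G.lev z ≠ p}) j x u →
        G.Lt Set.univ a x → G.Lt Set.univ a u → Conn G.Link T x u := by
      intro j x u h1 h2 h3
      refine (ih (p := p + 1) (by omega) (by omega) h1.left_mem.1.1.1 h1.right_mem.1.1.1 h2 h3
        ⟨j, h1.mono ?_⟩ (by push_cast at hn ⊢; omega)).mono ?_
      · rintro z ⟨⟨⟨-, h4⟩, -⟩, h5⟩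
        exact ⟨by have := h4.1; have : G.lev z ≠ p := h5; omega, h4.2⟩
      · rintro z ⟨⟨h4, h5⟩, h6⟩
        exact ⟨⟨h4, band_mono (by omega) le_rfl h5⟩, h6⟩
    -- The path is cut at its vertices of level `p`. These now lie over `a`, and so do their
    -- neighbours in the band, which are on level `p + 1`.
    induction k using Nat.strong_induction_on generalizing x with
    | _ k ihk =>
      by_cases hxp : G.lev x = p
      · cases hk with
        | nil h => exact .refl ⟨h.1, hax⟩
        | @cons k x x' y h1 h2 h3 =>
          have hup : G.up x x' := by
            rcases h2 with h2 | h2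
            · exact h2
            · have := G.lev_up h2
              have := h3.left_mem.1.2.1
              omega
          have hax' := hax.trans (Lt.single trivial trivial hup)
          exact Conn.trans (Conn.single ⟨h1.1, hax⟩ ⟨h3.left_mem.1, hax'⟩ h2)
            (ihk k (by omega) hax' h3)
      · rcases hk.exit {z | G.lev z ≠ p} hxp with h1 | ⟨u, v, i, j, hu, hv, h1, h2, h3, h4⟩
        · exact high h1 hax hay
        · have hv' : G.lev v = p := not_not.1 hv
          have hav := hBD v h4.left_mem hv'
          have hup : G.up v u := by
            rcases h1 with h1 | h1
            · have := G.lev_up h1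
              have := h3.right_mem.1.1.2.1
              omega
            · exact h1
          have hau := hav.trans (Lt.single trivial trivial hup)
          exact (high h3 hax hau).trans (Conn.trans (Conn.single ⟨h3.right_mem.1.1, hau⟩
            ⟨h4.left_mem.1, hav⟩ h1) (ihk j (by omega) hav h4))

/-- If `b ∈ D` lies over `x` and `x` is not connected to `D` by a path with levels smaller than
that of `b`, then `b` lies beneath each other vertex of `D` over `x`. -/
theorem UpConnected.eq_or_lt (hU : G.UpConnected hi) (hD : G.ConnClosed lo hi D) {x b : V}
    (hx : lo ≤ G.lev x) (hb : b ∈ D) (hxb : G.Lt Set.univ x b)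
    (hfar : ∀ y ∈ D, ¬ Conn G.Link (G.band (G.lev x) (G.lev b - 1)) x y) {y : V} (hy : y ∈ D)
    (hxy : G.Lt Set.univ x y) (hyhi : G.lev y ≤ hi) : y = b ∨ G.Lt Set.univ b y := by
  have hxD : x ∉ D := fun h => hfar x h (.refl ⟨le_rfl, by have := hxb.lev_lt; omega⟩)
  have hylev : ∀ y ∈ D, G.Lt Set.univ x y → G.lev b ≤ G.lev y := by
    intro y hy hxy
    by_contra h
    exact hfar y hy (hxy.conn.mono fun z hz => band_mono le_rfl (by omega) hz.2)
  obtain ⟨m, hm⟩ : ∃ m : ℕ, G.lev y < G.lev b + m := ⟨(G.lev y - G.lev b + 1).toNat, by omega⟩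
  induction m generalizing y with
  | zero => exact absurd (hylev y hy hxy) (by push_cast at hm; omega)
  | succ m ih =>
    by_cases hyb : y = b
    · exact .inl hyb
    · have h1 := hylev y hy hxy
      -- The path goes from `b` down to `x` and up to `y`. It can be moved into `D`, where it misses
      -- `x` because `x ∉ D`; hence it can be moved over `x`, and finally into the part of `D` over
      -- `x`.
      have h2 : Conn G.Link (G.band (G.lev x) (G.lev y)) b y :=
        ((hxb.conn.mono fun z hz => band_mono le_rfl h1 hz.2).symm Link.symm).trans
          (hxy.conn.mono fun z hz => hz.2)
      have h3 := hD _ _ hx hyhi b hb y hy h2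
      have h4 := hU x _ _ le_rfl hyhi b y hxb hxy
        (h3.mono fun z hz => ⟨hz.2, fun h => hxD (by rw [← show z = x from h]; exact hz.1)⟩)
      have h5 := hU.connClosed_over hD (lt_add_one _) (by omega) hyhi hb hy hxb hxy
        (h4.mono fun z hz => ⟨by have := Lt.lev_lt hz.2; omega, hz.1.2⟩)
      -- The level of `y` bounds the band from above, so the last vertex before `y` lies one level
      -- below `y`, and the induction hypothesis applies to it.
      obtain ⟨y', h6, h7⟩ := h5.before (Ne.symm hyb)
      obtain ⟨⟨⟨h8, h9⟩, h10⟩, -⟩ := h6.right_mem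
      have hup : G.up y' y := by
        rcases h7 with h7 | h7
        · exact h7
        · have := G.lev_up h7
          have := h9.2
          omega
      have := G.lev_up hup
      have hlt : G.Lt Set.univ y' y := .single trivial trivial hup
      rcases ih h8 h10 (by omega) (by push_cast at hm; omega)
        with rfl | h11
      · exact .inr hlt
      · exact .inr (h11.trans hlt)

end Graded

/-! ### Rising paths indexed by their levels -/

namespace Graded

variable {V : Type*} {G : Graded V} {S : Set V} {a b x : V}

/-- A rising path, as a function of the level. -/
theorem Lt.exists_path (h : G.Lt S a b) : ∃ f : ℤ → V, f (G.lev a) = a ∧ f (G.lev b) = b ∧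
    (∀ i, G.lev a ≤ i → i ≤ G.lev b → f i ∈ S ∧ G.lev (f i) = i) ∧
    ∀ i, G.lev a ≤ i → i < G.lev b → G.up (f i) (f (i + 1)) := by
  classical
  induction h with
  | @single b h =>
    have := G.lev_up h.2.2
    refine ⟨fun i => if i = G.lev a then a else b, by simp, by simp [this], fun i h1 h2 => ?_,
      fun i h1 h2 => ?_⟩
    · dsimp only
      split_ifs with h3
      · exact ⟨h.1, h3.symm⟩
      · exact ⟨h.2.1, by omega⟩
    · obtain rfl : i = G.lev a := by omega
      simpa using h.2.2
  | @tail b c h1 h ih =>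
    have hab := Lt.lev_lt h1
    have := G.lev_up h.2.2
    obtain ⟨f, hfa, hfb, hf, hf'⟩ := ih
    refine ⟨fun i => if i = G.lev c then c else f i, ?_, by simp, fun i h1 h2 => ?_,
      fun i h1 h2 => ?_⟩
    · dsimp only
      rw [if_neg (by omega), hfa]
    · dsimp only
      split_ifs with h3
      · exact ⟨h.2.1, h3.symm⟩
      · exact hf i h1 (by omega)
    · by_cases h3 : i = G.lev b
      · subst h3
        simpa [this, hfb] using h.2.2
      · dsimp only
        rw [if_neg (by omega), if_neg (by omega)]
        exact hf' i h1 (by omega)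

theorem lt_of_path {f : ℤ → V} {i j : ℤ} (hij : i < j) (hf : ∀ m, i ≤ m → m ≤ j → f m ∈ S)
    (hf' : ∀ m, i ≤ m → m < j → G.up (f m) (f (m + 1))) : G.Lt S (f i) (f j) := by
  obtain ⟨n, rfl⟩ : ∃ n : ℕ, j = i + 1 + n := ⟨(j - i - 1).toNat, by omega⟩
  induction n with
  | zero =>
    simpa using Lt.single (G := G) (hf i le_rfl hij.le) (hf (i + 1) (by omega) (by simp))
      (hf' i le_rfl hij)
  | succ n ih =>
    refine (ih (by omega) (fun m h1 h2 => hf m h1 (by omega)) fun m h1 h2 =>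
      hf' m h1 (by omega)).trans ?_
    have := Lt.single (hf (i + 1 + n) (by omega) (by omega)) (hf (i + 1 + n + 1) (by omega)
      (by push_cast; omega)) (hf' (i + 1 + n) (by omega) (by push_cast; omega))
    rwa [add_assoc (i + 1) (n : ℤ) 1] at this

end Graded

/-! ### The graded graph of a colored space -/

section Vertices

variable {N : ℕ} {M : Type*} [(lang N).Structure M]

theorem IsColoredSpace.existsUnique_vLevel (hM : IsColoredSpace N M) (v : Vertex M) :
    ∃! i : ℤ, VLevel N i v := by
  cases v with
  | bot => exact ⟨-1, rfl, fun _ h => h⟩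
  | real x => exact hM.existsUnique_level x
  | top => exact ⟨N + 1, rfl, fun _ h => h⟩

/-- The graph of the possibly imaginary vertices of a colored space. -/
noncomputable def IsColoredSpace.graph (hM : IsColoredSpace N M) : Graded (Vertex M) where
  up u v := VAdj N u v ∧ (hM.existsUnique_vLevel v).choose = (hM.existsUnique_vLevel u).choose + 1
  lev v := (hM.existsUnique_vLevel v).choose
  lev_up h := h.2

namespace IsColoredSpace

variable (hM : IsColoredSpace N M)

theorem vLevel_iff {i : ℤ} {v : Vertex M} : VLevel N i v ↔ hM.graph.lev v = i := by
  have h := (hM.existsUnique_vLevel v).choose_spec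
  constructor
  · intro h'
    exact (h.2 i h').symm
  · rintro rfl
    exact h.1

theorem level_iff {i : ℤ} {x : M} : Level N i x ↔ hM.graph.lev (.real x) = i :=
  hM.vLevel_iff (v := .real x)

theorem lev_bot : hM.graph.lev .bot = -1 := hM.vLevel_iff.1 rfl

theorem lev_top : hM.graph.lev .top = N + 1 := hM.vLevel_iff.1 rfl

theorem lev_real (x : M) : 0 ≤ hM.graph.lev (.real x) ∧ hM.graph.lev (.real x) ≤ N := by
  obtain ⟨j, hj, -⟩ := hM.level_iff.2 (rfl : _ = hM.graph.lev (.real x))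
  have := j.2
  omega

theorem lev_mem (v : Vertex M) : -1 ≤ hM.graph.lev v ∧ hM.graph.lev v ≤ N + 1 := by
  cases v with
  | bot => rw [lev_bot]; omega
  | real x => have := hM.lev_real x; omega
  | top => rw [lev_top]; omega

theorem exists_real {v : Vertex M} (h0 : 0 ≤ hM.graph.lev v) (hN : hM.graph.lev v ≤ N) :
    ∃ x, v = .real x := by
  cases v with
  | bot => rw [lev_bot] at h0; omega
  | real x => exact ⟨x, rfl⟩
  | top => rw [lev_top] at hN; omega

theorem strip_iff {p q : ℤ} {x : M} : x ∈ Strip N p q ↔ .real x ∈ hM.graph.band p q := by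
  simp [Strip, Graded.band, hM.level_iff]

include hM in
theorem vAdj_symm {u v : Vertex M} (h : VAdj N u v) : VAdj N v u := by
  cases u <;> cases v <;> simp only [VAdj] at h ⊢ <;> first | assumption | exact hM.adj_symm _ _ h

theorem up_iff {u v : Vertex M} :
    hM.graph.up u v ↔ VAdj N u v ∧ hM.graph.lev v = hM.graph.lev u + 1 := Iff.rfl

theorem link_iff {u v : Vertex M} : hM.graph.Link u v ↔ VAdj N u v := by
  constructor
  · rintro (h | h)
    exacts [h.1, hM.vAdj_symm h.1]
  · intro h
    have key : hM.graph.lev v = hM.graph.lev u + 1 ∨ hM.graph.lev u = hM.graph.lev v + 1 := by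
      cases u <;> cases v <;> simp only [VAdj, hM.level_iff] at h <;>
        first
        | exact h.elim
        | (rw [lev_bot, h]; omega)
        | (rw [lev_top, h]; omega)
        | skip
      obtain ⟨i, h | h⟩ := hM.level_of_adj _ _ h <;> simp only [hM.level_iff] at h <;> omega
    rcases key with h' | h'
    exacts [.inl ⟨h, h'⟩, .inr ⟨hM.vAdj_symm h, h'⟩]

theorem real_link_real {x y : M} : hM.graph.Link (.real x) (.real y) ↔ Adj N x y := hM.link_iff

/-- The image of a path in `M` as a walk through possibly imaginary vertices. -/
theorem conn_real {D : Set M} {S : Set (Vertex M)} (hS : ∀ x ∈ D, .real x ∈ S) {x y : M}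
    (h : Conn (Adj N) D x y) : Conn hM.graph.Link S (.real x) (.real y) := by
  obtain ⟨k, h⟩ := h
  exact ⟨k, h.map_hom _ hS fun _ _ _ _ h => hM.real_link_real.2 h⟩

theorem walk_of_real {D : Set M} {S : Set (Vertex M)} (hS : ∀ v ∈ S, ∃ x ∈ D, v = .real x)
    {x y : M} {k : ℕ} (h : Walk hM.graph.Link S k (.real x) (.real y)) : Walk (Adj N) D k x y := by
  refine h.map_hom (fun v => match v with | .real z => z | _ => x) ?_ ?_
  · intro v hv
    obtain ⟨z, hz, rfl⟩ := hS v hv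
    exact hz
  · intro v hv w hw h
    obtain ⟨z, hz, rfl⟩ := hS v hv
    obtain ⟨t, ht, rfl⟩ := hS w hw
    exact hM.real_link_real.1 h

theorem conn_of_real {D : Set M} {S : Set (Vertex M)} (hS : ∀ v ∈ S, ∃ x ∈ D, v = .real x)
    {x y : M} (h : Conn hM.graph.Link S (.real x) (.real y)) : Conn (Adj N) D x y :=
  h.imp fun _ h => hM.walk_of_real hS h

theorem beneath_real_iff {D : Set M} {x y : M} :
    Beneath N D (.real x) (.real y) ↔
      hM.graph.Lt (Vertex.real '' D) (.real x) (.real y) := by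
  constructor
  · rintro ⟨l, k, hk, c, rfl, rfl, h1, h2⟩
    have h3 : ∀ i : Fin k, hM.graph.up (.real (c i.castSucc)) (.real (c i.succ)) := by
      intro i
      refine ⟨h2 i, ?_⟩
      have e1 := hM.level_iff.1 (h1 i.castSucc).2
      have e2 := hM.level_iff.1 (h1 i.succ).2
      change hM.graph.lev _ = hM.graph.lev _ + 1
      rw [e1, e2]
      simp [add_assoc]
    have h4 : ∀ i : Fin (k + 1), i = 0 ∨
        hM.graph.Lt (Vertex.real '' D) (.real (c 0)) (.real (c i)) := by
      intro i
      induction i using Fin.induction with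
      | zero => exact .inl rfl
      | succ i ih =>
        have h5 := Graded.Lt.single (Set.mem_image_of_mem _ (h1 i.castSucc).1)
          (Set.mem_image_of_mem _ (h1 i.succ).1) (h3 i)
        rcases ih with ih | ih
        · rw [ih] at h5
          exact .inr h5
        · exact .inr (ih.trans h5)
    refine (h4 (Fin.last k)).resolve_left fun h => ?_
    have := congrArg Fin.val h
    simp at this
    omega
  · intro h
    obtain ⟨f, hx, hy, h1, h2⟩ := h.exists_path
    have hlt := h.lev_lt
    obtain ⟨k, hk⟩ : ∃ k : ℕ, hM.graph.lev (.real y) = hM.graph.lev (.real x) + k :=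
      ⟨(hM.graph.lev (.real y) - hM.graph.lev (.real x)).toNat, by omega⟩
    rw [hk] at hy h1 h2
    generalize hM.graph.lev (.real x) = l at *
    have h3 : ∀ i : Fin (k + 1), ∃ z ∈ D, f (l + (i : ℕ)) = .real z := by
      intro i
      have := i.2
      obtain ⟨⟨z, hz, hz'⟩, -⟩ := h1 (l + (i : ℕ)) (by omega) (by omega)
      exact ⟨z, hz, hz'.symm⟩
    choose c hc hc' using h3
    refine ⟨l, k, by omega, c, ?_, ?_, fun i => ⟨hc i, ?_⟩, fun i => ?_⟩
    · have := hc' 0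
      simp [hx] at this
      exact this.symm
    · have := hc' (Fin.last k)
      simp [hy] at this
      exact this.symm
    · have := i.2
      rw [hM.level_iff, ← hc']
      exact (h1 _ (by omega) (by omega)).2
    · have := i.2
      have h4 := (h2 (l + (i : ℕ)) (by omega) (by omega)).1
      have e1 := hc' i.castSucc
      have e2 := hc' i.succ
      simp only [Fin.val_castSucc, Fin.val_succ, Nat.cast_add, Nat.cast_one, ← add_assoc] at e1 e2
      rw [e1, e2] at h4
      exact h4

theorem lt_real_of_univ {x y : M} (h : hM.graph.Lt Set.univ (.real x) (.real y)) :
    hM.graph.Lt (Vertex.real '' Set.univ) (.real x) (.real y) := by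
  obtain ⟨f, hx, hy, h1, h2⟩ := h.exists_path
  rw [← hx, ← hy]
  refine Graded.lt_of_path h.lev_lt (fun m h3 h4 => ?_) h2
  have := (h1 m h3 h4).2
  obtain ⟨z, hz⟩ := hM.exists_real (v := f m) (by have := (hM.lev_real x).1; omega)
    (by have := (hM.lev_real y).2; omega)
  exact ⟨z, trivial, hz.symm⟩

variable (hf : ArbitrarilyFarPaths N M)

-- For `Beneath` it is a convention that `bot` lies beneath every real vertex. An actual rising path
-- is supplied by the axiom on far paths, except on level `0`, which is linked to `bot`.
include hf in
theorem bot_lt_real (x : M) : hM.graph.Lt Set.univ .bot (.real x) := by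
  have hx := hM.lev_real x
  obtain ⟨n, hn⟩ : ∃ n : ℕ, hM.graph.lev (.real x) = n := ⟨_, (Int.toNat_of_nonneg hx.1).symm⟩
  cases n with
  | zero => exact .single trivial trivial ⟨hM.level_iff.2 hn, by
      change hM.graph.lev _ = hM.graph.lev _ + 1; rw [hn, lev_bot]; rfl⟩
  | succ m =>
    obtain ⟨c, h1, h2, h3, h4, -⟩ := hf {x} (Set.finite_singleton x) (-1) m (by omega) (by omega)
      .bot (.real x) trivial rfl rfl (hM.level_iff.2 (by rw [hn]; push_cast; ring)) trivial 0
    have e : ∀ j, hM.graph.lev (.real (c j)) = (j : ℕ) := fun j => by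
      rw [hM.level_iff.1 (h1 j)]; ring
    have h5 : ∀ j, hM.graph.Lt Set.univ .bot (.real (c j)) := by
      intro j
      induction j using Fin.induction with
      | zero => exact .single trivial trivial ⟨h2, by
          change hM.graph.lev _ = hM.graph.lev _ + 1; rw [e, lev_bot]; rfl⟩
      | succ j ih => exact ih.trans (.single trivial trivial ⟨h4 j, by
          change hM.graph.lev _ = hM.graph.lev _ + 1; rw [e, e]; simp⟩)
    exact (h5 (Fin.last m)).trans (.single trivial trivial ⟨h3, by
      change hM.graph.lev _ = hM.graph.lev _ + 1; rw [e, hn]; simp⟩)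

include hf in
theorem real_lt_top (x : M) : hM.graph.Lt Set.univ (.real x) .top := by
  have hx := hM.lev_real x
  obtain ⟨n, hn⟩ : ∃ n : ℕ, hM.graph.lev (.real x) + n = N :=
    ⟨(N - hM.graph.lev (.real x)).toNat, by omega⟩
  cases n with
  | zero => exact .single trivial trivial ⟨hM.level_iff.2 (by simpa using hn), by
      change hM.graph.lev _ = hM.graph.lev _ + 1; rw [lev_top, ← hn]; simp⟩
  | succ m =>
    obtain ⟨c, h1, h2, h3, h4, -⟩ := hf {x} (Set.finite_singleton x) (hM.graph.lev (.real x)) m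
      (by omega) (by push_cast at hn; omega)
      (.real x) .top rfl trivial (hM.level_iff.2 rfl) (by simp [VLevel, ← hn]; ring) trivial 0
    have e : ∀ j, hM.graph.lev (.real (c j)) = _ := fun j => hM.level_iff.1 (h1 j)
    have h5 : ∀ j, hM.graph.Lt Set.univ (.real x) (.real (c j)) := by
      intro j
      induction j using Fin.induction with
      | zero => exact .single trivial trivial ⟨h2, by
          change hM.graph.lev _ = hM.graph.lev _ + 1; rw [e]; simp⟩
      | succ j ih => exact ih.trans (.single trivial trivial ⟨h4 j, by
          change hM.graph.lev _ = hM.graph.lev _ + 1; rw [e, e]; simp; ring⟩)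
    exact (h5 (Fin.last m)).trans (.single trivial trivial ⟨h3, by
      change hM.graph.lev _ = hM.graph.lev _ + 1; rw [e, lev_top, ← hn]; simp; ring⟩)

end IsColoredSpace

end Vertices

/-! ### Simple connectedness and nice sets in the graded graph -/

section NiceSets

variable {N : ℕ} {M : Type*} [(lang N).Structure M]

namespace IsColoredSpace

variable (hM : IsColoredSpace N M) (hs : SimplyConnected N M) (hf : ArbitrarilyFarPaths N M)

include hf in
theorem bot_lt {v : Vertex M} (h : 0 ≤ hM.graph.lev v) (h' : hM.graph.lev v ≤ N) :
    hM.graph.Lt Set.univ .bot v := by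
  obtain ⟨x, rfl⟩ := hM.exists_real h h'
  exact hM.bot_lt_real hf x

include hf in
theorem lt_top {v : Vertex M} (h : 0 ≤ hM.graph.lev v) (h' : hM.graph.lev v ≤ N) :
    hM.graph.Lt Set.univ v .top := by
  obtain ⟨x, rfl⟩ := hM.exists_real h h'
  exact hM.real_lt_top hf x

include hf in
theorem beneath_iff_of_real {u v : Vertex M} (h : ∃ x, u = .real x ∨ v = .real x) :
    Beneath N Set.univ u v ↔ hM.graph.Lt Set.univ u v := by
  have hlev : ∀ {u v}, hM.graph.lev v ≤ hM.graph.lev u → ¬ hM.graph.Lt Set.univ u v :=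
    fun h h' => absurd h'.lev_lt (by omega)
  cases u with
  | bot =>
    cases v with
    | bot => simp at h
    | real x => exact iff_of_true trivial (hM.bot_lt_real hf x)
    | top => simp at h
  | real x =>
    cases v with
    | bot => exact iff_of_false id (hlev (by have := hM.lev_real x; rw [lev_bot]; omega))
    | real y =>
      rw [hM.beneath_real_iff]
      exact ⟨Graded.Lt.mono (Set.subset_univ _), hM.lt_real_of_univ⟩
    | top => exact iff_of_true trivial (hM.real_lt_top hf x)
  | top =>
    cases v with
    | bot => simp at h
    | real x => exact iff_of_false id (hlev (by have := hM.lev_real x; rw [lev_top]; omega))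
    | top => simp at h

include hs hf in
/-- Simple connectedness for possibly imaginary vertices, without the bound on the lengths. -/
theorem conn_Ioo {a b : Vertex M} {p q : ℤ} (hp : hM.graph.lev a ≤ p) (hq : q ≤ hM.graph.lev b)
    {x y : Vertex M} (hx : x ∈ hM.graph.Ioo Set.univ a b) (hy : y ∈ hM.graph.Ioo Set.univ a b)
    (h : Conn hM.graph.Link (hM.graph.band p q \ {a, b}) x y) :
    Conn hM.graph.Link (hM.graph.band p q ∩ hM.graph.Ioo Set.univ a b) x y := by
  have ha := hM.lev_mem a
  have hb := hM.lev_mem b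
  have hreal : ∀ x ∈ hM.graph.Ioo Set.univ a b, ∃ x', x = .real x' := by
    rintro x ⟨h1, h2⟩
    have := h1.lev_lt
    have := h2.lev_lt
    exact hM.exists_real (by omega) (by omega)
  have hbetween : ∀ z : M, z ∈ Between N Set.univ a b ↔
      .real z ∈ hM.graph.Ioo Set.univ a b := by
    intro z
    simp only [Between, Graded.Ioo, Set.mem_univ, true_and, Set.mem_ofPred_eq]
    rw [hM.beneath_iff_of_real hf ⟨z, .inr rfl⟩, hM.beneath_iff_of_real hf ⟨z, .inl rfl⟩]
  obtain ⟨x, rfl⟩ := hreal x hx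
  obtain ⟨y, rfl⟩ := hreal y hy
  have hxb := h.left_mem.1
  have hyb := h.right_mem.1
  have hlt := hx.1.lev_lt.trans hx.2.lev_lt
  have hab : Beneath N Set.univ a b := by
    by_cases h1 : ∃ x, a = .real x ∨ b = .real x
    · exact (hM.beneath_iff_of_real hf h1).2 (hx.1.trans hx.2)
    · cases a with
      | bot =>
        cases b with
        | bot => exact absurd hlt (lt_irrefl _)
        | real x => exact absurd ⟨x, .inr rfl⟩ h1
        | top => trivial
      | real x => exact absurd ⟨x, .inl rfl⟩ h1
      | top => exact absurd hlt (by rw [lev_top]; omega)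
  obtain ⟨k, hk⟩ := h
  have hk' : PathIn N (Strip N p q ∩ {z | Vertex.real z ≠ a ∧ Vertex.real z ≠ b}) k x y := by
    rw [pathIn_iff_walk]
    refine hM.walk_of_real ?_ hk
    rintro v ⟨h1, h2⟩
    simp only [Set.mem_insert_iff, Set.mem_singleton_iff, not_or] at h2
    -- An imaginary vertex with level in `[p, q]`, an interval between the levels of `a` and `b`,
    -- can only be `a` or `b`. Both are avoided, so the walk is real.
    cases v with
    | bot =>
      have := h1.1
      rw [lev_bot] at this
      cases a with
      | bot => exact absurd rfl h2.1
      | real a => have := hM.lev_real a; omega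
      | top => rw [lev_top] at hp; omega
    | real z => exact ⟨z, ⟨hM.strip_iff.2 h1, h2⟩, rfl⟩
    | top =>
      have := h1.2
      rw [lev_top] at this
      cases b with
      | top => exact absurd rfl h2.2
      | real b => have := hM.lev_real b; omega
      | bot => rw [lev_bot] at hq; omega
  obtain ⟨k', -, h1⟩ := hs _ _ p q ha.1 hlt hb.2 hp (hxb.1.trans hxb.2) hq a b
    (hM.vLevel_iff.2 rfl) (hM.vLevel_iff.2 rfl) hab x y ⟨hM.strip_iff.2 hxb, (hbetween x).2 hx⟩
    ⟨hM.strip_iff.2 hyb, (hbetween y).2 hy⟩ k hk'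
  refine hM.conn_real (D := Strip N p q ∩ Between N Set.univ a b) ?_ ⟨k', pathIn_iff_walk.1 h1⟩
  exact fun z hz => ⟨hM.strip_iff.1 hz.1, (hbetween z).1 hz.2⟩

-- This is the case `b = top` of simple connectedness: a path with levels at most `N` misses `top`,
-- and its vertices over `a` all lie beneath `top`.
include hs hf in
theorem upConnected : hM.graph.UpConnected N := by
  intro a p q hp hq x y hx hy h
  have hreal : ∀ z, hM.graph.Lt Set.univ a z → z ∈ hM.graph.band p q →
      z ∈ hM.graph.Ioo Set.univ a .top := by
    intro z hz hz'
    have := hz.lev_lt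
    have := hM.lev_mem a
    exact ⟨hz, hM.lt_top hf (by omega) (hz'.2.trans hq)⟩
  refine (hM.conn_Ioo hs hf (b := .top) (q := q) hp (by rw [lev_top]; omega) (hreal x hx h.left_mem.1)
    (hreal y hy h.right_mem.1) (h.mono ?_)).mono ?_
  · rintro z ⟨h1, h2⟩
    refine ⟨h1, ?_⟩
    rintro (h3 | h3)
    · exact h2 h3
    · obtain rfl : z = .top := h3
      have := h1.2
      rw [lev_top] at this
      omega
  · exact fun z hz => ⟨hz.1, hz.2.1⟩

-- The case `a = bot` of simple connectedness. In the graph turned upside down, the lower bound `0`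
-- on the levels becomes an upper bound.
include hs hf in
theorem dual_upConnected : hM.graph.dual.UpConnected 0 := by
  intro b p q hp hq x y hx hy h
  rw [Graded.dual_link, Graded.dual_band] at h ⊢
  simp only [Graded.dual_lt] at hx hy ⊢
  change -hM.graph.lev b ≤ p at hp
  have hreal : ∀ z, hM.graph.Lt Set.univ z b → z ∈ hM.graph.band (-q) (-p) →
      z ∈ hM.graph.Ioo Set.univ .bot b := by
    intro z hz hz'
    have := hz.lev_lt
    have := hM.lev_mem b
    have := hz'.1
    exact ⟨hM.bot_lt hf (by omega) (by omega), hz⟩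
  refine (hM.conn_Ioo hs hf (a := .bot) (p := -q) (q := -p) (by rw [lev_bot]; omega) (by omega)
    (hreal x hx h.left_mem.1) (hreal y hy h.right_mem.1) (h.mono ?_)).mono ?_
  · rintro z ⟨h1, h2⟩
    refine ⟨h1, ?_⟩
    rintro (h3 | h3)
    · obtain rfl : z = .bot := h3
      have := h1.1
      rw [lev_bot] at this
      omega
    · exact h2 h3
  · exact fun z hz => ⟨hz.1, hz.2.2⟩

theorem mem_of_band {D : Set M} {p q : ℤ} (hp : 0 ≤ p) (hq : q ≤ N) {v : Vertex M}
    (hv : v ∈ {v | Vertex.Mem D v} ∩ hM.graph.band p q) : ∃ x ∈ D ∩ Strip N p q, v = .real x := by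
  obtain ⟨x, rfl⟩ := hM.exists_real (hp.trans hv.2.1) (hv.2.2.trans hq)
  exact ⟨x, ⟨hv.1, hM.strip_iff.2 hv.2⟩, rfl⟩

/-- Nice sets, in terms of the graph of possibly imaginary vertices. -/
theorem nice_iff {D : Set M} : Nice N D ↔
    (∀ x ∈ D, ∀ y ∈ D, hM.graph.Lt Set.univ (.real x) (.real y) →
      hM.graph.Lt (Vertex.real '' D) (.real x) (.real y)) ∧
    hM.graph.ConnClosed 0 N {v | Vertex.Mem D v} := by
  have hreal : ∀ {x y : M}, Beneath N Set.univ (.real x) (.real y) ↔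
      hM.graph.Lt Set.univ (.real x) (.real y) := by
    intro x y
    rw [hM.beneath_real_iff]
    exact ⟨Graded.Lt.mono (Set.subset_univ _), hM.lt_real_of_univ⟩
  constructor
  · rintro ⟨h1, h2⟩
    constructor
    · intro x hx y hy hxy
      -- With `top` as upper vertex, niceness speaks about all vertices of `D` over `x`.
      have h3 := h1 (.real x) .top hx trivial
      have : y ∈ D ∩ Between N Set.univ (.real x) .top := ⟨hy, trivial, hreal.2 hxy, trivial⟩
      rw [← h3] at this
      exact hM.beneath_real_iff.1 this.2.1
    · intro p q hp hq x hx y hy h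
      obtain ⟨x, hx', rfl⟩ := hM.mem_of_band hp hq ⟨hx, h.left_mem⟩
      obtain ⟨y, hy', rfl⟩ := hM.mem_of_band hp hq ⟨hy, h.right_mem⟩
      have hpq := h.left_mem.1.trans h.left_mem.2
      have h3 := h2 p q hp hpq hq x hx' y hy' (exists_pathIn_iff_conn.2 (hM.conn_of_real (fun v hv =>
        (hM.mem_of_band (D := Set.univ) hp hq ⟨by cases v <;> trivial, hv⟩).imp fun z hz =>
          ⟨hz.1.2, hz.2⟩) h))
      rw [exists_pathIn_iff_conn] at h3
      refine hM.conn_real ?_ h3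
      exact fun z hz => ⟨hz.1, hM.strip_iff.1 hz.2⟩
  · rintro ⟨h1, h2⟩
    have key : ∀ u v : Vertex M, u.Mem D → v.Mem D → Beneath N Set.univ u v → Beneath N D u v := by
      rintro (_ | x | _) (_ | y | _) hx hy h <;> try trivial
      exact hM.beneath_real_iff.2 (h1 x hx y hy (hreal.1 h))
    have key' : ∀ u v : Vertex M, Beneath N D u v → Beneath N Set.univ u v := by
      rintro (_ | x | _) (_ | y | _) h <;> try trivial
      exact hreal.2 (Graded.Lt.mono (Set.subset_univ _) (hM.beneath_real_iff.1 h))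
    refine ⟨fun a b ha hb => ?_, fun p q hp hpq hq x hx y hy h => ?_⟩
    · ext z
      constructor
      · rintro ⟨h3, h4, h5⟩
        exact ⟨h3, trivial, key' _ _ h4, key' _ _ h5⟩
      · rintro ⟨h3, -, h4, h5⟩
        exact ⟨h3, key _ _ ha h3 h4, key _ _ h3 hb h5⟩
    · rw [exists_pathIn_iff_conn] at h ⊢
      exact hM.conn_of_real (fun v hv => hM.mem_of_band hp hq hv) (h2 p q hp hq (.real x) hx.1
        (.real y) hy.1 (hM.conn_real (fun z hz => hM.strip_iff.1 hz) h))

/-- A vertex between `a` and `b` which is connected to a nice set by a path with levels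
strictly between those of `a` and `b` is connected to it by such a path between `a` and `b`. -/
theorem exists_conn_Ioo (hs : SimplyConnected N M) (hf : ArbitrarilyFarPaths N M)
    {D : Set M} (hD : Nice N D) {a b x y : Vertex M} (ha : a.Mem D) (hb : b.Mem D)
    (hx : x ∈ hM.graph.Ioo Set.univ a b) (hy : y.Mem D)
    (h : Conn hM.graph.Link (hM.graph.band (hM.graph.lev a + 1) (hM.graph.lev b - 1)) x y) :
    ∃ z : Vertex M, z.Mem D ∧ Conn hM.graph.Link (hM.graph.band (hM.graph.lev a + 1)
      (hM.graph.lev b - 1) ∩ hM.graph.Ioo Set.univ a b) x z := by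
  have hU := hM.upConnected hs hf
  obtain ⟨-, hC⟩ := hM.nice_iff.1 hD
  have hxb := h.left_mem
  have hyb := h.right_mem
  have hla := hM.lev_mem a
  have hlb := hM.lev_mem b
  -- The vertex `y` is first replaced by some `d ∈ D` connected to `x` over `a`. As `y` is connected
  -- to `a` through `x`, there is a path in `D` from `y` to `a`; its last vertex before `a` lies
  -- directly over `a`. If `a = bot`, then `y` itself will do.
  obtain ⟨d, hd, hxd⟩ : ∃ d : Vertex M, d.Mem D ∧ Conn hM.graph.Link
      (hM.graph.band (hM.graph.lev a + 1) (hM.graph.lev b - 1) ∩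
        {z | hM.graph.Lt Set.univ a z}) x d := by
    by_cases h0 : 0 ≤ hM.graph.lev a
    · have h1 : Conn hM.graph.Link (hM.graph.band (hM.graph.lev a) (hM.graph.lev b - 1)) y a :=
        ((h.mono (Graded.band_mono (by omega) le_rfl)).symm Graded.Link.symm).trans
          ((hx.1.conn.mono fun z hz => Graded.band_mono le_rfl hxb.2 hz.2).symm Graded.Link.symm)
      have hya : y ≠ a := by
        rintro rfl
        have := hyb.1
        omega
      obtain ⟨d, h2, h3⟩ := (hC _ _ h0 (by omega) y hy a ha h1).before hya
      have h4 := h2.right_mem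
      have hup : hM.graph.up a d := by
        rcases h3 with h3 | h3
        · have := hM.graph.lev_up h3
          have := h4.1.2.1
          omega
        · exact h3
      refine ⟨d, h4.1.1, (hU a _ (hM.graph.lev b - 1) le_rfl (by omega) x d hx.1 (.single trivial trivial hup)
        (Conn.trans (h.mono ?_) (h2.mono ?_))).mono ?_⟩
      · intro z hz
        refine ⟨Graded.band_mono (by omega) le_rfl hz, ?_⟩
        rintro rfl
        have := hz.1
        omega
      · exact fun z hz => ⟨hz.1.2, hz.2⟩
      · exact fun z hz => ⟨⟨Graded.Lt.lev_lt hz.2, hz.1.2⟩, hz.2⟩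
    · refine ⟨y, hy, h.mono fun z hz => ⟨hz, ?_⟩⟩
      have : a = .bot := by
        cases a with
        | bot => rfl
        | real a => have := hM.lev_real a; omega
        | top => rw [lev_top] at h0; omega
      subst this
      have := hz.1
      have := hz.2
      exact hM.bot_lt hf (by omega) (by omega)
  have hdb := hxd.right_mem
  -- The same is done at `b`: the last vertex `e` before `b`, on a path in `D` from `d` to `b`, lies
  -- directly beneath `b`. The path is taken over `a` by means of `connClosed_over`, so that `e`
  -- lies between `a` and `b`.
  by_cases hN : hM.graph.lev b ≤ N
  · have h1 := hU.connClosed_over hC (a := a) (p := hM.graph.lev a + 1) (by omega) (by omega) hN hd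
      hb hdb.2 (hx.1.trans hx.2) (((hxd.mono fun z hz => Graded.band_mono le_rfl (by omega)
        hz.1).symm Graded.Link.symm).trans (hx.2.conn.mono fun z hz =>
          Graded.band_mono hxb.1 le_rfl hz.2))
    have hne : d ≠ b := by
      rintro rfl
      have := hdb.1.2
      omega
    obtain ⟨e, h2, h3⟩ := h1.before hne
    have h4 := h2.right_mem
    have hup : hM.graph.up e b := by
      rcases h3 with h3 | h3
      · exact h3
      · have := hM.graph.lev_up h3
        have := h4.1.1.2.2
        omega
    refine ⟨e, h4.1.1.1, (hM.conn_Ioo hs hf (p := hM.graph.lev a + 1) (by omega) le_rfl hx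
      ⟨h4.1.2, .single trivial trivial hup⟩ (Conn.trans (hxd.mono ?_) (h2.mono ?_))).mono ?_⟩
    · rintro z ⟨hz, -⟩
      refine ⟨Graded.band_mono le_rfl (by omega) hz, ?_⟩
      rintro (rfl | h5)
      · have := hz.1; omega
      · have := hz.2
        rw [show z = b from h5] at this
        omega
    · rintro z ⟨⟨⟨-, hz⟩, -⟩, hz'⟩
      refine ⟨hz, ?_⟩
      rintro (rfl | h5)
      · have := hz.1; omega
      · exact hz' h5
    · exact fun z hz => ⟨⟨hz.1.1, by have := Graded.Lt.lev_lt hz.2.2; omega⟩, hz.2⟩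
  · have : b = .top := by
      cases b with
      | top => rfl
      | real b => have := hM.lev_real b; omega
      | bot => rw [lev_bot] at hN; omega
    subst this
    refine ⟨d, hd, hxd.mono fun z hz => ⟨hz.1, hz.2, ?_⟩⟩
    have := hz.1.1
    have := hz.1.2
    exact hM.lt_top hf (by omega) (by omega)

end IsColoredSpace

end NiceSets

/-! ### Free paths and their attachment to nice sets -/

section Attach

variable (N : ℕ) {M : Type*} [(lang N).Structure M]

/-- `a, c_0, …, c_m, b` is a rising path which starts on level `l`. -/
structure RisingPath (l : ℤ) (m : ℕ) (a b : Vertex M) (c : Fin (m + 1) → M) : Prop where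
  level : ∀ j : Fin (m + 1), Level N (l + 1 + (j : ℕ)) (c j)
  first : VAdj N a (.real (c 0))
  last : VAdj N (.real (c (Fin.last m))) b
  adj : ∀ j : Fin m, Adj N (c j.castSucc) (c j.succ)

/-- `a, c_0, …, c_m, b` is a rising path which starts on level `l`, between two vertices of `D`,
no interior vertex of which is connected to `D` by a path with levels in `[l + 1, l + m + 1]`. -/
structure FreePath (D : Set M) (l : ℤ) (m : ℕ) (a b : Vertex M) (c : Fin (m + 1) → M) : Prop
    extends RisingPath N l m a b c where
  le_level : -1 ≤ l
  level_le : l + m + 2 ≤ N + 1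
  mem_left : a.Mem D
  mem_right : b.Mem D
  vLevel_left : VLevel N l a
  vLevel_right : VLevel N (l + m + 2) b
  far : ∀ x ∈ D, ∀ j k, ¬ PathIn N (Strip N (l + 1) (l + m + 1)) k (c j) x

/-- `D'` arises from `D` by adjoining a free path. -/
def Attach (D D' : Set M) : Prop :=
  ∃ l m a b c, FreePath N D l m a b c ∧ D' = D ∪ Set.range c

variable {N} {D : Set M} {l : ℤ} {m : ℕ} {a b : Vertex M} {c : Fin (m + 1) → M}

/-- Once the path and its two ends are indexed by levels, `Graded.lt_of_path` applies to any part of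
it. -/
theorem RisingPath.exists_fun (hM : IsColoredSpace N M) (h : RisingPath N l m a b c)
    (ha : VLevel N l a) (hb : VLevel N (l + m + 2) b) :
    ∃ f : ℤ → Vertex M, f l = a ∧ f (l + m + 2) = b ∧
      (∀ j : Fin (m + 1), f (l + 1 + (j : ℕ)) = .real (c j)) ∧
      ∀ i, l ≤ i → i < l + m + 2 → hM.graph.up (f i) (f (i + 1)) := by
  classical
  -- `c 0` has level `l + 1`, hence the index `i - l - 1`. The values outside of `[l, l + m + 2]`
  -- play no role.
  let f : ℤ → Vertex M := fun i =>
    if i ≤ l then a else if i = l + m + 2 then b else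
      .real (c (Fin.ofNat (m + 1) (i - l - 1).toNat))
  have fl : f l = a := if_pos le_rfl
  have fr : f (l + m + 2) = b := by
    change ite _ _ _ = _
    rw [if_neg (by omega), if_pos rfl]
  have fc : ∀ j : Fin (m + 1), f (l + 1 + (j : ℕ)) = .real (c j) := by
    intro j
    have := j.2
    change ite _ _ _ = _
    rw [if_neg (by omega), if_neg (by omega)]
    congr
    apply Fin.ext
    rw [show l + 1 + (j : ℕ) - l - 1 = ((j : ℕ) : ℤ) by ring, Int.toNat_natCast]
    exact Nat.mod_eq_of_lt this
  have e : ∀ j, hM.graph.lev (.real (c j)) = l + 1 + (j : ℕ) := fun j => hM.level_iff.1 (h.level j)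
  refine ⟨f, fl, fr, fc, fun i h1 h2 => ?_⟩
  rcases eq_or_lt_of_le h1 with rfl | h1
  · have := fc 0
    simp only [Fin.val_zero, Nat.cast_zero, add_zero] at this
    rw [fl, this]
    refine ⟨h.first, ?_⟩
    change hM.graph.lev _ = hM.graph.lev _ + 1
    rw [e, hM.vLevel_iff.1 ha]
    simp
  · obtain ⟨j, rfl⟩ : ∃ j : ℕ, i = l + 1 + j := ⟨(i - l - 1).toNat, by omega⟩
    by_cases hj : j = m
    · subst hj
      have := fc (Fin.last j)
      simp only [Fin.val_last] at this
      rw [show l + 1 + (j : ℤ) + 1 = l + j + 2 by ring, fr, this]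
      refine ⟨h.last, ?_⟩
      change hM.graph.lev _ = hM.graph.lev _ + 1
      rw [e, hM.vLevel_iff.1 hb]
      simp only [Fin.val_last]
      ring
    · have e1 := fc (Fin.castSucc ⟨j, by omega⟩)
      have e2 := fc (Fin.succ ⟨j, by omega⟩)
      simp only [Fin.val_castSucc, Fin.val_succ, Nat.cast_add, Nat.cast_one, ← add_assoc] at e1 e2
      rw [e1, e2]
      refine ⟨h.adj _, ?_⟩
      change hM.graph.lev _ = hM.graph.lev _ + 1
      rw [e, e]
      simp [add_assoc]

theorem RisingPath.of_fun (hM : IsColoredSpace N M) {f : ℤ → Vertex M}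
    (hf : ∀ i, l ≤ i → i < l + m + 2 → hM.graph.up (f i) (f (i + 1)))
    (hf' : ∀ i, l ≤ i → i ≤ l + m + 2 → hM.graph.lev (f i) = i) (hl : -1 ≤ l)
    (hr : l + m + 2 ≤ N + 1) : ∃ c : Fin (m + 1) → M,
      RisingPath N l m (f l) (f (l + m + 2)) c ∧
        ∀ j : Fin (m + 1), f (l + 1 + (j : ℕ)) = .real (c j) := by
  have h3 : ∀ j : Fin (m + 1), ∃ z, f (l + 1 + (j : ℕ)) = .real z := by
    intro j
    have := j.2
    have := hf' (l + 1 + (j : ℕ)) (by omega) (by omega)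
    exact hM.exists_real (by omega) (by omega)
  choose c hc using h3
  refine ⟨c, ⟨fun j => ?_, ?_, ?_, fun j => ?_⟩, hc⟩
  · have := j.2
    rw [hM.level_iff, ← hc]
    exact hf' _ (by omega) (by omega)
  · have := (hf l le_rfl (by omega)).1
    have h0 := hc 0
    simp only [Fin.val_zero, Nat.cast_zero, add_zero] at h0
    rwa [h0] at this
  · have := (hf (l + 1 + m) (by omega) (by omega)).1
    have h0 := hc (Fin.last m)
    simp only [Fin.val_last] at h0
    rwa [h0, show l + 1 + (m : ℤ) + 1 = l + m + 2 by ring] at this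
  · have := j.2
    have h4 := (hf (l + 1 + (j : ℕ)) (by omega) (by omega)).1
    have e1 := hc j.castSucc
    have e2 := hc j.succ
    simp only [Fin.val_castSucc, Fin.val_succ, Nat.cast_add, Nat.cast_one, ← add_assoc] at e1 e2
    rw [e1, e2] at h4
    exact h4

namespace FreePath

variable (hM : IsColoredSpace N M) (hs : SimplyConnected N M) (hf : ArbitrarilyFarPaths N M)
  (hc : FreePath N D l m a b c)

include hc

theorem lev_left : hM.graph.lev a = l := hM.vLevel_iff.1 hc.vLevel_left

theorem lev_right : hM.graph.lev b = l + m + 2 := hM.vLevel_iff.1 hc.vLevel_right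

theorem lev_path (j : Fin (m + 1)) : hM.graph.lev (.real (c j)) = l + 1 + (j : ℕ) :=
  hM.level_iff.1 (hc.level j)

theorem notMem (hM : IsColoredSpace N M) (j : Fin (m + 1)) : c j ∉ D := by
  intro h
  refine hc.far _ h j 0 (pathIn_iff_walk.2 (.nil ?_))
  have := j.2
  rw [hM.strip_iff]
  constructor <;> rw [hc.lev_path hM] <;> omega

theorem not_conn (j : Fin (m + 1)) {v : Vertex M} (hv : v.Mem D) :
    ¬ Conn hM.graph.Link (hM.graph.band (l + 1) (l + m + 1)) (.real (c j)) v := by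
  intro h
  have h1 := hc.le_level
  have h2 := hc.level_le
  obtain ⟨x, hx, rfl⟩ := hM.mem_of_band (by omega) (by omega) ⟨hv, h.right_mem⟩
  have := hM.conn_of_real (D := Strip N (l + 1) (l + m + 1)) (fun w hw => ?_) h
  · obtain ⟨k, hk⟩ := exists_pathIn_iff_conn.2 this
    exact hc.far x hx.1 j k hk
  · obtain ⟨z, hz, rfl⟩ := hM.mem_of_band (D := Set.univ) (p := l + 1) (q := l + m + 1) (by omega)
      (by omega) (v := w) ⟨by cases w <;> trivial, hw⟩
    exact ⟨z, hz.2, rfl⟩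

theorem lt_real (i j : Fin (m + 1)) (hij : i < j) {S : Set (Vertex M)}
    (hS : ∀ i, .real (c i) ∈ S) : hM.graph.Lt S (.real (c i)) (.real (c j)) := by
  obtain ⟨f, -, -, h1, h2⟩ := hc.toRisingPath.exists_fun hM hc.vLevel_left hc.vLevel_right
  have := i.2
  have := j.2
  rw [← h1, ← h1]
  refine Graded.lt_of_path (by simpa using hij) (fun k h3 h4 => ?_) fun k h3 h4 =>
    h2 k (by omega) (by omega)
  obtain ⟨n, rfl⟩ : ∃ n : ℕ, k = l + 1 + n := ⟨(k - l - 1).toNat, by omega⟩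
  have := h1 ⟨n, by omega⟩
  rw [this]
  exact hS _

theorem lt_right (i : Fin (m + 1)) {S : Set (Vertex M)} (hS : ∀ i, .real (c i) ∈ S) (hb : b ∈ S) :
    hM.graph.Lt S (.real (c i)) b := by
  obtain ⟨f, -, h0, h1, h2⟩ := hc.toRisingPath.exists_fun hM hc.vLevel_left hc.vLevel_right
  have := i.2
  rw [← h1, ← h0]
  refine Graded.lt_of_path (by omega) (fun k h3 h4 => ?_) fun k h3 h4 => h2 k (by omega) (by omega)
  by_cases hk : k = l + m + 2
  · subst hk
    rwa [h0]
  · obtain ⟨n, rfl⟩ : ∃ n : ℕ, k = l + 1 + n := ⟨(k - l - 1).toNat, by omega⟩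
    have := h1 ⟨n, by omega⟩
    rw [this]
    exact hS _

theorem left_lt (i : Fin (m + 1)) {S : Set (Vertex M)} (hS : ∀ i, .real (c i) ∈ S) (ha : a ∈ S) :
    hM.graph.Lt S a (.real (c i)) := by
  obtain ⟨f, h0, -, h1, h2⟩ := hc.toRisingPath.exists_fun hM hc.vLevel_left hc.vLevel_right
  have := i.2
  rw [← h1, ← h0]
  refine Graded.lt_of_path (by omega) (fun k h3 h4 => ?_) fun k h3 h4 => h2 k (by omega) (by omega)
  by_cases hk : k = l
  · subst hk
    rwa [h0]
  · obtain ⟨n, rfl⟩ : ∃ n : ℕ, k = l + 1 + n := ⟨(k - l - 1).toNat, by omega⟩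
    have := h1 ⟨n, by omega⟩
    rw [this]
    exact hS _

include hM hs hf

/-- A free path is not connected to `D` on the levels from that of `c j` up to the one just below
`b`, which is what `UpConnected.eq_or_lt` requires. -/
theorem eq_or_lt (hD : Nice N D) (j : Fin (m + 1)) {y : M} (hy : y ∈ D)
    (h : hM.graph.Lt Set.univ (.real (c j)) (.real y)) :
    .real y = b ∨ hM.graph.Lt Set.univ b (.real y) := by
  have := hc.le_level
  refine (hM.upConnected hs hf).eq_or_lt (hM.nice_iff.1 hD).2 (hM.lev_real _).1 hc.mem_right
    (hc.lt_right hM j (fun _ => trivial) trivial) (fun v hv h1 => hc.not_conn hM j hv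
      (h1.mono (Graded.band_mono ?_ ?_))) hy h (hM.lev_real y).2
  · rw [hc.lev_path hM]
    omega
  · rw [hc.lev_right hM]
    omega

/-- The same argument in the graph turned upside down, in which `D` is connectedly closed for the
levels from `-N` to `0`. -/
theorem eq_or_gt (hD : Nice N D) (j : Fin (m + 1)) {y : M} (hy : y ∈ D)
    (h : hM.graph.Lt Set.univ (.real y) (.real (c j))) :
    .real y = a ∨ hM.graph.Lt Set.univ (.real y) a := by
  have h0 := (hM.dual_upConnected hs hf).eq_or_lt (lo := -N) (D := {v | Vertex.Mem D v})
    (x := .real (c j)) (b := a) ?_ ?_ hc.mem_left ?_ ?_ (y := .real y) hy (Graded.dual_lt.2 h)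
    (neg_nonpos.2 (hM.lev_real y).1)
  · rwa [Graded.dual_lt] at h0
  · intro p q hp hq x hx y hy h1
    rw [Graded.dual_link, Graded.dual_band] at h1 ⊢
    exact (hM.nice_iff.1 hD).2 _ _ (by omega) (by omega) x hx y hy h1
  · exact neg_le_neg (hM.lev_real _).2
  · exact Graded.dual_lt.2 (hc.left_lt hM j (fun _ => trivial) trivial)
  · intro v hv h1
    rw [Graded.dual_link, Graded.dual_band] at h1
    refine hc.not_conn hM j hv (h1.mono (Graded.band_mono ?_ ?_))
    · change l + 1 ≤ -(-hM.graph.lev a - 1)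
      rw [hc.lev_left hM]
      omega
    · change -(-hM.graph.lev _) ≤ l + m + 1
      have := j.2
      rw [hc.lev_path hM]
      omega

/-- The links between a free path and the nice set to which it is attached. -/
theorem adj_iff (hD : Nice N D) (j : Fin (m + 1)) {y : M} (hy : y ∈ D) :
    Adj N (c j) y ↔ (j = Fin.last m ∧ b = .real y) ∨ (j = 0 ∧ a = .real y) := by
  have hj := j.2
  have e := hc.lev_path hM j
  have ea := hc.lev_left hM
  have eb := hc.lev_right hM
  constructor
  · intro h
    rcases hM.real_link_real.2 h with h | h
    · have e1 := hM.graph.lev_up h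
      have h2 := hc.eq_or_lt hM hs hf hD j hy (.single trivial trivial h)
      refine .inl ?_
      rcases h2 with h2 | h2
      · rw [h2] at e1
        exact ⟨Fin.ext (by simp only [Fin.val_last]; omega), h2.symm⟩
      · have := h2.lev_lt
        omega
    · have e1 := hM.graph.lev_up h
      have h2 := hc.eq_or_gt hM hs hf hD j hy (.single trivial trivial h)
      refine .inr ?_
      rcases h2 with h2 | h2
      · rw [h2] at e1
        exact ⟨Fin.ext (by simp only [Fin.val_zero]; omega), h2.symm⟩
      · have := h2.lev_lt
        omega
  · rintro (⟨rfl, rfl⟩ | ⟨rfl, rfl⟩)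
    · exact hc.last
    · exact hM.adj_symm _ _ hc.first

/-- Attaching a free path to a nice set yields a nice set. -/
theorem nice (hD : Nice N D) : Nice N (D ∪ Set.range c) := by
  obtain ⟨hD1, hD2⟩ := hM.nice_iff.1 hD
  have hl := hc.le_level
  have hr := hc.level_le
  have ea := hc.lev_left hM
  have eb := hc.lev_right hM
  have hS : ∀ i, .real (c i) ∈ Vertex.real '' (D ∪ Set.range c) :=
    fun i => ⟨c i, .inr ⟨i, rfl⟩, rfl⟩
  have hsub : Vertex.real '' D ⊆ Vertex.real '' (D ∪ Set.range c) :=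
    Set.image_mono Set.subset_union_left
  rw [hM.nice_iff]
  constructor
  -- A rising path between `D` and the free path can be replaced by one through an end `a` or `b`,
  -- which splits it into a piece inside of `D` and a piece of the free path.
  · rintro x (hx | ⟨i, rfl⟩) y (hy | ⟨j, rfl⟩) hxy
    · exact (hD1 x hx y hy hxy).mono hsub
    · have h1 := hc.eq_or_gt hM hs hf hD j hx hxy
      have haS : ∀ a', a = .real a' → a ∈ Vertex.real '' (D ∪ Set.range c) := by
        rintro a' rfl
        exact ⟨a', .inl hc.mem_left, rfl⟩
      rcases h1 with h1 | h1
      · rw [h1]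
        exact hc.left_lt hM j hS (haS x h1.symm)
      · have := h1.lev_lt
        have := hM.lev_real x
        obtain ⟨a', rfl⟩ := hM.exists_real (v := a) (by omega) (by omega)
        exact ((hD1 x hx a' hc.mem_left h1).mono hsub).trans (hc.left_lt hM j hS (haS a' rfl))
    · have h1 := hc.eq_or_lt hM hs hf hD i hy hxy
      have hbS : ∀ b', b = .real b' → b ∈ Vertex.real '' (D ∪ Set.range c) := by
        rintro b' rfl
        exact ⟨b', .inl hc.mem_right, rfl⟩
      rcases h1 with h1 | h1
      · rw [h1]
        exact hc.lt_right hM i hS (hbS y h1.symm)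
      · have := h1.lev_lt
        have := hM.lev_real y
        obtain ⟨b', rfl⟩ := hM.exists_real (v := b) (by omega) (by omega)
        exact (hc.lt_right hM i hS (hbS b' rfl)).trans ((hD1 b' hc.mem_right y hy h1).mono hsub)
    · refine hc.lt_real hM i j ?_ hS
      have := hxy.lev_lt
      rw [hc.lev_path hM, hc.lev_path hM] at this
      exact Fin.lt_def.2 (by omega)
  · have hsub' : {v | Vertex.Mem D v} ⊆ {v | Vertex.Mem (D ∪ Set.range c) v} := by
      rintro (_ | x | _) h
      exacts [trivial, .inl h, trivial]
    have hmem : ∀ i, .real (c i) ∈ {v | Vertex.Mem (D ∪ Set.range c) v} := fun i => .inr ⟨i, rfl⟩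
    -- If `[p, q]` contains the level of `a` or that of `b`, the free path leads to this end, and
    -- `D` is closed. Otherwise the relevant levels are strictly between those of `a` and `b`, where
    -- the free path is not connected to `D`.
    have main : ∀ p q : ℤ, 0 ≤ p → q ≤ N → ∀ i, ∀ y ∈ {v | Vertex.Mem D v},
        Conn hM.graph.Link (hM.graph.band p q) (.real (c i)) y →
        Conn hM.graph.Link ({v | Vertex.Mem (D ∪ Set.range c) v} ∩ hM.graph.band p q)
          (.real (c i)) y := by
      intro p q hp hq i y hy h
      have hi := i.2
      have e := hc.lev_path hM i
      have h1 := h.left_mem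
      by_cases hpl : p ≤ l
      · have h2 := (hc.left_lt hM i (S := {v | Vertex.Mem (D ∪ Set.range c) v}) hmem
          (hsub' hc.mem_left)).conn.symm Graded.Link.symm
        rw [ea] at h2
        have h3 : Conn hM.graph.Link ({v | Vertex.Mem (D ∪ Set.range c) v} ∩ hM.graph.band p q)
            (.real (c i)) a :=
          h2.mono (Set.inter_subset_inter_right _ (Graded.band_mono hpl h1.2))
        exact h3.trans ((hD2 p q hp hq a hc.mem_left y hy (((h3.mono
          Set.inter_subset_right).symm Graded.Link.symm).trans h)).mono
          (Set.inter_subset_inter_left _ hsub'))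
      · by_cases hqr : l + m + 2 ≤ q
        · have h2 := (hc.lt_right hM i (S := {v | Vertex.Mem (D ∪ Set.range c) v}) hmem
            (hsub' hc.mem_right)).conn
          rw [eb] at h2
          have h3 : Conn hM.graph.Link ({v | Vertex.Mem (D ∪ Set.range c) v} ∩ hM.graph.band p q)
              (.real (c i)) b :=
            h2.mono (Set.inter_subset_inter_right _ (Graded.band_mono h1.1 hqr))
          exact h3.trans ((hD2 p q hp hq b hc.mem_right y hy (((h3.mono
            Set.inter_subset_right).symm Graded.Link.symm).trans h)).mono
            (Set.inter_subset_inter_left _ hsub'))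
        · exact absurd (h.mono (Graded.band_mono (by omega) (by omega))) (hc.not_conn hM i hy)
    have hcases : ∀ v ∈ {v | Vertex.Mem (D ∪ Set.range c) v},
        v ∈ {v | Vertex.Mem D v} ∨ ∃ i, v = .real (c i) := by
      rintro (_ | x | _) h
      · exact .inl trivial
      · rcases h with h | ⟨i, rfl⟩
        exacts [.inl h, .inr ⟨i, rfl⟩]
      · exact .inl trivial
    intro p q hp hq x hx y hy h
    rcases hcases x hx with hx' | ⟨i, rfl⟩ <;> rcases hcases y hy with hy' | ⟨j, rfl⟩
    · exact (hD2 p q hp hq x hx' y hy' h).mono (Set.inter_subset_inter_left _ hsub')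
    · exact (main p q hp hq j x hx' (h.symm Graded.Link.symm)).symm Graded.Link.symm
    · exact main p q hp hq i y hy' h
    · have hx := h.left_mem
      have hy := h.right_mem
      rcases lt_trichotomy i j with hij | rfl | hij
      · exact (hc.lt_real hM i j hij hmem).conn.mono
          (Set.inter_subset_inter_right _ (Graded.band_mono hx.1 hy.2))
      · exact .refl ⟨hmem i, hx⟩
      · exact ((hc.lt_real hM j i hij hmem).conn.mono
          (Set.inter_subset_inter_right _ (Graded.band_mono hy.1 hx.2))).symm Graded.Link.symm

end FreePath

theorem Attach.subset {D D' : Set M} (h : Attach N D D') : D ⊆ D' := by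
  obtain ⟨l, m, a, b, c, -, rfl⟩ := h
  exact Set.subset_union_left

theorem subset_of_reflTransGen_attach {D D' : Set M} (h : Relation.ReflTransGen (Attach N) D D') :
    D ⊆ D' := by
  induction h with
  | refl => exact subset_rfl
  | tail _ h ih => exact ih.trans h.subset

theorem Nice.of_reflTransGen_attach (hM : IsColoredSpace N M) (hs : SimplyConnected N M)
    (hf : ArbitrarilyFarPaths N M) {D D' : Set M} (hD : Nice N D)
    (h : Relation.ReflTransGen (Attach N) D D') : Nice N D' := by
  induction h with
  | refl => exact hD
  | tail _ h ih =>
    obtain ⟨l, m, a, b, c, hc, rfl⟩ := h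
    exact hc.nice hM hs hf ih

theorem Vertex.Mem.mono {D D' : Set M} (h : D ⊆ D') {v : Vertex M} (hv : v.Mem D) : v.Mem D' := by
  cases v with
  | bot => trivial
  | real x => exact h hv
  | top => trivial

/-- Induction on the difference of the levels of `a` and `b`. Either `x` is connected to `D` on the
levels strictly between them and is reached along a path between `a` and `b`, each edge of which
leads to a smaller interval; or any rising path from `a` to `b` through `x` is free. -/
theorem exists_attach_of_mem_Ioo (hM : IsColoredSpace N M) (hs : SimplyConnected N M)
    (hf : ArbitrarilyFarPaths N M) {D : Set M} (hD : Nice N D) {a b : Vertex M} (ha : a.Mem D)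
    (hb : b.Mem D) {x : Vertex M} (hx : x ∈ hM.graph.Ioo Set.univ a b) :
    ∃ D', Relation.ReflTransGen (Attach N) D D' ∧ x.Mem D' := by
  obtain ⟨n, hn⟩ : ∃ n : ℕ, hM.graph.lev b - hM.graph.lev a < n :=
    ⟨(hM.graph.lev b - hM.graph.lev a + 1).toNat, by omega⟩
  induction n generalizing D a b x with
  | zero =>
    have := hx.1.lev_lt
    have := hx.2.lev_lt
    push_cast at hn
    omega
  | succ n ih =>
    have hax := hx.1.lev_lt
    have hxb := hx.2.lev_lt
    by_cases h : ∃ y : Vertex M, y.Mem D ∧ Conn hM.graph.Link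
        (hM.graph.band (hM.graph.lev a + 1) (hM.graph.lev b - 1)) x y
    · obtain ⟨y, hy, h⟩ := h
      obtain ⟨z, hz, h'⟩ := hM.exists_conn_Ioo hs hf hD ha hb hx hy h
      -- The walk from `z` to `x` is absorbed vertex by vertex. The successor `z'` of a vertex `z`
      -- already in `D` lies between `z` and `b` or between `a` and `z`, so the outer induction
      -- hypothesis adjoins it.
      obtain ⟨k, hk⟩ := h'.symm Graded.Link.symm
      clear h h' hx hax hxb hy
      induction hk generalizing D with
      | nil h => exact ⟨D, .refl, hz⟩
      | @cons k z z' x h1 h2 h3 ihk =>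
        have hz1 := h1.2.1.lev_lt
        have hz2 := h1.2.2.lev_lt
        obtain ⟨D1, hD1, hz'⟩ : ∃ D', Relation.ReflTransGen (Attach N) D D' ∧ z'.Mem D' := by
          rcases h2 with h2 | h2
          · exact ih hD hz hb ⟨.single trivial trivial h2, h3.left_mem.2.2⟩
              (by push_cast at hn; omega)
          · exact ih hD ha hz ⟨h3.left_mem.2.1, .single trivial trivial h2⟩
              (by push_cast at hn; omega)
        have hsub := subset_of_reflTransGen_attach hD1
        obtain ⟨D2, hD2, hx⟩ := ihk (hD.of_reflTransGen_attach hM hs hf hD1) (ha.mono hsub)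
          (hb.mono hsub) hz'
        exact ⟨D2, hD1.trans hD2, hx⟩
    · push Not at h
      obtain ⟨f, hf1, hf2, hf3, hf4⟩ := hx.1.exists_path
      obtain ⟨g, hg1, hg2, hg3, hg4⟩ := hx.2.exists_path
      have hla := hM.lev_mem a
      have hlb := hM.lev_mem b
      obtain ⟨m, hm⟩ : ∃ m : ℕ, hM.graph.lev b = hM.graph.lev a + m + 2 :=
        ⟨(hM.graph.lev b - hM.graph.lev a - 2).toNat, by omega⟩
      -- The rising paths from `a` to `x` and from `x` to `b` are joined. All interior vertices are
      -- connected to `x` along the path, so none of them is connected to `D` on these levels.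
      let F : ℤ → Vertex M := fun i => if i ≤ hM.graph.lev x then f i else g i
      have F1 : ∀ i, i ≤ hM.graph.lev x → F i = f i := fun i hi => if_pos hi
      have F2 : ∀ i, hM.graph.lev x ≤ i → F i = g i := by
        intro i hi
        rcases eq_or_lt_of_le hi with rfl | hi
        · rw [F1 _ le_rfl, hf2, hg1]
        · exact if_neg (by omega)
      have hup : ∀ i, hM.graph.lev a ≤ i → i < hM.graph.lev b →
          hM.graph.up (F i) (F (i + 1)) := by
        intro i h1 h2
        by_cases h3 : i < hM.graph.lev x
        · rw [F1 _ h3.le, F1 _ h3]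
          exact hf4 i h1 h3
        · rw [F2 _ (by omega), F2 _ (by omega)]
          exact hg4 i (by omega) h2
      have hlev : ∀ i, hM.graph.lev a ≤ i → i ≤ hM.graph.lev b → hM.graph.lev (F i) = i := by
        intro i h1 h2
        by_cases h3 : i ≤ hM.graph.lev x
        · rw [F1 _ h3]
          exact (hf3 i h1 h3).2
        · rw [F2 _ (by omega)]
          exact (hg3 i (by omega) h2).2
      have hFa : F (hM.graph.lev a) = a := by rw [F1 _ hax.le, hf1]
      have hFb : F (hM.graph.lev b) = b := by rw [F2 _ hxb.le, hg2]
      obtain ⟨c, hc, hFc⟩ := RisingPath.of_fun hM (f := F) (l := hM.graph.lev a) (m := m)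
        (by rwa [← hm]) (by rwa [← hm]) hla.1 (by omega)
      rw [hFa, ← hm, hFb] at hc
      obtain ⟨i, hi⟩ : ∃ i : ℕ, hM.graph.lev x = hM.graph.lev a + 1 + i :=
        ⟨(hM.graph.lev x - hM.graph.lev a - 1).toNat, by omega⟩
      have hxc : x = .real (c ⟨i, by omega⟩) := by
        rw [← hFc, ← hi, F1 _ le_rfl, hf2]
      refine ⟨D ∪ Set.range c, .single ⟨_, m, a, b, c, ⟨hc, hla.1, by omega, ha, hb,
        hM.vLevel_iff.2 rfl, hM.vLevel_iff.2 hm, fun y hy j k hk => ?_⟩, rfl⟩, ?_⟩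
      · refine h (.real y) hy ?_
        have e : hM.graph.lev a + m + 1 = hM.graph.lev b - 1 := by omega
        rw [e] at hk
        have h1 := hM.conn_real (S := hM.graph.band (hM.graph.lev a + 1) (hM.graph.lev b - 1))
          (fun z hz => hM.strip_iff.1 hz) ⟨k, pathIn_iff_walk.1 hk⟩
        refine Conn.trans ?_ h1
        have hj := j.2
        have h2 : ∀ i j : ℤ, hM.graph.lev a < i → i < j → j < hM.graph.lev b →
            Conn hM.graph.Link (hM.graph.band (hM.graph.lev a + 1) (hM.graph.lev b - 1))
              (F i) (F j) := by
          intro i j h3 h4 h5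
          refine (Graded.lt_of_path (G := hM.graph) (S := Set.univ) h4 (fun _ _ _ => trivial)
            fun k h6 h7 => hup k (by omega) (by omega)).conn.mono fun z hz =>
              Graded.band_mono ?_ ?_ hz.2
          · rw [hlev _ (by omega) (by omega)]; omega
          · rw [hlev _ (by omega) (by omega)]; omega
        rw [hxc, ← hFc, ← hFc]
        rcases lt_trichotomy i (j : ℕ) with h3 | h3 | h3
        · exact h2 _ _ (by omega) (by simpa using h3) (by omega)
        · simp only [h3]
          refine .refl ⟨?_, ?_⟩ <;> rw [hlev _ (by omega) (by omega)] <;> omega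
        · exact (h2 _ _ (by omega) (by simpa using h3) (by simp only; omega)).symm
            Graded.Link.symm
      · rw [hxc]
        exact .inr ⟨_, rfl⟩

/-- Each vertex belongs to an extension of a given nice set by finitely many free paths. -/
theorem Nice.exists_attach (hM : IsColoredSpace N M) (hs : SimplyConnected N M)
    (hf : ArbitrarilyFarPaths N M) {D : Set M} (hD : Nice N D) (x : M) :
    ∃ D', Relation.ReflTransGen (Attach N) D D' ∧ x ∈ D' :=
  exists_attach_of_mem_Ioo hM hs hf hD (a := .bot) (b := .top) (x := .real x) trivial trivial
    ⟨hM.bot_lt_real hf x, hM.real_lt_top hf x⟩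

end Attach

section Elementary

open Filter

/-! ### Ultraproducts -/

section Ultraproduct

variable {N : ℕ} {J : Type*} {K : J → Type*} [∀ j, (lang N).Structure (K j)] [∀ j, Nonempty (K j)]
  {u : Ultrafilter J}

theorem level_cast {i : ℤ} (x : ∀ j, K j) :
    Level N i (x : (u : Filter J).Product K) ↔ ∀ᶠ j in u, Level N i (x j) := by
  have := Ultraproduct.realize_formula_cast (u := u) (levelF N i (0 : Fin 1)) fun _ => x
  simpa only [realize_levelF] using this

theorem adj_cast (x y : ∀ j, K j) :
    Adj N (x : (u : Filter J).Product K) (y : (u : Filter J).Product K) ↔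
      ∀ᶠ j in u, Adj N (x j) (y j) := by
  have := Ultraproduct.realize_formula_cast (u := u) (adjF N (0 : Fin 2) 1)
    fun i => if i = 0 then x else y
  simpa only [realize_adjF, if_true, if_neg one_ne_zero] using this

/-- The length `k` is fixed, which makes the existence of such a path a first-order property and
Łoś's theorem applicable. -/
theorem pathIn_strip_cast {p q : ℤ} {k : ℕ} (x y : ∀ j, K j) :
    PathIn N (Strip N p q) k (x : (u : Filter J).Product K) (y : (u : Filter J).Product K) ↔
      ∀ᶠ j in u, PathIn N (Strip N p q) k (x j) (y j) := by
  have := Ultraproduct.realize_formula_cast (u := u)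
    (pathF N k (fun i => stripF N p q (Sum.inr i)) (0 : Fin 2) 1) fun i => if i = 0 then x else y
  simpa only [realize_pathF, realize_stripF, Sum.elim_inr, if_true, if_neg one_ne_zero, PathIn]
    using this

end Ultraproduct

/-! ### Elementary embeddings -/

variable {N : ℕ}

namespace ElementaryEmbedding

variable {M M' : Type*} [(lang N).Structure M] [(lang N).Structure M'] (e : M ↪ₑ[lang N] M')

theorem level_iff {i : ℤ} {x : M} : Level N i (e x) ↔ Level N i x := by
  have := e.map_formula (levelF N i (0 : Fin 1)) fun _ => x
  simpa only [realize_levelF, Function.comp] using this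

theorem adj_iff {x y : M} : Adj N (e x) (e y) ↔ Adj N x y := by
  have := e.map_formula (adjF N (0 : Fin 2) 1) ![x, y]
  simp only [realize_adjF, Function.comp] at this
  exact this

theorem pathIn_strip_iff {p q : ℤ} {k : ℕ} {x y : M} :
    PathIn N (Strip N p q) k (e x) (e y) ↔ PathIn N (Strip N p q) k x y := by
  have := e.map_formula (pathF N k (fun i => stripF N p q (Sum.inr i)) (0 : Fin 2) 1) ![x, y]
  simp only [realize_pathF, realize_stripF, Sum.elim_inr, Function.comp] at this
  exact this

theorem beneath_iff {x y : M} :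
    Beneath N Set.univ (.real (e x)) (.real (e y)) ↔ Beneath N Set.univ (.real x) (.real y) := by
  have := e.map_formula (beneathF N (.real (0 : Fin 2)) (.real 1)) ![x, y]
  simp only [realize_beneathF, Vertex.map, Function.comp] at this
  exact this

theorem pathIn_image {D : Set M} {p q : ℤ} {k : ℕ} {x y : M}
    (h : PathIn N (D ∩ Strip N p q) k x y) :
    PathIn N (e '' D ∩ Strip N p q) k (e x) (e y) := by
  obtain ⟨c, rfl, rfl, h1, h2⟩ := h
  refine ⟨e ∘ c, rfl, rfl, fun i => ⟨⟨_, (h1 i).1, rfl⟩, ?_⟩, fun i => (adj_iff e).2 (h2 i)⟩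
  obtain ⟨j, h3, h4, h5⟩ := (h1 i).2
  exact ⟨j, h3, h4, (level_iff e).2 h5⟩

theorem mem_strip_iff {p q : ℤ} {x : M} : e x ∈ Strip N p q ↔ x ∈ Strip N p q := by
  simp only [Strip, Set.mem_ofPred_eq, level_iff e]

end ElementaryEmbedding

/-! ### Nice sets as families -/

section Families

variable {ι M M' M'' : Type*} [(lang N).Structure M] [(lang N).Structure M']
  [(lang N).Structure M'']

variable (N) in
/-- Two families of vertices which satisfy the same atomic formulas. -/
structure SameAtomic (g : ι → M) (g' : ι → M') : Prop where
  eq_iff : ∀ i j, g i = g j ↔ g' i = g' j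
  level_iff : ∀ i k, Level N k (g i) ↔ Level N k (g' i)
  adj_iff : ∀ i j, Adj N (g i) (g j) ↔ Adj N (g' i) (g' j)

namespace SameAtomic

variable {g : ι → M} {g' : ι → M'}

theorem symm (h : SameAtomic N g g') : SameAtomic N g' g :=
  ⟨fun i j => (h.eq_iff i j).symm, fun i j => (h.level_iff i j).symm,
    fun i j => (h.adj_iff i j).symm⟩

theorem map (h : SameAtomic N g g') (e : M' ↪ₑ[lang N] M'') : SameAtomic N g (e ∘ g') where
  eq_iff i j := by rw [h.eq_iff, Function.comp, Function.comp, e.injective.eq_iff]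
  level_iff i k := by rw [h.level_iff, Function.comp, ElementaryEmbedding.level_iff]
  adj_iff i j := by rw [h.adj_iff, Function.comp, Function.comp, ElementaryEmbedding.adj_iff]

theorem beneath (h : SameAtomic N g g') {i j : ι}
    (hb : Beneath N (Set.range g) (.real (g i)) (.real (g j))) :
    Beneath N (Set.range g') (.real (g' i)) (.real (g' j)) := by
  obtain ⟨l, k, hk, c, h0, h1, h2, h3⟩ := hb
  choose s hs using fun i => (h2 i).1
  refine ⟨l, k, hk, g' ∘ s, ?_, ?_, fun i => ⟨⟨_, rfl⟩, ?_⟩, fun i => ?_⟩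
  · exact (h.eq_iff _ _).1 ((hs 0).trans h0)
  · exact (h.eq_iff _ _).1 ((hs _).trans h1)
  · exact (h.level_iff _ _).1 (by rw [hs]; exact (h2 i).2)
  · exact (h.adj_iff _ _).1 (by rw [hs, hs]; exact h3 i)

theorem vLevel_iff (h : SameAtomic N g g') {k : ℤ} (v : Vertex ι) :
    VLevel N k (v.map g) ↔ VLevel N k (v.map g') := by
  cases v with
  | bot => rfl
  | real i => exact h.level_iff i k
  | top => rfl

theorem map_eq_real_iff (h : SameAtomic N g g') (v : Vertex ι) (i : ι) :
    v.map g = .real (g i) ↔ v.map g' = .real (g' i) := by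
  cases v with
  | bot => simp [Vertex.map]
  | real j => simpa [Vertex.map] using h.eq_iff j i
  | top => simp [Vertex.map]

end SameAtomic

/-- The image of a nice set under an elementary embedding is nice. -/
theorem Nice.image {D : Set M} (hM : IsColoredSpace N M) (hM' : IsColoredSpace N M')
    (hD : Nice N D) (e : M ↪ₑ[lang N] M') : Nice N (e '' D) := by
  rw [hM'.nice_iff]
  constructor
  · rintro _ ⟨x, hx, rfl⟩ _ ⟨y, hy, rfl⟩ h
    have h1 : Beneath N Set.univ (.real x) (.real y) := by
      rw [← ElementaryEmbedding.beneath_iff e, hM'.beneath_real_iff]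
      exact hM'.lt_real_of_univ h
    have h2 := (hM.nice_iff.1 hD).1 x hx y hy
      ((hM.beneath_real_iff.1 h1).mono (Set.subset_univ _))
    rw [← hM.beneath_real_iff] at h2
    rw [← hM'.beneath_real_iff]
    obtain ⟨l, k, hk, c, rfl, rfl, h3, h4⟩ := h2
    exact ⟨l, k, hk, e ∘ c, rfl, rfl, fun i => ⟨⟨_, (h3 i).1, rfl⟩,
      (ElementaryEmbedding.level_iff e).2 (h3 i).2⟩,
      fun i => (ElementaryEmbedding.adj_iff e).2 (h4 i)⟩
  · intro p q hp hq v hv w hw h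
    obtain ⟨v, ⟨⟨x, hx, rfl⟩, hx'⟩, rfl⟩ := hM'.mem_of_band hp hq ⟨hv, h.left_mem⟩
    obtain ⟨w, ⟨⟨y, hy, rfl⟩, hy'⟩, rfl⟩ := hM'.mem_of_band hp hq ⟨hw, h.right_mem⟩
    have h1 : Conn (Adj N) (Strip N p q) (e x) (e y) := hM'.conn_of_real (fun v hv =>
        (hM'.mem_of_band (D := Set.univ) hp hq ⟨by cases v <;> trivial, hv⟩).imp fun z hz =>
          ⟨hz.1.2, hz.2⟩) h
    -- Paths of this particular length `k` are described by a formula, so their existence is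
    -- reflected back to `M`, where niceness of `D` applies.
    obtain ⟨k, hk⟩ := exists_pathIn_iff_conn.2 h1
    obtain ⟨k', hk'⟩ := hD.connected p q hp (h.left_mem.1.trans h.left_mem.2) hq x
      ⟨hx, (ElementaryEmbedding.mem_strip_iff e).1 hx'⟩ y
      ⟨hy, (ElementaryEmbedding.mem_strip_iff e).1 hy'⟩
      ⟨k, (ElementaryEmbedding.pathIn_strip_iff e).1 hk⟩
    refine hM'.conn_real ?_ ⟨k', pathIn_iff_walk.1 (ElementaryEmbedding.pathIn_image e hk')⟩
    exact fun z hz => ⟨hz.1, hM'.strip_iff.1 hz.2⟩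

/-- Linked vertices have consecutive levels, and a path has one vertex on each level, so it has no
further edges. -/
theorem FreePath.adj_path_iff {D : Set M} {l : ℤ} {m : ℕ} {a b : Vertex M} {c : Fin (m + 1) → M}
    (hc : FreePath N D l m a b c) (hM : IsColoredSpace N M) (i j : Fin (m + 1)) :
    Adj N (c i) (c j) ↔ (i : ℕ) + 1 = j ∨ (j : ℕ) + 1 = i := by
  have key : ∀ i j : Fin (m + 1), (i : ℕ) + 1 = j → Adj N (c i) (c j) := by
    intro i j hij
    have := j.2
    have h := hc.adj ⟨i, by omega⟩
    rwa [show (Fin.castSucc ⟨i, by omega⟩ : Fin (m + 1)) = i from rfl,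
      show (Fin.succ ⟨i, by omega⟩ : Fin (m + 1)) = j from Fin.ext hij] at h
  constructor
  · intro h
    have e1 := hc.lev_path hM i
    have e2 := hc.lev_path hM j
    rcases hM.real_link_real.2 h with h | h
    · have := hM.graph.lev_up h
      omega
    · have := hM.graph.lev_up h
      omega
  · rintro (h | h)
    · exact key i j h
    · exact hM.adj_symm _ _ (key j i h)

end Families

-- Free paths in elementary extensions

universe v

/-- A free path between two vertices of a given set exists in some elementary extension. -/
theorem exists_freePath {M : Type v} [(lang N).Structure M] (hM : M ⊨ PS N) {D : Set M} {l : ℤ}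
    {m : ℕ} {a b : Vertex M} (hl : -1 ≤ l) (hr : l + m + 2 ≤ N + 1) (ha : a.Mem D) (hb : b.Mem D)
    (ha' : VLevel N l a) (hb' : VLevel N (l + m + 2) b) (hab : Beneath N Set.univ a b) :
    ∃ (M' : Type v) (_ : (lang N).Structure M') (e : M ↪ₑ[lang N] M') (c : Fin (m + 1) → M'),
      FreePath N (e '' D) l m (a.map e) (b.map e) c := by
  classical
  obtain ⟨hM1, -, hf⟩ := models_PS_iff.1 hM
  -- The axiom on far paths asks for `a` and `b` to be members of the finite set, so they are added
  -- to `F ∩ D`.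
  let A : Finset M → Set M := fun F => {x | x ∈ F ∧ x ∈ D} ∪ {x | .real x = a} ∪ {x | .real x = b}
  have hsing : ∀ a : Vertex M, {x | Vertex.real x = a}.Finite := by
    intro a
    refine Set.Subsingleton.finite fun x hx y hy => ?_
    have hx : Vertex.real x = a := hx
    have hy : Vertex.real y = a := hy
    simpa using hx.trans hy.symm
  have hA : ∀ F, (A F).Finite := fun F => ((F.finite_toSet.subset fun x hx => hx.1).union
    (hsing a)).union (hsing b)
  have haA : ∀ F, a.Mem (A F) := fun F => by
    cases a with
    | bot => trivial
    | real x => exact .inl (.inr rfl)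
    | top => trivial
  have hbA : ∀ F, b.Mem (A F) := fun F => by
    cases b with
    | bot => trivial
    | real x => exact .inr rfl
    | top => trivial
  choose c h1 h2 h3 h4 h5 using fun j : Finset M × ℕ =>
    hf (A j.1) (hA j.1) l m hl hr a b (haA j.1) (hbA j.1) ha' hb' hab j.2
  have : Nonempty M := ⟨c (∅, 0) 0⟩
  -- A pair `(F, n)` indexes a path at distance more than `n` from `F ∩ D`. Along an ultrafilter
  -- finer than `atTop`, each given vertex of `D` and each given distance are eventually taken care
  -- of.
  let u : Ultrafilter (Finset M × ℕ) := Ultrafilter.of atTop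
  have hu : ∀ {p : Finset M × ℕ → Prop}, (∀ᶠ j in atTop, p j) → ∀ᶠ j in u, p j :=
    fun h => Ultrafilter.of_le _ h
  let P := (u : Filter (Finset M × ℕ)).Product fun _ => M
  let e : M ↪ₑ[lang N] P := ⟨fun x => ((fun _ => x : Finset M × ℕ → M) : P), fun n φ x => by
    have := Ultraproduct.realize_formula_cast (u := u) φ (fun i (_ : Finset M × ℕ) => x i)
    rw [eventually_const] at this
    exact this⟩
  have he : ∀ x, e x = ((fun _ => x : Finset M × ℕ → M) : P) := fun _ => rfl
  let c' : Fin (m + 1) → P := fun i => ((fun j => c j i : Finset M × ℕ → M) : P)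
  have hc' : ∀ i, c' i = ((fun j => c j i : Finset M × ℕ → M) : P) := fun _ => rfl
  have hmem : ∀ {v : Vertex M}, v.Mem D → (v.map e).Mem (e '' D) := by
    rintro (_ | x | _) hv
    exacts [trivial, ⟨x, hv, rfl⟩, trivial]
  have hlev : ∀ {v : Vertex M} {i : ℤ}, VLevel N i v → VLevel N i (v.map e) := by
    rintro (_ | x | _) i hv
    exacts [hv, (ElementaryEmbedding.level_iff e).2 hv, hv]
  refine ⟨P, inferInstance, e, c', ⟨⟨fun i => ?_, ?_, ?_, fun i => ?_⟩, hl, hr, hmem ha, hmem hb,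
    hlev ha', hlev hb', ?_⟩⟩
  · exact (level_cast _).2 (Eventually.of_forall fun j => h1 j i)
  · cases a with
    | bot => exact (level_cast _).2 (Eventually.of_forall fun j => h2 j)
    | real x => exact (adj_cast _ _).2 (Eventually.of_forall fun j => h2 j)
    | top => exact (level_cast _).2 (Eventually.of_forall fun j => h2 j)
  · cases b with
    | bot => exact (level_cast _).2 (Eventually.of_forall fun j => h3 j)
    | real x => exact (adj_cast _ _).2 (Eventually.of_forall fun j => h3 j)
    | top => exact (level_cast _).2 (Eventually.of_forall fun j => h3 j)
  · exact (adj_cast _ _).2 (Eventually.of_forall fun j => h4 j i)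
  · rintro _ ⟨x, hx, rfl⟩ i k hk
    replace hk := (pathIn_strip_cast _ _).1 hk
    -- A path of length `k` to `x` in the ultrapower would exist at some index `(F, n)` with `x ∈ F`
    -- and `k ≤ n`, against the choice of `c`.
    have h6 : ∀ᶠ j in u, (({x} : Finset M), k) ≤ j := hu (eventually_ge_atTop _)
    obtain ⟨j, h7, h8⟩ := (hk.and h6).exists
    obtain ⟨h9, h10⟩ := h8
    refine h5 j x (.inl (.inl ⟨h9 (by simp), hx⟩)) ?_ i k h10 h7
    obtain ⟨_, -, rfl, h11, -⟩ := h7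
    exact h11 _

end Elementary

/-! ## Back and forth between nice sets -/

section NiceIso

universe u v w

variable {N : ℕ}

variable (N) in
/-- Two families with the same atomic formulas, both enumerating nice sets. -/
structure NiceIso {ι M M' : Type*} [(lang N).Structure M] [(lang N).Structure M'] (g : ι → M)
    (g' : ι → M') : Prop extends SameAtomic N g g' where
  nice : Nice N (Set.range g)
  nice' : Nice N (Set.range g')

theorem NiceIso.symm {ι M M' : Type*} [(lang N).Structure M] [(lang N).Structure M'] {g : ι → M}
    {g' : ι → M'} (h : NiceIso N g g') : NiceIso N g' g :=
  ⟨h.toSameAtomic.symm, h.nice', h.nice⟩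

/-- An isomorphism of nice sets extends to a set which arises by adjoining a free path, after
replacing the second model by an elementary extension. -/
theorem NiceIso.extend_attach {ι : Type w} {M : Type u} {M' : Type v} [(lang N).Structure M]
    [(lang N).Structure M'] (hM : M ⊨ PS N) (hM' : M' ⊨ PS N) {g : ι → M} {g' : ι → M'}
    (h : NiceIso N g g') {D : Set M} (hD : Attach N (Set.range g) D) :
    ∃ (M'' : Type v) (_ : (lang N).Structure M'') (e : M' ↪ₑ[lang N] M'') (κ : Type w) (s : ι → κ)
      (k : κ → M) (k' : κ → M''), NiceIso N k k' ∧ Set.range k = D ∧ k ∘ s = g ∧ k' ∘ s = e ∘ g' := by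
  obtain ⟨hM1, hM2, hM3⟩ := models_PS_iff.1 hM
  obtain ⟨l, m, a, b, c, hc, rfl⟩ := hD
  have key : ∀ a : Vertex M, a.Mem (Set.range g) → ∃ a' : Vertex ι, a'.map g = a := by
    rintro (_ | x | _) hx
    · exact ⟨.bot, rfl⟩
    · obtain ⟨i, rfl⟩ := hx
      exact ⟨.real i, rfl⟩
    · exact ⟨.top, rfl⟩
  have key' : ∀ a : Vertex ι, (a.map g').Mem (Set.range g') := by
    rintro (_ | i | _)
    exacts [trivial, ⟨i, rfl⟩, trivial]
  obtain ⟨α, rfl⟩ := key a hc.mem_left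
  obtain ⟨β, rfl⟩ := key b hc.mem_right
  -- By niceness, the relation between real ends is witnessed by a rising path inside of the range
  -- of `g`, which the atomic formulas transfer to `g'`.
  have hab : Beneath N Set.univ (α.map g') (β.map g') := by
    have hlt := (hc.left_lt hM1 0 (S := Set.univ) (fun _ => trivial) trivial).trans
      (hc.lt_right hM1 0 (fun _ => trivial) trivial)
    have hlt' := hlt.lev_lt
    have ha := hM1.lev_mem (α.map g)
    have hb := hM1.lev_mem (β.map g)
    cases α with
    | bot =>
      cases β with
      | bot => exact absurd hlt' (lt_irrefl _)
      | real j => trivial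
      | top => trivial
    | real i =>
      cases β with
      | bot => change _ < hM1.graph.lev .bot at hlt'; rw [hM1.lev_bot] at hlt'; omega
      | real j =>
        have h1 := (hM1.nice_iff.1 h.nice).1 _ ⟨i, rfl⟩ _ ⟨j, rfl⟩ hlt
        have h2 := h.beneath (hM1.beneath_real_iff.2 h1)
        obtain ⟨l, k, hk, c, h3, h4, h5, h6⟩ := h2
        exact ⟨l, k, hk, c, h3, h4, fun i => ⟨trivial, (h5 i).2⟩, h6⟩
      | top => trivial
    | top => change hM1.graph.lev .top < _ at hlt'; rw [hM1.lev_top] at hlt'; omega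
  obtain ⟨M'', inst, e, c', hc'⟩ := exists_freePath hM' hc.le_level hc.level_le (key' α) (key' β)
    ((h.vLevel_iff α).1 hc.vLevel_left) ((h.vLevel_iff β).1 hc.vLevel_right) hab
  have hM'' : M'' ⊨ PS N := (e.theory_model_iff _).1 hM'
  obtain ⟨hM1'', hM2'', hM3''⟩ := models_PS_iff.1 hM''
  have h' := h.toSameAtomic.map e
  have hnice := h.nice'.image (models_PS_iff.1 hM').1 hM1'' e
  rw [← Set.range_comp, Vertex.map_map, Vertex.map_map] at hc'
  rw [← Set.range_comp] at hnice
  -- On both sides the links to the path are those at its ends, and the ends correspond to each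
  -- other; hence the atomic formulas agree.
  have hadj : ∀ i j, Adj N (c j) (g i) ↔ Adj N (c' j) ((e ∘ g') i) := fun i j => by
    rw [hc.adj_iff hM1 hM2 hM3 h.nice j ⟨i, rfl⟩, hc'.adj_iff hM1'' hM2'' hM3'' hnice j ⟨i, rfl⟩,
      h'.map_eq_real_iff, h'.map_eq_real_iff]
  have hinj : ∀ i j, c i = c j ↔ i = j := fun i j => ⟨fun hij => by
    have := hc.lev_path hM1 i
    rw [hij, hc.lev_path hM1 j] at this
    exact Fin.ext (by omega), fun hij => by rw [hij]⟩
  have hinj' : ∀ i j, c' i = c' j ↔ i = j := fun i j => ⟨fun hij => by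
    have := hc'.lev_path hM1'' i
    rw [hij, hc'.lev_path hM1'' j] at this
    exact Fin.ext (by omega), fun hij => by rw [hij]⟩
  refine ⟨M'', inst, e, ι ⊕ Fin (m + 1), Sum.inl, Sum.elim g c, Sum.elim (e ∘ g') c',
    ⟨⟨?_, ?_, ?_⟩, ?_, ?_⟩, Set.Sum.elim_range g c, rfl, rfl⟩
  · rintro (i | i) (j | j) <;> simp only [Sum.elim_inl, Sum.elim_inr]
    · exact h'.eq_iff i j
    · exact iff_of_false (fun hij => hc.notMem hM1 j ⟨i, hij⟩) fun hij => hc'.notMem hM1'' j ⟨i, hij⟩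
    · exact iff_of_false (fun hij => hc.notMem hM1 i ⟨j, hij.symm⟩)
        fun hij => hc'.notMem hM1'' i ⟨j, hij.symm⟩
    · rw [hinj, hinj']
  · rintro (i | i) k <;> simp only [Sum.elim_inl, Sum.elim_inr]
    · exact h'.level_iff i k
    · rw [hM1.level_iff, hM1''.level_iff, hc.lev_path hM1, hc'.lev_path hM1'']
  · rintro (i | i) (j | j) <;> simp only [Sum.elim_inl, Sum.elim_inr]
    · exact h'.adj_iff i j
    · exact ⟨fun hij => hM1''.adj_symm _ _ ((hadj i j).1 (hM1.adj_symm _ _ hij)),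
        fun hij => hM1.adj_symm _ _ ((hadj i j).2 (hM1''.adj_symm _ _ hij))⟩
    · exact hadj j i
    · rw [hc.adj_path_iff hM1, hc'.adj_path_iff hM1'']
  · rw [Set.Sum.elim_range]
    exact hc.nice hM1 hM2 hM3 h.nice
  · rw [Set.Sum.elim_range]
    exact hc'.nice hM1'' hM2'' hM3'' hnice

theorem NiceIso.extend_reflTransGen {ι : Type w} {M : Type u} {M' : Type v}
    [(lang N).Structure M] [(lang N).Structure M'] (hM : M ⊨ PS N) (hM' : M' ⊨ PS N) {g : ι → M}
    {g' : ι → M'} (h : NiceIso N g g') {D : Set M}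
    (hD : Relation.ReflTransGen (Attach N) (Set.range g) D) :
    ∃ (M'' : Type v) (_ : (lang N).Structure M'') (e : M' ↪ₑ[lang N] M'') (κ : Type w) (s : ι → κ)
      (k : κ → M) (k' : κ → M''), NiceIso N k k' ∧ Set.range k = D ∧ k ∘ s = g ∧ k' ∘ s = e ∘ g' := by
  induction hD with
  | refl => exact ⟨M', inferInstance, .refl _ _, ι, id, g, g', h, rfl, rfl, rfl⟩
  | tail _ hD ih =>
    obtain ⟨M₁, inst₁, e₁, κ₁, s₁, k₁, k₁', h₁, rfl, rfl, h₂⟩ := ih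
    obtain ⟨M₂, inst₂, e₂, κ₂, s₂, k₂, k₂', h₃, rfl, rfl, h₄⟩ :=
      h₁.extend_attach hM ((e₁.theory_model_iff _).1 hM') hD
    refine ⟨M₂, inst₂, e₂.comp e₁, κ₂, s₂ ∘ s₁, k₂, k₂', h₃, rfl, rfl, ?_⟩
    rw [← Function.comp_assoc, h₄, Function.comp_assoc, h₂]
    rfl

/-- An isomorphism of nice sets extends to a set containing a given vertex, after replacing the
second model by an elementary extension. -/
theorem NiceIso.extend {ι : Type w} {M : Type u} {M' : Type v} [(lang N).Structure M]
    [(lang N).Structure M'] (hM : M ⊨ PS N) (hM' : M' ⊨ PS N) {g : ι → M} {g' : ι → M'}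
    (h : NiceIso N g g') (x : M) :
    ∃ (M'' : Type v) (_ : (lang N).Structure M'') (e : M' ↪ₑ[lang N] M'') (κ : Type w) (s : ι → κ)
      (k : κ → M) (k' : κ → M'') (i : κ),
      NiceIso N k k' ∧ k i = x ∧ k ∘ s = g ∧ k' ∘ s = e ∘ g' := by
  obtain ⟨hM1, hM2, hM3⟩ := models_PS_iff.1 hM
  obtain ⟨D, hD, hx⟩ := h.nice.exists_attach hM1 hM2 hM3 x
  obtain ⟨M'', inst, e, κ, s, k, k', h1, rfl, h2, h3⟩ := h.extend_reflTransGen hM hM' hD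
  obtain ⟨i, hi⟩ := hx
  exact ⟨M'', inst, e, κ, s, k, k', i, h1, hi, h2, h3⟩

theorem exists_eq_var {N : ℕ} {α : Type*} (t : (lang N).Term α) : ∃ x, t = Term.var x := by
  cases t with
  | var x => exact ⟨x, rfl⟩
  | func f => exact f.elim

theorem relMap_level_iff {M : Type*} [(lang N).Structure M] {i : Fin (N + 1)} {f : Fin 1 → M} :
    Structure.RelMap (L := lang N) (Rel.level i) f ↔ Level N i (f 0) := by
  rw [show f = ![f 0] from funext fun j => by rw [Subsingleton.elim j 0]; rfl]
  refine ⟨fun h => ⟨i, rfl, h⟩, fun ⟨j, hj, h⟩ => ?_⟩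
  obtain rfl : j = i := Fin.ext (by exact_mod_cast hj)
  exact h

theorem relMap_adj_iff {M : Type*} [(lang N).Structure M] {f : Fin 2 → M} :
    Structure.RelMap (L := lang N) Rel.adj f ↔ Adj N (f 0) (f 1) := by
  rw [Adj, show ![f 0, f 1] = f from List.ofFn_inj.1 rfl]

/-- Isomorphisms of nice sets preserve all formulas. -/
theorem NiceIso.realize_iff {α : Type*} {n : ℕ} (φ : (lang N).BoundedFormula α n) {ι : Type w}
    {M : Type u} {M' : Type v} [(lang N).Structure M] [(lang N).Structure M'] (hM : M ⊨ PS N)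
    (hM' : M' ⊨ PS N) {g : ι → M} {g' : ι → M'} (h : NiceIso N g g') (v : α → ι) (xs : Fin n → ι) :
    φ.Realize (g ∘ v) (g ∘ xs) ↔ φ.Realize (g' ∘ v) (g' ∘ xs) := by
  induction φ generalizing ι M M' with
  | falsum => rfl
  | equal t₁ t₂ =>
    obtain ⟨x, rfl⟩ := exists_eq_var t₁
    obtain ⟨y, rfl⟩ := exists_eq_var t₂
    simp only [BoundedFormula.Realize, Term.realize_var, ← Sum.comp_elim]
    exact h.eq_iff _ _
  | rel R ts =>
    choose x hx using fun i => exists_eq_var (ts i)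
    obtain rfl : ts = fun i => Term.var (x i) := funext hx
    simp only [BoundedFormula.Realize, Term.realize_var, ← Sum.comp_elim]
    cases R with
    | level i =>
      rw [relMap_level_iff, relMap_level_iff]
      exact h.level_iff _ _
    | adj =>
      rw [relMap_adj_iff, relMap_adj_iff]
      exact h.adj_iff _ _
  | imp _ _ ih₁ ih₂ =>
    simp only [BoundedFormula.Realize]
    rw [ih₁ hM hM' h, ih₂ hM hM' h]
  | all φ ih =>
    constructor
    -- The given `y` lies in `M'`, so the isomorphism is extended from `M'` into an elementary
    -- extension of `M`. The quantified formula remains true there and is instantiated at the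
    -- partner of `y`. The induction hypothesis must hold for all models, since the model has
    -- changed.
    · intro hφ y
      obtain ⟨M₁, inst, e, κ, s, k, k', i, h₁, rfl, rfl, h₂⟩ := h.symm.extend hM' hM y
      have hφ' := (e.map_boundedFormula φ.all _ _).2 hφ
      rw [← Function.comp_assoc, ← Function.comp_assoc, ← h₂] at hφ'
      have h₃ := hφ' (k' i)
      have h₄ := ih ((e.theory_model_iff _).1 hM) hM' h₁.symm (s ∘ v) (Fin.snoc (s ∘ xs) i)
      rw [Fin.comp_snoc, Fin.comp_snoc] at h₄
      exact h₄.1 h₃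
    · intro hφ y
      obtain ⟨M₁, inst, e, κ, s, k, k', i, h₁, rfl, rfl, h₂⟩ := h.extend hM hM' y
      have hφ' := (e.map_boundedFormula φ.all _ _).2 hφ
      rw [← Function.comp_assoc, ← Function.comp_assoc, ← h₂] at hφ'
      have h₃ := hφ' (k' i)
      have h₄ := ih hM ((e.theory_model_iff _).1 hM') h₁ (s ∘ v) (Fin.snoc (s ∘ xs) i)
      rw [Fin.comp_snoc, Fin.comp_snoc] at h₄
      exact h₄.2 h₃

theorem NiceIso.realize_formula {α ι M M' : Type*} [(lang N).Structure M] [(lang N).Structure M']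
    (hM : M ⊨ PS N) (hM' : M' ⊨ PS N) {g : ι → M} {g' : ι → M'} (h : NiceIso N g g') (v : α → ι)
    (φ : (lang N).Formula α) : φ.Realize (g ∘ v) ↔ φ.Realize (g' ∘ v) := by
  have := h.realize_iff φ hM hM' v Fin.elim0
  rwa [Subsingleton.elim (g ∘ Fin.elim0) default, Subsingleton.elim (g' ∘ Fin.elim0) default] at this

theorem SameAtomic.of_isQF {ι M M' : Type*} [(lang N).Structure M] [(lang N).Structure M']
    {a : ι → M} {a' : ι → M'}
    (h : ∀ φ : (lang N).Formula ι, φ.IsQF → (φ.Realize a ↔ φ.Realize a')) :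
    SameAtomic N a a' where
  eq_iff i j := by
    have := h (Term.equal (Term.var i) (Term.var j)) (.of_isAtomic (.equal _ _))
    simpa [Formula.realize_equal] using this
  level_iff i k := by
    refine exists_congr fun j => and_congr_right fun _ => ?_
    exact Formula.realize_rel₁.symm.trans ((h (Relations.formula₁ (L := lang N) (Rel.level j)
      (Term.var i)) (.of_isAtomic (.rel _ _))).trans Formula.realize_rel₁)
  adj_iff i j := Formula.realize_rel₂.symm.trans ((h (Relations.formula₂ (L := lang N) Rel.adj
    (Term.var i) (Term.var j)) (.of_isAtomic (.rel _ _))).trans Formula.realize_rel₂)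

theorem level_map_iff {F M M' : Type*} [(lang N).Structure M] [(lang N).Structure M']
    [FunLike F M M'] [StrongHomClass (lang N) F M M'] (f : F) {x : M} {k : ℤ} :
    Level N k (f x) ↔ Level N k x := by
  refine exists_congr fun j => and_congr_right fun _ => ?_
  have := StrongHomClass.map_rel (L := lang N) f (Rel.level j) ![x]
  rwa [show f ∘ ![x] = ![f x] from List.ofFn_inj.1 rfl] at this

theorem adj_map_iff {F M M' : Type*} [(lang N).Structure M] [(lang N).Structure M']
    [FunLike F M M'] [StrongHomClass (lang N) F M M'] (f : F) {x y : M} :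
    Adj N (f x) (f y) ↔ Adj N x y := by
  have := StrongHomClass.map_rel (L := lang N) f Rel.adj ![x, y]
  rwa [show f ∘ ![x, y] = ![f x, f y] from List.ofFn_inj.1 rfl] at this

theorem SameAtomic.of_partialEquiv {M M' : Type*} [(lang N).Structure M] [(lang N).Structure M']
    (f : M ≃ₚ[lang N] M') :
    SameAtomic N (fun x : f.dom => (x : M)) (fun x => (f.toEquiv x : M')) where
  eq_iff i j := by simp
  level_iff i k := (level_map_iff f.dom.subtype).trans
    ((level_map_iff f.toEquiv).symm.trans (level_map_iff f.cod.subtype).symm)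
  adj_iff i j := (adj_map_iff f.dom.subtype).trans
    ((adj_map_iff f.toEquiv).symm.trans (adj_map_iff f.cod.subtype).symm)

theorem nice_empty {M : Type*} [(lang N).Structure M] : Nice N (∅ : Set M) where
  between_eq a b _ _ := by
    ext x
    simp [Between]
  connected _ _ _ _ _ x hx := absurd hx.1 (Set.notMem_empty x)

theorem nonempty_of_models {M : Type*} [(lang N).Structure M] (hM : M ⊨ PS N) : Nonempty M := by
  obtain ⟨-, -, hf⟩ := models_PS_iff.1 hM
  obtain ⟨c, -⟩ := hf ∅ Set.finite_empty (-1) N le_rfl (by omega) .bot .top trivial trivial rfl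
    (by simp only [VLevel]; ring) trivial 0
  exact ⟨c 0⟩

/-- The empty set is nice in both models, so the empty families start the back and forth. -/
theorem realize_sentence_iff {M M' : Type*} [(lang N).Structure M] [(lang N).Structure M']
    (hM : M ⊨ PS N) (hM' : M' ⊨ PS N) (φ : (lang N).Sentence) : M ⊨ φ ↔ M' ⊨ φ := by
  have h : NiceIso N (Empty.elim : Empty → M) (Empty.elim : Empty → M') :=
    ⟨⟨fun i => i.elim, fun i => i.elim, fun i => i.elim⟩, by
      rw [Set.range_eq_empty]; exact nice_empty, by rw [Set.range_eq_empty]; exact nice_empty⟩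
  have := h.realize_formula hM hM' id φ
  rwa [Subsingleton.elim (Empty.elim ∘ id : Empty → M) default,
    Subsingleton.elim (Empty.elim ∘ id : Empty → M') default] at this

end NiceIso

/-! ### Simple connectedness of subgraphs, with bounds on lengths -/

namespace Graded

variable {V : Type*} {G : Graded V} {S : Set V}

variable (G) in
/-- Simple connectedness of the subgraph `S` for the pair `a`, `b`. -/
def SimplyConnectedAt (S : Set V) (a b : V) : Prop :=
  ∀ p q : ℤ, G.lev a ≤ p → q ≤ G.lev b → ∀ x ∈ G.Ioo S a b, ∀ y ∈ G.Ioo S a b, ∀ k,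
    Walk G.Link (S ∩ (G.band p q \ {a, b})) k x y →
      ∃ k' ≤ k, Walk G.Link (S ∩ G.band p q ∩ G.Ioo S a b) k' x y

theorem SimplyConnectedAt.dual {a b : V} (h : G.SimplyConnectedAt S a b) :
    G.dual.SimplyConnectedAt S b a := by
  intro p q hp hq x hx y hy k hk
  change -G.lev b ≤ p at hp
  change q ≤ -G.lev a at hq
  rw [dual_Ioo] at hx hy
  rw [dual_link, dual_band] at hk ⊢
  rw [dual_Ioo]
  rw [Set.pair_comm] at hk
  exact h (-q) (-p) (by omega) (by omega) x hx y hy k hk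

theorem dual_dual : G.dual.dual = G := by
  cases G
  simp [Graded.dual]

theorem simplyConnectedAt_of_dual {a b : V} (h : G.dual.SimplyConnectedAt S b a) :
    G.SimplyConnectedAt S a b := by
  have := h.dual
  rwa [dual_dual] at this

theorem lev_sub_le_of_walk {k : ℕ} {x y : V} (h : Walk G.Link S k x y) :
    G.lev x - G.lev y ≤ k ∧ G.lev y - G.lev x ≤ k := by
  induction h with
  | nil _ => simp
  | cons _ h _ ih =>
    push_cast
    rcases h with h | h <;> have := G.lev_up h <;> omega

/-- A rising path from `x` to `y`, with its vertices between `x` and `y`. -/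
theorem Lt.walk_between {x y : V} (h : G.Lt S x y) : ∃ k : ℕ, G.lev y = G.lev x + k ∧
    Walk G.Link {z | z ∈ S ∧ (z = x ∨ G.Lt S x z) ∧ (z = y ∨ G.Lt S z y)} k x y := by
  induction h with
  | @single y h =>
    exact ⟨1, by simp [G.lev_up h.2.2], .single ⟨h.1, .inl rfl, .inr (.single h.1 h.2.1 h.2.2)⟩
      ⟨h.2.1, .inr (.single h.1 h.2.1 h.2.2), .inl rfl⟩ (.inl h.2.2)⟩
  | @tail y z h1 h ih =>
    obtain ⟨k, h2, h3⟩ := ih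
    have hyz : G.Lt S y z := .single h.1 h.2.1 h.2.2
    refine ⟨k + 1, by rw [G.lev_up h.2.2, h2]; push_cast; ring, (h3.mono ?_).trans
      (.single ⟨h.1, .inr h1, .inr hyz⟩ ⟨h.2.1, .inr (.tail h1 h), .inl rfl⟩ (.inl h.2.2))⟩
    rintro w ⟨h4, h5, rfl | h6⟩
    · exact ⟨h4, h5, .inr hyz⟩
    · exact ⟨h4, h5, .inr (h6.trans hyz)⟩

/-- If `g` is the only vertex linked to `a` from above, then simple connectedness for `g`, `b`
implies simple connectedness for `a`, `b`. -/
theorem SimplyConnectedAt.of_unique_up {a b g : V} (hg : G.up a g) (ha : a ∈ S) (hgS : g ∈ S)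
    (hu : ∀ y ∈ S, G.up a y → y = g) (h : G.SimplyConnectedAt S g b) :
    G.SimplyConnectedAt S a b := by
  have hag : G.Lt S a g := .single ha hgS hg
  have hlev := G.lev_up hg
  have hcov : ∀ x, G.Lt S a x → x = g ∨ G.Lt S g x := by
    intro x hx
    rcases Relation.TransGen.head'_iff.1 hx with ⟨z, hz, hzx⟩
    obtain rfl := hu z hz.2.1 hz.2.2
    rcases Relation.reflTransGen_iff_eq_or_transGen.1 hzx with h | h
    exacts [.inl h, .inr h]
  have hrise : ∀ p q : ℤ, p ≤ G.lev g → ∀ x, G.lev x ≤ q → x ∈ G.Ioo S a b → ∃ k : ℕ,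
      G.lev x = G.lev g + k ∧ Walk G.Link (S ∩ G.band p q ∩ G.Ioo S a b) k g x := by
    intro p q hp x hq hx
    rcases hcov x hx.1 with rfl | h1
    · exact ⟨0, by simp, .nil ⟨⟨hgS, hp, hq⟩, hx⟩⟩
    · obtain ⟨k, hk, h2⟩ := h1.walk_between
      refine ⟨k, hk, h2.mono ?_⟩
      rintro z ⟨h3, h4, h5⟩
      have h6 : G.lev g ≤ G.lev z ∧ G.Lt S a z := by
        rcases h4 with rfl | h4
        exacts [⟨le_rfl, hag⟩, ⟨h4.lev_lt.le, hag.trans h4⟩]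
      have h7 : G.lev z ≤ G.lev x ∧ G.Lt S z b := by
        rcases h5 with rfl | h5
        exacts [⟨le_rfl, hx.2⟩, ⟨h5.lev_lt.le, h5.trans hx.2⟩]
      exact ⟨⟨h3, hp.trans h6.1, h7.1.trans hq⟩, h6.2, h7.2⟩
  intro p q hp hq x hx y hy k hk
  -- If the walk reaches a vertex `v` not above the level of `g`, it may be replaced by the path
  -- from `x` down to `g` and up to `y`: both halves are no longer than the differences of levels to
  -- `v`, which bound the two parts of the walk from below.
  have low : ∀ (v : V) (i j : ℕ), p ≤ G.lev v → G.lev v ≤ G.lev g → i + j ≤ k →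
      G.lev x - G.lev v ≤ i → G.lev y - G.lev v ≤ j →
      ∃ k' ≤ k, Walk G.Link (S ∩ G.band p q ∩ G.Ioo S a b) k' x y := by
    intro v i j h1 h2 h3 h4 h5
    obtain ⟨k₁, h6, h7⟩ := hrise p q (h1.trans h2) x hk.left_mem.2.1.2 hx
    obtain ⟨k₂, h8, h9⟩ := hrise p q (h1.trans h2) y hk.right_mem.2.1.2 hy
    exact ⟨k₁ + k₂, by omega, (h7.symm Link.symm).trans h9⟩
  by_cases hxg : G.lev x ≤ G.lev g
  · exact low x 0 k hk.left_mem.2.1.1 hxg (by omega) (by simp) (lev_sub_le_of_walk hk).2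
  · rcases hk.exit {z | G.lev g < G.lev z} (not_le.1 hxg) with h1 | ⟨u, v, i, j, _, hv, h1, h2, h3, h4⟩
    · have hIoo : ∀ z, G.lev g < G.lev z → z ∈ G.Ioo S a b → z ∈ G.Ioo S g b := by
        intro z hz hz'
        rcases hcov z hz'.1 with rfl | h2
        · exact absurd hz (lt_irrefl _)
        · exact ⟨h2, hz'.2⟩
      -- A walk which remains above the level of `g` avoids `g`, and its ends lie over `g`; the
      -- assumption for `g`, `b` applies with the raised lower bound.
      have hw : Walk G.Link (S ∩ (G.band (max p (G.lev g + 1)) q \ {g, b})) k x y := by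
        refine h1.mono ?_
        rintro z ⟨⟨h4, h5, h6⟩, h7⟩
        have h7 : G.lev g < G.lev z := h7
        refine ⟨h4, ⟨max_le h5.1 h7, h5.2⟩, ?_⟩
        rintro (rfl | h8)
        · exact lt_irrefl _ h7
        · exact h6 (.inr h8)
      obtain ⟨k', h2, h3⟩ := h _ q (by omega) hq x (hIoo x h1.left_mem.2 hx) y
        (hIoo y h1.right_mem.2 hy) k hw
      refine ⟨k', h2, h3.mono ?_⟩
      rintro z ⟨⟨h4, h5⟩, h6⟩
      exact ⟨⟨h4, band_mono (le_max_left _ _) le_rfl h5⟩, hag.trans h6.1, h6.2⟩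
    · have hv : ¬ G.lev g < G.lev v := hv
      have h5 := lev_sub_le_of_walk h3
      have h6 := lev_sub_le_of_walk h4
      refine low v (i + 1) j h4.left_mem.2.1.1 (not_lt.1 hv) (by omega) ?_ h6.2
      push_cast
      rcases h1 with h1 | h1 <;> have := G.lev_up h1 <;> omega

theorem SimplyConnectedAt.of_unique_down {a b g : V} (hg : G.up g b) (hb : b ∈ S) (hgS : g ∈ S)
    (hu : ∀ y ∈ S, G.up y b → y = g) (h : G.SimplyConnectedAt S a g) :
    G.SimplyConnectedAt S a b :=
  simplyConnectedAt_of_dual (h.dual.of_unique_up (G := G.dual) hg hb hgS hu)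

end Graded

/-! ## Construction of a model -/

/-- Names for the vertices of the free pseudospace: `node k e f i` is the vertex on level `i` of the
path between `e` and `f` which is adjoined in the `k`-th step. -/
inductive Node
  | bot : Node
  | top : Node
  | node (k : ℕ) (e f : Node) (i : ℤ) : Node

namespace Node

variable (N : ℕ)

/-- The level of a vertex. -/
def lev : Node → ℤ
  | bot => -1
  | top => N + 1
  | node _ _ _ i => i

/-- The edges of the free pseudospace. -/
inductive Up : Node → Node → Prop
  | first (k : ℕ) (e f : Node) : Up e (node k e f (lev N e + 1))
  | step (k : ℕ) (e f : Node) (i : ℤ) : Up (node k e f i) (node k e f (i + 1))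
  | last (k : ℕ) (e f : Node) : Up (node k e f (lev N f - 1)) f

/-- The graph of all names. -/
def graph : Graded Node where
  up := Up N
  lev := lev N
  lev_up h := by
    cases h with
    | first => rfl
    | step => rfl
    | last => simp [lev]

/-- The vertices which are present after step `n`. -/
def stage : ℕ → Set Node
  | 0 => {bot, top} ∪ {x | ∃ i : ℤ, 0 ≤ i ∧ i ≤ N ∧ x = node 0 bot top i}
  | n + 1 => stage n ∪ {x | ∃ e f i, x = node (n + 1) e f i ∧ (graph N).Lt (stage n) e f ∧
      lev N e < i ∧ i < lev N f}

/-- `x` is a vertex on the path between `e` and `f` which is adjoined in step `n + 1`. -/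
def New (n : ℕ) (e f : Node) (i : ℤ) (x : Node) : Prop :=
  x = node (n + 1) e f i ∧ (graph N).Lt (stage N n) e f ∧ lev N e < i ∧ i < lev N f

variable {N} {n : ℕ} {e f x y a b : Node} {i : ℤ}

theorem stage_subset_succ : stage N n ⊆ stage N (n + 1) := Set.subset_union_left

theorem stage_mono {m n : ℕ} (h : m ≤ n) : stage N m ⊆ stage N n :=
  monotone_nat_of_le_succ (f := stage N) (fun _ => stage_subset_succ) h

theorem bot_mem : bot ∈ stage N n := stage_mono (Nat.zero_le n) (.inl (.inl rfl))

theorem top_mem : top ∈ stage N n := stage_mono (Nat.zero_le n) (.inl (.inr rfl))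

/-- Paths are adjoined as a whole and after their ends. The bound `k ≤ n` shows that the names used
in step `n + 1` are new. -/
theorem node_mem {k : ℕ} (h : node k e f i ∈ stage N n) :
    k ≤ n ∧ e ∈ stage N n ∧ f ∈ stage N n ∧ lev N e < i ∧ i < lev N f ∧
      ∀ j, lev N e < j → j < lev N f → node k e f j ∈ stage N n := by
  induction n with
  | zero =>
    rcases h with (h | h) | ⟨j, h1, h2, h⟩
    · cases h
    · cases h
    · cases h
      refine ⟨le_rfl, bot_mem, top_mem, ?_, ?_, fun j h3 h4 => .inr ⟨j, ?_, ?_, rfl⟩⟩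
      all_goals simp only [lev] at *; omega
  | succ n ih =>
    rcases h with h | ⟨e', f', j, h, h1, h2, h3⟩
    · obtain ⟨h1, h2, h3, h4, h5, h6⟩ := ih h
      exact ⟨by omega, .inl h2, .inl h3, h4, h5, fun j h7 h8 => .inl (h6 j h7 h8)⟩
    · cases h
      exact ⟨le_rfl, .inl h1.left_mem, .inl h1.right_mem, h2, h3,
        fun j h7 h8 => .inr ⟨_, _, j, rfl, h1, h7, h8⟩⟩

theorem New.notMem (h : New N n e f i x) : x ∉ stage N n := by
  rintro hx
  rw [h.1] at hx
  have := (node_mem hx).1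
  omega

theorem New.mem (h : New N n e f i x) : x ∈ stage N (n + 1) := .inr ⟨e, f, i, h⟩

theorem New.left_mem (h : New N n e f i x) : e ∈ stage N n := h.2.1.left_mem

theorem New.right_mem (h : New N n e f i x) : f ∈ stage N n := h.2.1.right_mem

theorem New.lev_eq (h : New N n e f i x) : (graph N).lev x = i := by
  rw [h.1]
  rfl

theorem New.move (h : New N n e f i x) {j : ℤ} (hj : lev N e < j) (hj' : j < lev N f) :
    New N n e f j (node (n + 1) e f j) := ⟨rfl, h.2.1, hj, hj'⟩

/-- The edges which are present after step `n + 1`. -/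
theorem up_cases (h : (graph N).up x y) (hx : x ∈ stage N (n + 1)) (hy : y ∈ stage N (n + 1)) :
    (x ∈ stage N n ∧ y ∈ stage N n) ∨ (∃ f, New N n x f (lev N x + 1) y) ∨
      (∃ e, New N n e y (lev N y - 1) x) ∨ ∃ e f i, New N n e f i x ∧ New N n e f (i + 1) y := by
  cases h with
  | first k e f =>
    rcases hy with hy | ⟨e', f', j, hy⟩
    · exact .inl ⟨(node_mem hy).2.1, hy⟩
    · obtain ⟨h1, h2⟩ := hy
      cases h1
      exact .inr (.inl ⟨f, rfl, h2⟩)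
  | step k e f i =>
    rcases hx with hx | ⟨e', f', j, hx⟩
    · obtain ⟨h1, h2, h3, h4, h5, h6⟩ := node_mem hx
      obtain ⟨-, -, -, h7, h8, -⟩ := node_mem hy
      exact .inl ⟨hx, h6 _ h7 h8⟩
    · obtain ⟨h1, h2⟩ := hx
      cases h1
      obtain ⟨-, -, -, h7, h8, -⟩ := node_mem hy
      exact .inr (.inr (.inr ⟨e, f, i, ⟨rfl, h2⟩, rfl, h2.1, h7, h8⟩))
  | last k e f =>
    rcases hx with hx | ⟨e', f', j, hx⟩
    · exact .inl ⟨hx, (node_mem hx).2.2.1⟩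
    · obtain ⟨h1, h2⟩ := hx
      cases h1
      exact .inr (.inr (.inl ⟨e, rfl, h2⟩))

/-- A rising path from an old vertex enters a new path only at its lower end `e`. If it leaves
through the upper end `f`, this passage is replaced by an old rising path from `e` to `f`. -/
theorem lt_cases_right (h : (graph N).Lt (stage N (n + 1)) x y) (hx : x ∈ stage N n) :
    (graph N).Lt (stage N n) x y ∨
      ∃ e f i, New N n e f i y ∧ (x = e ∨ (graph N).Lt (stage N n) x e) := by
  have main : ∀ {x z y}, x ∈ stage N n → (x = z ∧ x ∈ stage N n ∨ (graph N).Lt (stage N n) x z ∨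
      ∃ e f i, New N n e f i z ∧ (x = e ∨ (graph N).Lt (stage N n) x e)) →
      z ∈ stage N (n + 1) → y ∈ stage N (n + 1) → (graph N).up z y →
      (graph N).Lt (stage N n) x y ∨
      ∃ e f i, New N n e f i y ∧ (x = e ∨ (graph N).Lt (stage N n) x e) := by
    intro x z y hx h hz hy hzy
    have hz' : z ∈ stage N n → x = z ∨ (graph N).Lt (stage N n) x z := by
      intro hz
      rcases h with ⟨h, -⟩ | h | ⟨e, f, i, h, -⟩
      exacts [.inl h, .inr h, absurd hz h.notMem]
    rcases up_cases hzy hz hy with ⟨h1, h2⟩ | ⟨f, h1⟩ | ⟨e, h1⟩ | ⟨e, f, i, h1, h2⟩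
    · have h3 : (graph N).Lt (stage N n) z y := .single h1 h2 hzy
      rcases hz' h1 with rfl | h4
      exacts [.inl h3, .inl (h4.trans h3)]
    · exact .inr ⟨z, f, _, h1, hz' h1.left_mem⟩
    · left
      rcases h with ⟨rfl, h⟩ | h | ⟨e', f', i, ⟨h, -⟩, h2⟩
      · exact absurd h h1.notMem
      · exact absurd h.right_mem h1.notMem
      · have := h1.1.symm.trans h
        cases this
        rcases h2 with rfl | h2
        exacts [h1.2.1, h2.trans h1.2.1]
    · right
      rcases h with ⟨rfl, h⟩ | h | ⟨e', f', i, ⟨h, -⟩, h3⟩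
      · exact absurd h h1.notMem
      · exact absurd h.right_mem h1.notMem
      · have := h1.1.symm.trans h
        cases this
        exact ⟨_, _, _, h2, h3⟩
  induction h with
  | single h => exact main hx (.inl ⟨rfl, hx⟩) h.1 h.2.1 h.2.2
  | tail _ h ih => exact main hx (.inr ih) h.1 h.2.1 h.2.2

theorem lt_cases_left (h : (graph N).Lt (stage N (n + 1)) x y) (hy : y ∈ stage N n) :
    (graph N).Lt (stage N n) x y ∨
      ∃ e f i, New N n e f i x ∧ (f = y ∨ (graph N).Lt (stage N n) f y) := by
  have main : ∀ {x z y}, y ∈ stage N n → (z = y ∧ y ∈ stage N n ∨ (graph N).Lt (stage N n) z y ∨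
      ∃ e f i, New N n e f i z ∧ (f = y ∨ (graph N).Lt (stage N n) f y)) →
      x ∈ stage N (n + 1) → z ∈ stage N (n + 1) → (graph N).up x z →
      (graph N).Lt (stage N n) x y ∨
      ∃ e f i, New N n e f i x ∧ (f = y ∨ (graph N).Lt (stage N n) f y) := by
    intro x z y hy h hx hz hxz
    have hz' : z ∈ stage N n → z = y ∨ (graph N).Lt (stage N n) z y := by
      intro hz
      rcases h with ⟨h, -⟩ | h | ⟨e, f, i, h, -⟩
      exacts [.inl h, .inr h, absurd hz h.notMem]
    rcases up_cases hxz hx hz with ⟨h1, h2⟩ | ⟨f, h1⟩ | ⟨e, h1⟩ | ⟨e, f, i, h1, h2⟩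
    · have h3 : (graph N).Lt (stage N n) x z := .single h1 h2 hxz
      rcases hz' h2 with rfl | h4
      exacts [.inl h3, .inl (h3.trans h4)]
    · left
      rcases h with ⟨rfl, h⟩ | h | ⟨e', f', i, ⟨h, -⟩, h2⟩
      · exact absurd h h1.notMem
      · exact absurd h.left_mem h1.notMem
      · have := h1.1.symm.trans h
        cases this
        rcases h2 with rfl | h2
        exacts [h1.2.1, h1.2.1.trans h2]
    · exact .inr ⟨e, z, _, h1, hz' h1.right_mem⟩
    · right
      rcases h with ⟨rfl, h⟩ | h | ⟨e', f', i, ⟨h, -⟩, h3⟩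
      · exact absurd h h2.notMem
      · exact absurd h.left_mem h2.notMem
      · have := h2.1.symm.trans h
        cases this
        exact ⟨_, _, _, h1, h3⟩
  induction h using Relation.TransGen.head_induction_on with
  | single h => exact main hy (.inl ⟨rfl, hy⟩) h.1 h.2.1 h.2.2
  | head h _ ih => exact main hy (.inr ih) h.1 h.2.1 h.2.2

/-- New paths join only vertices which were comparable before, so old vertices acquire no new
relations. -/
theorem lt_stage_of_succ (h : (graph N).Lt (stage N (n + 1)) x y) (hx : x ∈ stage N n)
    (hy : y ∈ stage N n) : (graph N).Lt (stage N n) x y := by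
  rcases lt_cases_right h hx with h | ⟨e, f, i, h, -⟩
  exacts [h, absurd hy h.notMem]

/-- The path of which `x` is a vertex. -/
theorem New.exists_path (h : New N n e f i x) : ∃ F : ℤ → Node, F (lev N e) = e ∧
    F (lev N f) = f ∧ F i = x ∧ ∀ j, lev N e ≤ j → j < lev N f →
      F j ∈ stage N (n + 1) ∧ F (j + 1) ∈ stage N (n + 1) ∧ (graph N).up (F j) (F (j + 1)) := by
  classical
  let F : ℤ → Node := fun j =>
    if j = lev N e then e else if j = lev N f then f else node (n + 1) e f j
  have hlt : lev N e < lev N f := h.2.2.1.trans h.2.2.2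
  have F1 : F (lev N e) = e := if_pos rfl
  have F2 : F (lev N f) = f := by simp [F, hlt.ne']
  have F3 : ∀ j, lev N e < j → j < lev N f → F j = node (n + 1) e f j := by
    intro j h1 h2
    simp [F, h1.ne', h2.ne]
  have hmem : ∀ j, lev N e ≤ j → j ≤ lev N f → F j ∈ stage N (n + 1) := by
    intro j h1 h2
    rcases eq_or_lt_of_le h1 with rfl | h1
    · rw [F1]
      exact .inl h.left_mem
    rcases eq_or_lt_of_le h2 with rfl | h2
    · rw [F2]
      exact .inl h.right_mem
    · rw [F3 j h1 h2]
      exact (h.move h1 h2).mem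
  have hgap : lev N e + 1 < lev N f := by have := h.2.2; omega
  refine ⟨F, F1, F2, (F3 i h.2.2.1 h.2.2.2).trans h.1.symm, fun j h1 h2 =>
    ⟨hmem j h1 h2.le, hmem _ (by omega) (by omega), ?_⟩⟩
  rcases eq_or_lt_of_le h1 with rfl | h1
  · rw [F1, F3 _ (by omega) hgap]
    exact .first _ _ _
  by_cases h3 : j + 1 = lev N f
  · rw [h3, F2, F3 j h1 h2, show j = lev N f - 1 by omega]
    exact .last _ _ _
  · rw [F3 j h1 h2, F3 _ (by omega) (by omega)]
    exact .step _ _ _ _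

theorem New.left_lt (h : New N n e f i x) : (graph N).Lt (stage N (n + 1)) e x := by
  obtain ⟨F, h1, h2, h3, h4⟩ := h.exists_path
  have := h.2.2
  rw [← h1, ← h3]
  exact Graded.lt_of_path h.2.2.1 (fun j h5 h6 => (h4 j h5 (by omega)).1)
    fun j h5 h6 => (h4 j h5 (by omega)).2.2

theorem New.lt_right (h : New N n e f i x) : (graph N).Lt (stage N (n + 1)) x f := by
  obtain ⟨F, h1, h2, h3, h4⟩ := h.exists_path
  have := h.2.2
  rw [← h2, ← h3]
  refine Graded.lt_of_path h.2.2.2 (fun j h5 h6 => ?_) fun j h5 h6 => (h4 j (by omega) h6).2.2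
  have := (h4 (j - 1) (by omega) (by omega)).2.1
  rwa [sub_add_cancel] at this

/-- A walk which leaves the new vertices on the path between `e` and `f` leaves it to `e` or `f`. -/
theorem New.exit (h : New N n e f i x) (hxy : (graph N).Link x y) (hy : y ∈ stage N (n + 1)) :
    (∃ j, New N n e f j y) ∨ y = e ∨ y = f := by
  rcases hxy with hxy | hxy
  · rcases up_cases hxy h.mem hy with ⟨h1, -⟩ | ⟨f', h1⟩ | ⟨e', h1⟩ | ⟨e', f', j, h1, h2⟩
    · exact absurd h1 h.notMem
    · exact absurd h1.left_mem h.notMem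
    · have := h.1.symm.trans h1.1
      cases this
      exact .inr (.inr rfl)
    · have := h.1.symm.trans h1.1
      cases this
      exact .inl ⟨_, h2⟩
  · rcases up_cases hxy hy h.mem with ⟨-, h1⟩ | ⟨f', h1⟩ | ⟨e', h1⟩ | ⟨e', f', j, h1, h2⟩
    · exact absurd h1 h.notMem
    · have := h.1.symm.trans h1.1
      cases this
      exact .inr (.inl rfl)
    · exact absurd h1.right_mem h.notMem
    · have := h.1.symm.trans h2.1
      cases this
      exact .inl ⟨_, h1⟩

/-- Walks can be pushed back to an earlier stage. -/
theorem collapse {p q : ℤ} {F : Set Node} (hF : ∀ z ∈ F, lev N z ≤ p ∨ q ≤ lev N z) {k : ℕ}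
    (h : Walk (graph N).Link (stage N (n + 1) ∩ ((graph N).band p q \ F)) k x y)
    (hx : x ∈ stage N n) (hy : y ∈ stage N n) :
    ∃ k' ≤ k, Walk (graph N).Link (stage N n ∩ ((graph N).band p q \ F)) k' x y := by
  classical
  set K := (graph N).band p q \ F with hK
  have hP : ∀ e f, ∃ P : ℤ → Node, (graph N).Lt (stage N n) e f → P (lev N e) = e ∧ P (lev N f) = f ∧
      (∀ i, lev N e ≤ i → i ≤ lev N f → P i ∈ stage N n ∧ lev N (P i) = i) ∧
      ∀ i, lev N e ≤ i → i < lev N f → (graph N).up (P i) (P (i + 1)) := by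
    intro e f
    by_cases hef : (graph N).Lt (stage N n) e f
    · obtain ⟨P, hP⟩ := hef.exists_path
      exact ⟨P, fun _ => hP⟩
    · exact ⟨fun _ => e, fun h => absurd h hef⟩
  choose P hP using hP
  -- The new stage is folded onto the old one. A new path is mapped onto an old rising path between
  -- its ends if both ends are allowed, and onto its allowed end if there is just one. A path with
  -- no allowed end cannot be entered, and the value `x` is a dummy.
  let g : Node → Node → ℤ → Node := fun e f i =>
    if e ∈ K then if f ∈ K then P e f i else e else if f ∈ K then f else x
  let H : Node → Node := fun z => if z ∈ stage N n then z else
    match z with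
    | node _ e f i => g e f i
    | z => z
  have H1 : ∀ z ∈ stage N n, H z = z := fun z hz => if_pos hz
  have H2 : ∀ {e f i z}, New N n e f i z → H z = g e f i := by
    intro e f i z hz
    have hz' := hz.notMem
    obtain ⟨rfl, -⟩ := hz
    exact if_neg hz'
  have hxK : x ∈ K := h.left_mem.2
  have key := h.map (r' := (graph N).Link) (S'' := stage N n ∩ K) H ?_ ?_
  · rwa [H1 x hx, H1 y hy] at key
  · rintro z ⟨hz, hzK⟩
    rcases hz with hz | ⟨e, f, i, hz⟩
    · rw [H1 z hz]
      exact ⟨hz, hzK⟩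
    · have hz : New N n e f i z := hz
      rw [H2 hz]
      simp only [g]
      have hle := hz.left_mem
      have hre := hz.right_mem
      split_ifs with h1 h2 h2
      · obtain ⟨-, -, h3, -⟩ := hP e f hz.2.1
        have hi := hz.2.2
        obtain ⟨h4, h5⟩ := h3 i hi.1.le hi.2.le
        have hzi : p ≤ i ∧ i ≤ q := by
          have := hzK.1
          simp only [Graded.band, Set.mem_ofPred_eq, hz.lev_eq] at this
          exact this
        refine ⟨h4, ⟨?_, ?_⟩, fun h6 => ?_⟩
        · change p ≤ lev N _
          rw [h5]
          exact hzi.1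
        · change lev N _ ≤ q
          rw [h5]
          exact hzi.2
        -- Both ends are in the band, so the level `i` strictly between them is strictly between `p`
        -- and `q`, where `F` has no vertices.
        · have h7 : p ≤ lev N e := h1.1.1
          have h8 : lev N f ≤ q := h2.1.2
          have := hF _ h6
          rw [h5] at this
          omega
      · exact ⟨hle, h1⟩
      · exact ⟨hre, h2⟩
      · exact ⟨hx, hxK⟩
  · have up : ∀ z ∈ stage N (n + 1) ∩ K, ∀ w ∈ stage N (n + 1) ∩ K, (graph N).up z w →
        H z = H w ∨ (graph N).Link (H z) (H w) := by
      rintro z ⟨hz, hzK⟩ w ⟨hw, hwK⟩ hzw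
      rcases up_cases hzw hz hw with ⟨h1, h2⟩ | ⟨f, h1⟩ | ⟨e, h1⟩ | ⟨e, f, i, h1, h2⟩
      · rw [H1 z h1, H1 w h2]
        exact .inr (.inl hzw)
      · rw [H1 z h1.left_mem, H2 h1]
        simp only [g, if_pos hzK]
        split_ifs with h2
        · obtain ⟨h3, -, -, h4⟩ := hP z f h1.2.1
          have h5 := h1.2.2
          have h6 := h4 (lev N z) le_rfl (h5.1.trans h5.2)
          rw [h3] at h6
          exact .inr (.inl h6)
        · exact .inl rfl
      · rw [H1 w h1.right_mem, H2 h1]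
        simp only [g, if_pos hwK]
        split_ifs with h2
        · obtain ⟨-, h3, -, h4⟩ := hP e w h1.2.1
          have h5 := h1.2.2
          have h6 := h4 (lev N w - 1) (by omega) (by omega)
          rw [sub_add_cancel, h3] at h6
          exact .inr (.inl h6)
        · exact .inl rfl
      · rw [H2 h1, H2 h2]
        simp only [g]
        split_ifs
        · obtain ⟨-, -, -, h4⟩ := hP e f h1.2.1
          have h5 := h1.2.2
          exact .inr (.inl (h4 i h5.1.le h5.2))
        all_goals exact .inl rfl
    rintro z hz w hw (hzw | hzw)
    · exact up z hz w hw hzw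
    · exact (up w hw z hz hzw).imp Eq.symm Or.symm

end Node

/-! ### Simple connectedness of the stages and of their union -/

namespace Node

variable {N n : ℕ} {e f x y a b : Node} {i : ℤ}

/-- A new vertex between the old vertices `a` and `b` lies on a path whose ends are in the closed
interval from `a` to `b`. A walk avoiding `a` and `b` stays on this path or leaves it at an end
which is then an old vertex strictly between them. -/
theorem exists_entry (ha : a ∈ stage N n) (hb : b ∈ stage N n) {p q : ℤ} {k : ℕ}
    (hx : x ∈ (graph N).Ioo (stage N (n + 1)) a b)
    (h : Walk (graph N).Link (stage N (n + 1) ∩ ((graph N).band p q \ {a, b})) k x y) :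
    Walk (graph N).Link (stage N (n + 1) ∩ (graph N).band p q ∩
      (graph N).Ioo (stage N (n + 1)) a b) k x y ∨
    ∃ x' i j, i + j ≤ k ∧ x' ∈ stage N n ∧ x' ∈ (graph N).Ioo (stage N n) a b ∧
      Walk (graph N).Link (stage N (n + 1) ∩ (graph N).band p q ∩
        (graph N).Ioo (stage N (n + 1)) a b) i x x' ∧
      Walk (graph N).Link (stage N (n + 1) ∩ ((graph N).band p q \ {a, b})) j x' y := by
  have hxm := h.left_mem
  rcases hxm.1 with hxn | ⟨e, f, i, hxn⟩
  · exact .inr ⟨x, 0, k, by omega, hxn, ⟨lt_stage_of_succ hx.1 ha hxn, lt_stage_of_succ hx.2 hxn hb⟩,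
      .nil ⟨⟨hxm.1, hxm.2.1⟩, hx⟩, h⟩
  · have hxn : New N n e f i x := hxn
    have hae : a = e ∨ (graph N).Lt (stage N n) a e := by
      rcases lt_cases_right hx.1 ha with h1 | ⟨e', f', j, h1, h2⟩
      · exact absurd h1.right_mem hxn.notMem
      · have := hxn.1.symm.trans h1.1
        cases this
        exact h2
    have hfb : f = b ∨ (graph N).Lt (stage N n) f b := by
      rcases lt_cases_left hx.2 hb with h1 | ⟨e', f', j, h1, h2⟩
      · exact absurd h1.left_mem hxn.notMem
      · have := hxn.1.symm.trans h1.1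
        cases this
        exact h2
    have hIoo : ∀ z j, New N n e f j z → z ∈ (graph N).Ioo (stage N (n + 1)) a b := by
      intro z j hz
      constructor
      · rcases hae with rfl | h1
        exacts [hz.left_lt, (h1.mono stage_subset_succ).trans hz.left_lt]
      · rcases hfb with rfl | h1
        exacts [hz.lt_right, hz.lt_right.trans (h1.mono stage_subset_succ)]
    have hsub : ∀ z, z ∈ stage N (n + 1) ∩ ((graph N).band p q \ {a, b}) ∩ {z | ∃ j, New N n e f j z} →
        z ∈ stage N (n + 1) ∩ (graph N).band p q ∩ (graph N).Ioo (stage N (n + 1)) a b :=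
      fun z hz => ⟨⟨hz.1.1, hz.1.2.1⟩, hIoo z _ hz.2.choose_spec⟩
    rcases h.exit {z | ∃ j, New N n e f j z} ⟨i, hxn⟩ with h1 | ⟨u, v, i', j, hu, hv, h1, h2, h3, h4⟩
    · exact .inl (h1.mono hsub)
    · obtain ⟨j', hu⟩ := hu
      have hvm := h4.left_mem
      have hva : v ≠ a := fun h5 => hvm.2.2 (.inl h5)
      have hvb : v ≠ b := fun h5 => hvm.2.2 (.inr h5)
      have hv' : v ∈ stage N n ∧ v ∈ (graph N).Ioo (stage N n) a b := by
        rcases hu.exit h1 hvm.1 with h5 | rfl | rfl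
        · exact absurd h5 hv
        · have h5 := hae.resolve_left (Ne.symm hva)
          refine ⟨hu.left_mem, h5, ?_⟩
          rcases hfb with rfl | h6
          exacts [hu.2.1, hu.2.1.trans h6]
        · have h5 := hfb.resolve_left hvb
          refine ⟨hu.right_mem, ?_, h5⟩
          rcases hae with rfl | h6
          exacts [hu.2.1, h6.trans hu.2.1]
      refine .inr ⟨v, i' + 1, j, by omega, hv'.1, hv'.2, (h3.mono hsub).trans (.single
        (hsub u h3.right_mem) ⟨⟨hvm.1, hvm.2.1⟩, hv'.2.1.mono stage_subset_succ,
          hv'.2.2.mono stage_subset_succ⟩ h1), h4⟩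

/-- The walk is split at the first old vertices met from its two ends. The middle part collapses to
the old stage, where the assumption applies; the outer parts already lie between `a` and `b`. No
part becomes longer. -/
theorem simplyConnectedAt_succ_of_mem (h : (graph N).SimplyConnectedAt (stage N n) a b)
    (ha : a ∈ stage N n) (hb : b ∈ stage N n) :
    (graph N).SimplyConnectedAt (stage N (n + 1)) a b := by
  intro p q hp hq x hx y hy k hk
  rcases exists_entry ha hb hx hk with h1 | ⟨x', i, j, h1, h2, h3, h4, h5⟩
  · exact ⟨k, le_rfl, h1⟩
  · have h6 := h5.symm Graded.Link.symm
    rcases exists_entry ha hb hy h6 with h7 | ⟨y', i', j', h7, h8, h9, h10, h11⟩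
    · exact ⟨i + j, h1, h4.trans (h7.symm Graded.Link.symm)⟩
    · obtain ⟨k₁, h12, h13⟩ := collapse (F := {a, b}) (by
        rintro z (rfl | h12)
        · exact .inl hp
        · rw [show z = b from h12]
          exact .inr hq) (h11.symm Graded.Link.symm) h2 h8
      obtain ⟨k₂, h14, h15⟩ := h p q hp hq x' h3 y' h9 k₁ h13
      refine ⟨i + k₂ + i', by omega, (h4.trans (h15.mono ?_)).trans (h10.symm Graded.Link.symm)⟩
      rintro z ⟨⟨hz1, hz2⟩, hz3, hz4⟩
      exact ⟨⟨stage_subset_succ hz1, hz2⟩, hz3.mono stage_subset_succ, hz4.mono stage_subset_succ⟩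

theorem New.exists_unique_up (h : New N n e f i x) : ∃ g, (graph N).up x g ∧
    (∀ y ∈ stage N (n + 1), (graph N).up x y → y = g) ∧
    ((i + 1 = lev N f ∧ g = f) ∨ New N n e f (i + 1) g) := by
  have hcov : ∀ y ∈ stage N (n + 1), (graph N).up x y →
      (y = f ∧ i + 1 = lev N f) ∨ New N n e f (i + 1) y := by
    intro y hy hxy
    rcases up_cases hxy h.mem hy with ⟨h1, -⟩ | ⟨f', h1⟩ | ⟨e', h1⟩ | ⟨e', f', j, h1, h2⟩
    · exact absurd h1 h.notMem
    · exact absurd h1.left_mem h.notMem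
    · have := h.1.symm.trans h1.1
      cases this
      exact .inl ⟨rfl, by omega⟩
    · have := h.1.symm.trans h1.1
      cases this
      exact .inr h2
  have hi := h.2.2
  by_cases hf : i + 1 = lev N f
  · refine ⟨f, ?_, fun y hy hxy => ?_, .inl ⟨hf, rfl⟩⟩
    · rw [h.1, show i = lev N f - 1 by omega]
      exact .last _ _ _
    · rcases hcov y hy hxy with ⟨h1, -⟩ | h1
      · exact h1
      · have := h1.2.2
        omega
  · have h' := h.move (j := i + 1) (by omega) (by omega)
    refine ⟨_, ?_, fun y hy hxy => ?_, .inr h'⟩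
    · rw [h.1]
      exact .step _ _ _ _
    · rcases hcov y hy hxy with ⟨-, h1⟩ | h1
      · exact absurd h1 hf
      · exact h1.1

theorem New.exists_unique_down (h : New N n e f i x) : ∃ g, (graph N).up g x ∧
    (∀ y ∈ stage N (n + 1), (graph N).up y x → y = g) ∧
    ((i = lev N e + 1 ∧ g = e) ∨ New N n e f (i - 1) g) := by
  have hcov : ∀ y ∈ stage N (n + 1), (graph N).up y x →
      (y = e ∧ i = lev N e + 1) ∨ New N n e f (i - 1) y := by
    intro y hy hxy
    rcases up_cases hxy hy h.mem with ⟨-, h1⟩ | ⟨f', h1⟩ | ⟨e', h1⟩ | ⟨e', f', j, h1, h2⟩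
    · exact absurd h1 h.notMem
    · have := h.1.symm.trans h1.1
      cases this
      exact .inl ⟨rfl, rfl⟩
    · exact absurd h1.right_mem h.notMem
    · have := h.1.symm.trans h2.1
      cases this
      exact .inr (by rwa [add_sub_cancel_right])
  have hi := h.2.2
  by_cases hf : i = lev N e + 1
  · refine ⟨e, ?_, fun y hy hxy => ?_, .inl ⟨hf, rfl⟩⟩
    · rw [h.1, hf]
      exact .first _ _ _
    · rcases hcov y hy hxy with ⟨h1, -⟩ | h1
      · exact h1
      · have := h1.2.2
        omega
  · have h' := h.move (j := i - 1) (by omega) (by omega)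
    refine ⟨_, ?_, fun y hy hxy => ?_, .inr h'⟩
    · have := Up.step (N := N) (n + 1) e f (i - 1)
      rw [sub_add_cancel] at this
      rw [h.1]
      exact this
    · rcases hcov y hy hxy with ⟨-, h1⟩ | h1
      · exact absurd h1 hf
      · exact h1.1

/-- A new vertex `a` is replaced by its unique upper neighbour until the upper end of its path, an
old vertex, is reached. Likewise a new `b` is moved down to the lower end of its path. -/
theorem simplyConnectedAt_succ
    (h : ∀ a ∈ stage N n, ∀ b ∈ stage N n, (graph N).SimplyConnectedAt (stage N n) a b) :
    ∀ a ∈ stage N (n + 1), ∀ b ∈ stage N (n + 1),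
      (graph N).SimplyConnectedAt (stage N (n + 1)) a b := by
  have h1 : ∀ b ∈ stage N n, ∀ a ∈ stage N (n + 1),
      (graph N).SimplyConnectedAt (stage N (n + 1)) a b := by
    intro b hb a ha
    rcases ha with ha | ⟨e, f, i, ha⟩
    · exact simplyConnectedAt_succ_of_mem (h a ha b hb) ha hb
    · have ha : New N n e f i a := ha
      obtain ⟨k, hk⟩ : ∃ k : ℕ, lev N f - i = k := ⟨_, (Int.toNat_of_nonneg
        (by have := ha.2.2; omega)).symm⟩
      induction k generalizing a i with
      | zero => have := ha.2.2; omega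
      | succ k ih =>
        obtain ⟨g, h2, h3, ⟨-, rfl⟩ | h4⟩ := ha.exists_unique_up
        · exact .of_unique_up h2 ha.mem (.inl ha.right_mem) h3
            (simplyConnectedAt_succ_of_mem (h _ ha.right_mem b hb) ha.right_mem hb)
        · exact .of_unique_up h2 ha.mem h4.mem h3 (ih _ _ h4 h4 (by push_cast at hk; omega))
  intro a ha b hb
  rcases hb with hb | ⟨e, f, i, hb⟩
  · exact h1 b hb a ha
  · have hb : New N n e f i b := hb
    obtain ⟨k, hk⟩ : ∃ k : ℕ, i - lev N e = k := ⟨_, (Int.toNat_of_nonneg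
      (by have := hb.2.2; omega)).symm⟩
    induction k generalizing b i with
    | zero => have := hb.2.2; omega
    | succ k ih =>
      obtain ⟨g, h2, h3, ⟨-, rfl⟩ | h4⟩ := hb.exists_unique_down
      · exact .of_unique_down h2 hb.mem (.inl hb.left_mem) h3 (h1 _ hb.left_mem a ha)
      · exact .of_unique_down h2 hb.mem h4.mem h3 (ih _ _ h4 h4 (by push_cast at hk; omega))

theorem lev_mem (hx : x ∈ stage N n) : x = bot ∨ x = top ∨ 0 ≤ lev N x ∧ lev N x ≤ N := by
  induction n generalizing x with
  | zero =>
    rcases hx with (rfl | rfl) | ⟨j, h1, h2, rfl⟩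
    exacts [.inl rfl, .inr (.inl rfl), .inr (.inr ⟨h1, h2⟩)]
  | succ n ih =>
    rcases hx with hx | ⟨e, f, i, hx⟩
    · exact ih hx
    · have hx : New N n e f i x := hx
      refine .inr (.inr ?_)
      have h1 : -1 ≤ lev N e := by
        rcases ih hx.left_mem with h | h | h
        · rw [h]
          exact le_rfl
        · rw [h]
          change (-1 : ℤ) ≤ N + 1
          omega
        · omega
      have h2 : lev N f ≤ N + 1 := by
        rcases ih hx.right_mem with h | h | h
        · rw [h]
          change (-1 : ℤ) ≤ N + 1
          omega
        · rw [h]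
          exact le_rfl
        · omega
      have h3 := hx.2.2
      rw [show lev N x = i from hx.lev_eq]
      omega

theorem flag_zero : ∃ F : ℤ → Node, (∀ x ∈ stage N 0, -1 ≤ lev N x ∧ lev N x ≤ N + 1 ∧
    x = F (lev N x)) ∧ (∀ i : ℤ, -1 ≤ i → i ≤ N + 1 → F i ∈ stage N 0) ∧
    ∀ i : ℤ, -1 ≤ i → i < N + 1 → (graph N).up (F i) (F (i + 1)) := by
  classical
  let F : ℤ → Node := fun i => if i = -1 then bot else if i = N + 1 then top else node 0 bot top i
  have F1 : F (-1) = bot := if_pos rfl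
  have F2 : F (N + 1) = top := by
    have : (N : ℤ) + 1 ≠ -1 := by omega
    simp [F, this]
  have F3 : ∀ i : ℤ, 0 ≤ i → i ≤ N → F i = node 0 bot top i := by
    intro i h1 h2
    have h3 : i ≠ -1 := by omega
    have h4 : i ≠ N + 1 := by omega
    simp [F, h3, h4]
  refine ⟨F, ?_, fun i h1 h2 => ?_, fun i h1 h2 => ?_⟩
  · rintro x ((rfl | rfl) | ⟨j, h1, h2, rfl⟩)
    · exact ⟨le_rfl, by simp only [lev]; omega, F1.symm⟩
    · exact ⟨by simp only [lev]; omega, le_rfl, F2.symm⟩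
    · exact ⟨by simp only [lev]; omega, by simp only [lev]; omega, (F3 j h1 h2).symm⟩
  · by_cases h3 : i = -1
    · rw [h3, F1]
      exact bot_mem
    by_cases h4 : i = N + 1
    · rw [h4, F2]
      exact top_mem
    · exact .inr ⟨i, by omega, by omega, F3 i (by omega) (by omega)⟩
  · by_cases h3 : i = -1
    · subst h3
      rw [F1, F3 _ (by omega) (by omega)]
      exact .first _ _ _
    by_cases h4 : i = N
    · subst h4
      rw [F2, F3 _ (by omega) (by omega)]
      have := Up.last (N := N) 0 bot top
      rwa [show lev N top - 1 = N from add_sub_cancel_right _ _] at this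
    · rw [F3 _ (by omega) (by omega), F3 _ (by omega) (by omega)]
      exact .step _ _ _ _

theorem simplyConnectedAt_stage : ∀ a ∈ stage N n, ∀ b ∈ stage N n,
    (graph N).SimplyConnectedAt (stage N n) a b := by
  induction n with
  | zero =>
    obtain ⟨F, h1, h2, h3⟩ := flag_zero (N := N)
    have hlt : ∀ x ∈ stage N 0, ∀ y ∈ stage N 0, lev N x < lev N y →
        (graph N).Lt (stage N 0) x y := by
      intro x hx y hy hxy
      obtain ⟨h4, h5, h6⟩ := h1 x hx
      obtain ⟨h7, h8, h9⟩ := h1 y hy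
      rw [h6, h9]
      exact Graded.lt_of_path hxy (fun j _ _ => h2 j (by omega) (by omega))
        fun j _ _ => h3 j (by omega) (by omega)
    have hinj : ∀ x ∈ stage N 0, ∀ y ∈ stage N 0, lev N x = lev N y → x = y := by
      intro x hx y hy hxy
      rw [(h1 x hx).2.2, (h1 y hy).2.2, hxy]
    intro a ha b hb p q hp hq x hx y hy k hk
    -- The initial stage has one vertex on each level, so a walk between the levels of `a` and `b`
    -- which avoids both is between them already.
    refine ⟨k, le_rfl, hk.mono ?_⟩
    rintro z ⟨hz1, ⟨hz2, hz3⟩, hz4⟩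
    have hza : lev N a ≠ lev N z := fun h => hz4 (.inl (hinj z hz1 a ha h.symm))
    have hzb : lev N z ≠ lev N b := fun h => hz4 (.inr (hinj z hz1 b hb h))
    exact ⟨⟨hz1, hz2, hz3⟩, hlt a ha z hz1 (lt_of_le_of_ne (hp.trans hz2) hza),
      hlt z hz1 b hb (lt_of_le_of_ne (hz3.trans hq) hzb)⟩
  | succ n ih => exact simplyConnectedAt_succ ih

variable (N) in
/-- The vertices of the free pseudospace, including the two imaginary ones. -/
def space : Set Node := ⋃ n, stage N n

theorem stage_subset_space : stage N n ⊆ space N := Set.subset_iUnion _ n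

theorem exists_stage_lt (h : (graph N).Lt (space N) x y) : ∃ n, (graph N).Lt (stage N n) x y := by
  induction h with
  | single h =>
    obtain ⟨m, hm⟩ := Set.mem_iUnion.1 h.1
    obtain ⟨n, hn⟩ := Set.mem_iUnion.1 h.2.1
    exact ⟨max m n, .single (stage_mono (le_max_left _ _) hm) (stage_mono (le_max_right _ _) hn)
      h.2.2⟩
  | tail _ h ih =>
    obtain ⟨m, hm⟩ := ih
    obtain ⟨n, hn⟩ := Set.mem_iUnion.1 h.2.1
    have hm' := hm.mono (stage_mono (le_max_left m n))
    exact ⟨max m n, hm'.trans (.single hm'.right_mem (stage_mono (le_max_right _ _) hn) h.2.2)⟩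

theorem exists_stage_walk {K : Set Node} {k : ℕ}
    (h : Walk (graph N).Link (space N ∩ K) k x y) :
    ∃ n, Walk (graph N).Link (stage N n ∩ K) k x y := by
  induction h with
  | nil h =>
    obtain ⟨n, hn⟩ := Set.mem_iUnion.1 h.1
    exact ⟨n, .nil ⟨hn, h.2⟩⟩
  | cons h1 h2 _ ih =>
    obtain ⟨m, hm⟩ := Set.mem_iUnion.1 h1.1
    obtain ⟨n, hn⟩ := ih
    exact ⟨max m n, .cons ⟨stage_mono (le_max_left _ _) hm, h1.2⟩ h2
      (hn.mono (Set.inter_subset_inter_left _ (stage_mono (le_max_right _ _))))⟩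

theorem simplyConnectedAt_space : (graph N).SimplyConnectedAt (space N) a b := by
  intro p q hp hq x hx y hy k hk
  obtain ⟨n₁, h1⟩ := exists_stage_lt hx.1
  obtain ⟨n₂, h2⟩ := exists_stage_lt hx.2
  obtain ⟨n₃, h3⟩ := exists_stage_lt hy.1
  obtain ⟨n₄, h4⟩ := exists_stage_lt hy.2
  obtain ⟨n₅, h5⟩ := exists_stage_walk hk
  let n := n₁ + n₂ + n₃ + n₄ + n₅
  have h1 := h1.mono (stage_mono (n := n) (by omega))
  have h2 := h2.mono (stage_mono (n := n) (by omega))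
  have h3 := h3.mono (stage_mono (n := n) (by omega))
  have h4 := h4.mono (stage_mono (n := n) (by omega))
  have h5 := h5.mono (Set.inter_subset_inter_left _ (stage_mono (n := n) (by omega)))
  obtain ⟨k', h6, h7⟩ := simplyConnectedAt_stage a h1.left_mem b h2.right_mem p q hp hq x ⟨h1, h2⟩ y
    ⟨h3, h4⟩ k h5
  refine ⟨k', h6, h7.mono ?_⟩
  rintro z ⟨⟨h8, h9⟩, h10, h11⟩
  exact ⟨⟨stage_subset_space h8, h9⟩, h10.mono stage_subset_space, h11.mono stage_subset_space⟩

/-- Paths with levels in a given interval do not connect more vertices at later stages. -/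
theorem walk_stage {p q : ℤ} {k : ℕ} (hx : x ∈ stage N n) (hy : y ∈ stage N n)
    (h : Walk (graph N).Link (space N ∩ (graph N).band p q) k x y) :
    ∃ k', Walk (graph N).Link (stage N n ∩ (graph N).band p q) k' x y := by
  obtain ⟨m, hm⟩ := exists_stage_walk h
  replace hm := hm.mono (Set.inter_subset_inter_left _ (stage_mono (n := n + m) (Nat.le_add_left m n)))
  clear h
  induction m generalizing k with
  | zero => exact ⟨k, hm⟩
  | succ m ih =>
    obtain ⟨k', -, h⟩ := collapse (n := n + m) (p := p) (q := q) (F := ∅) (k := k)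
      (fun z hz => absurd hz (Set.notMem_empty z)) (by rwa [Set.sdiff_empty])
      (stage_mono (Nat.le_add_right n m) hx) (stage_mono (Nat.le_add_right n m) hy)
    rw [Set.sdiff_empty] at h
    exact ih h

/-- A new path between `e` and `f` is not connected to the old vertices by paths with levels strictly
between those of `e` and `f`. -/
theorem New.not_walk (h : New N n e f i x) (hy : y ∈ stage N n) {k : ℕ} :
    ¬ Walk (graph N).Link (space N ∩ (graph N).band (lev N e + 1) (lev N f - 1)) k x y := by
  intro hk
  obtain ⟨k', hk'⟩ := walk_stage h.mem (stage_subset_succ hy) hk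
  -- In stage `n + 1` the new path can be left only through `e` or `f`, whose levels are outside of
  -- the band.
  rcases hk'.exit {z | ∃ j, New N n e f j z} ⟨i, h⟩ with h1 | ⟨u, v, i', j, ⟨j', hu⟩, hv, h1, h2, h3, h4⟩
  · obtain ⟨j, h2⟩ := h1.right_mem.2
    exact h2.notMem hy
  · have hvm := h4.left_mem
    have h5 : lev N e + 1 ≤ lev N v := hvm.2.1
    have h6 : lev N v ≤ lev N f - 1 := hvm.2.2
    rcases hu.exit h1 hvm.1 with h5 | rfl | rfl
    · exact hv h5
    · omega
    · omega

theorem bot_lt (hx : x ∈ stage N n) (hxb : x ≠ bot) : (graph N).Lt (stage N n) bot x := by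
  induction n generalizing x with
  | zero =>
    obtain ⟨F, h1, h2, h3⟩ := flag_zero (N := N)
    obtain ⟨h4, h5, h6⟩ := h1 x hx
    obtain ⟨h7, h8, h9⟩ := h1 bot bot_mem
    have : lev N x ≠ lev N bot := fun h => hxb (by rw [h6, h, ← h9])
    have h10 : lev N bot = -1 := rfl
    rw [h6, h9]
    exact Graded.lt_of_path (by omega) (fun j _ _ => h2 j (by omega) (by omega))
      fun j _ _ => h3 j (by omega) (by omega)
  | succ n ih =>
    rcases hx with hx | ⟨e, f, i, hx⟩
    · exact (ih hx hxb).mono stage_subset_succ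
    · have hx : New N n e f i x := hx
      by_cases he : e = bot
      · rw [← he]
        exact hx.left_lt
      · exact ((ih hx.left_mem he).mono stage_subset_succ).trans hx.left_lt

theorem lt_top (hx : x ∈ stage N n) (hxt : x ≠ top) : (graph N).Lt (stage N n) x top := by
  induction n generalizing x with
  | zero =>
    obtain ⟨F, h1, h2, h3⟩ := flag_zero (N := N)
    obtain ⟨h4, h5, h6⟩ := h1 x hx
    obtain ⟨h7, h8, h9⟩ := h1 top top_mem
    have : lev N x ≠ lev N top := fun h => hxt (by rw [h6, h, ← h9])
    have h10 : lev N top = N + 1 := rfl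
    rw [h6, h9]
    exact Graded.lt_of_path (by omega) (fun j _ _ => h2 j (by omega) (by omega))
      fun j _ _ => h3 j (by omega) (by omega)
  | succ n ih =>
    rcases hx with hx | ⟨e, f, i, hx⟩
    · exact (ih hx hxt).mono stage_subset_succ
    · have hx : New N n e f i x := hx
      by_cases he : f = top
      · rw [← he]
        exact hx.lt_right
      · exact hx.lt_right.trans ((ih hx.right_mem he).mono stage_subset_succ)

end Node

/-! ### The free pseudospace as a model of the axioms -/

variable {N : ℕ}

variable (N) in
/-- The real vertices of the free pseudospace. -/
def Point : Type := {x : Node // x ∈ Node.space N ∧ x ≠ .bot ∧ x ≠ .top}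

namespace Point

instance : (lang N).Structure (Point N) where
  funMap f := Empty.elim f
  RelMap {_} R := match R with
    | .level i => fun v => Node.lev N (v 0).1 = (i : ℕ)
    | .adj => fun v => (Node.graph N).Link (v 0).1 (v 1).1

theorem lev_mem (x : Point N) : 0 ≤ Node.lev N x.1 ∧ Node.lev N x.1 ≤ N := by
  obtain ⟨n, hn⟩ := Set.mem_iUnion.1 x.2.1
  exact ((Node.lev_mem hn).resolve_left x.2.2.1).resolve_left x.2.2.2

theorem level_iff {i : ℤ} {x : Point N} : Level N i x ↔ Node.lev N x.1 = i := by
  constructor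
  · rintro ⟨j, rfl, h⟩
    exact h
  · rintro rfl
    have := lev_mem x
    have h : (((Node.lev N x.1).toNat : ℕ) : ℤ) = Node.lev N x.1 := Int.toNat_of_nonneg this.1
    have hlt : (Node.lev N x.1).toNat < N + 1 := by omega
    exact ⟨⟨(Node.lev N x.1).toNat, hlt⟩, h, h.symm⟩

theorem adj_iff {x y : Point N} : Adj N x y ↔ (Node.graph N).Link x.1 y.1 := Iff.rfl

theorem isColoredSpace : IsColoredSpace N (Point N) where
  existsUnique_level x := ⟨_, level_iff.2 rfl, fun _ h => (level_iff.1 h).symm⟩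
  adj_symm _ _ h := Graded.Link.symm h
  level_of_adj x y h := by
    simp only [level_iff]
    rcases h with h | h
    · exact ⟨_, .inl ⟨rfl, (Node.graph N).lev_up h⟩⟩
    · exact ⟨_, .inr ⟨(Node.graph N).lev_up h, rfl⟩⟩

/-- The name of a vertex. -/
def toNode : Vertex (Point N) → Node
  | .bot => .bot
  | .real x => x.1
  | .top => .top

theorem toNode_injective : Function.Injective (toNode (N := N)) := by
  rintro (_ | x | _) (_ | y | _) h
  · rfl
  · exact absurd h.symm y.2.2.1
  · cases h
  · exact absurd h x.2.2.1
  · exact congrArg _ (Subtype.ext h)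
  · exact absurd h x.2.2.2
  · cases h
  · exact absurd h.symm y.2.2.2
  · rfl

theorem toNode_mem (v : Vertex (Point N)) : toNode v ∈ Node.space N := by
  cases v with
  | bot => exact Node.stage_subset_space (n := 0) Node.bot_mem
  | real x => exact x.2.1
  | top => exact Node.stage_subset_space (n := 0) Node.top_mem

theorem exists_toNode {x : Node} (hx : x ∈ Node.space N) : ∃ v : Vertex (Point N), toNode v = x := by
  by_cases h : x = .bot
  · exact ⟨.bot, h.symm⟩
  by_cases h' : x = .top
  · exact ⟨.top, h'.symm⟩
  · exact ⟨.real ⟨x, hx, h, h'⟩, rfl⟩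

theorem lev_toNode (v : Vertex (Point N)) : Node.lev N (toNode v) = isColoredSpace.graph.lev v := by
  cases v with
  | bot => exact isColoredSpace.lev_bot.symm
  | real x => exact (isColoredSpace.level_iff.1 (level_iff.2 rfl)).symm
  | top => exact isColoredSpace.lev_top.symm

/-- The path through a vertex of level `0` starts on a negative level, hence at `bot`. Thus the
edges to `bot` in the graph of names are the ones which the colored space prescribes. -/
theorem up_bot {x : Point N} (h : Node.lev N x.1 = 0) : (Node.graph N).up .bot x.1 := by
  obtain ⟨n, hn⟩ := Set.mem_iUnion.1 x.2.1
  obtain ⟨x, hx, hxb, hxt⟩ := x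
  cases x with
  | bot => exact absurd rfl hxb
  | top => exact absurd rfl hxt
  | node k e f i =>
    obtain rfl : i = 0 := h
    obtain ⟨-, he, -, h1, -⟩ := Node.node_mem hn
    rcases Node.lev_mem he with rfl | rfl | h2
    · exact Node.Up.first k .bot f
    · simp only [Node.lev] at h1
      omega
    · omega

theorem up_top {x : Point N} (h : Node.lev N x.1 = N) : (Node.graph N).up x.1 .top := by
  obtain ⟨n, hn⟩ := Set.mem_iUnion.1 x.2.1
  obtain ⟨x, hx, hxb, hxt⟩ := x
  cases x with
  | bot => exact absurd rfl hxb
  | top => exact absurd rfl hxt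
  | node k e f i =>
    obtain rfl : i = N := h
    obtain ⟨-, -, hf, -, h1, -⟩ := Node.node_mem hn
    rcases Node.lev_mem hf with rfl | rfl | h2
    · simp only [Node.lev] at h1
      omega
    · have := Node.Up.last (N := N) k e .top
      rwa [show Node.lev N .top - 1 = N from add_sub_cancel_right _ _] at this
    · omega

theorem up_iff {u v : Vertex (Point N)} :
    isColoredSpace.graph.up u v ↔ (Node.graph N).up (toNode u) (toNode v) := by
  have hlev : (Node.graph N).up (toNode u) (toNode v) →
      isColoredSpace.graph.lev v = isColoredSpace.graph.lev u + 1 := by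
    intro h
    rw [← lev_toNode, ← lev_toNode]
    exact (Node.graph N).lev_up h
  rw [isColoredSpace.up_iff]
  refine ⟨fun ⟨h1, h2⟩ => ?_, fun h => ⟨?_, hlev h⟩⟩
  · have hu := isColoredSpace.lev_mem u
    have hv := isColoredSpace.lev_mem v
    rcases u with _ | x | _ <;> rcases v with _ | y | _
    · exact h1.elim
    · exact up_bot (level_iff.1 h1)
    · exact h1.elim
    · rw [isColoredSpace.lev_bot] at h2
      omega
    · rcases adj_iff.1 h1 with h | h
      · exact h
      · have := (Node.graph N).lev_up h
        change Node.lev N (toNode (.real x)) = Node.lev N (toNode (.real y)) + 1 at this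
        rw [lev_toNode, lev_toNode] at this
        omega
    · exact up_top (level_iff.1 h1)
    · exact h1.elim
    · rw [isColoredSpace.lev_top] at h2
      omega
    · exact h1.elim
  · have h2 := hlev h
    have hu := lev_toNode u
    have hv := lev_toNode v
    rcases u with _ | x | _ <;> rcases v with _ | y | _ <;>
      try simp only [isColoredSpace.lev_bot, isColoredSpace.lev_top] at h2 hu hv
    · omega
    · exact level_iff.2 (hv.trans h2)
    · omega
    · have := isColoredSpace.lev_real x
      omega
    · exact .inl h
    · exact level_iff.2 (hu.trans (by omega))
    · omega
    · have := isColoredSpace.lev_real y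
      omega
    · omega

theorem lt_iff {u v : Vertex (Point N)} : isColoredSpace.graph.Lt Set.univ u v ↔
    (Node.graph N).Lt (Node.space N) (toNode u) (toNode v) := by
  constructor
  · intro h
    induction h with
    | single h => exact .single (toNode_mem _) (toNode_mem _) (up_iff.1 h.2.2)
    | tail _ h ih => exact ih.trans (.single (toNode_mem _) (toNode_mem _) (up_iff.1 h.2.2))
  · intro h
    suffices ∀ y, (Node.graph N).Lt (Node.space N) (toNode u) y → ∀ v, toNode v = y →
        isColoredSpace.graph.Lt Set.univ u v from this _ h _ rfl
    intro y h
    induction h with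
    | single h =>
      rintro v rfl
      exact .single trivial trivial (up_iff.2 h.2.2)
    | tail _ h ih =>
      rintro v rfl
      obtain ⟨w, rfl⟩ := exists_toNode h.1
      exact (ih w rfl).trans (.single trivial trivial (up_iff.2 h.2.2))

theorem beneath_iff {u v : Vertex (Point N)} : Beneath N Set.univ u v ↔
    (Node.graph N).Lt (Node.space N) (toNode u) (toNode v) := by
  have hlev : (Node.graph N).Lt (Node.space N) (toNode u) (toNode v) →
      isColoredSpace.graph.lev u < isColoredSpace.graph.lev v := by
    intro h
    rw [← lev_toNode, ← lev_toNode]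
    exact h.lev_lt
  have hu := isColoredSpace.lev_mem u
  have hv := isColoredSpace.lev_mem v
  have hbot : toNode v ≠ .bot → (Node.graph N).Lt (Node.space N) .bot (toNode v) := by
    intro h
    obtain ⟨n, hn⟩ := Set.mem_iUnion.1 (toNode_mem v)
    exact (Node.bot_lt hn h).mono Node.stage_subset_space
  have htop : toNode u ≠ .top → (Node.graph N).Lt (Node.space N) (toNode u) .top := by
    intro h
    obtain ⟨n, hn⟩ := Set.mem_iUnion.1 (toNode_mem u)
    exact (Node.lt_top hn h).mono Node.stage_subset_space
  rcases u with _ | x | _ <;> rcases v with _ | y | _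
  · exact iff_of_false id fun h => (hlev h).false
  · exact iff_of_true trivial (hbot y.2.2.1)
  · exact iff_of_true trivial (hbot fun h => by cases h)
  · refine iff_of_false id fun h => ?_
    have := hlev h
    rw [isColoredSpace.lev_bot] at this
    omega
  · rw [isColoredSpace.beneath_real_iff, ← lt_iff]
    exact ⟨Graded.Lt.mono (Set.subset_univ _), isColoredSpace.lt_real_of_univ⟩
  · exact iff_of_true trivial (htop x.2.2.2)
  all_goals
    refine iff_of_false id fun h => ?_
    have := hlev h
    rw [isColoredSpace.lev_top] at this
    omega

theorem between_iff {a b : Vertex (Point N)} {x : Point N} : x ∈ Between N Set.univ a b ↔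
    x.1 ∈ (Node.graph N).Ioo (Node.space N) (toNode a) (toNode b) :=
  ⟨fun h => ⟨beneath_iff.1 h.2.1, beneath_iff.1 h.2.2⟩,
    fun h => ⟨trivial, beneath_iff.2 h.1, beneath_iff.2 h.2⟩⟩

theorem strip_iff {p q : ℤ} {x : Point N} :
    x ∈ Strip N p q ↔ x.1 ∈ (Node.graph N).band p q := by
  simp [Strip, Graded.band, level_iff]
  rfl

theorem simplyConnected : SimplyConnected N (Point N) := by
  intro l r p q _ _ _ hp _ hq a b ha hb _ x y hx hy k hk
  have hla := (lev_toNode a).trans (isColoredSpace.vLevel_iff.1 ha)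
  have hlb := (lev_toNode b).trans (isColoredSpace.vLevel_iff.1 hb)
  have hwalk : Walk (Node.graph N).Link
      (Node.space N ∩ ((Node.graph N).band p q \ {toNode a, toNode b})) k x.1 y.1 := by
    refine (pathIn_iff_walk.1 hk).map_hom Subtype.val ?_ fun _ _ _ _ h => h
    rintro z ⟨hz1, hza, hzb⟩
    refine ⟨z.2.1, strip_iff.1 hz1, ?_⟩
    rintro (h | h)
    exacts [hza (toNode_injective h), hzb (toNode_injective h)]
  obtain ⟨k', hk', h⟩ := Node.simplyConnectedAt_space p q (hla.trans_le hp) (hq.trans_eq hlb.symm)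
    x.1 (between_iff.1 hx.2) y.1 (between_iff.1 hy.2) k hwalk
  refine ⟨k', hk', pathIn_iff_walk.2 ?_⟩
  have key : ∀ z ∈ Node.space N ∩ (Node.graph N).band p q ∩
      (Node.graph N).Ioo (Node.space N) (toNode a) (toNode b), ∃ t : Point N, t.1 = z := by
    rintro z ⟨⟨hz, -⟩, h1, h2⟩
    obtain ⟨v, rfl⟩ := exists_toNode hz
    have h3 := (lt_iff.2 h1).lev_lt
    have h4 := (lt_iff.2 h2).lev_lt
    have h5 := isColoredSpace.lev_mem a
    have h6 := isColoredSpace.lev_mem b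
    obtain ⟨t, rfl⟩ := isColoredSpace.exists_real (v := v) (by omega) (by omega)
    exact ⟨t, rfl⟩
  classical
  let g : Node → Point N := fun z =>
    if h : z ∈ Node.space N ∧ z ≠ .bot ∧ z ≠ .top then ⟨z, h⟩ else x
  have hg : ∀ t : Point N, g t.1 = t := fun t => dif_pos t.2
  have h' : Walk (Adj N) (Strip N p q ∩ Between N Set.univ a b) k' (g x.1) (g y.1) := by
    refine h.map_hom g (fun z hz => ?_) fun z hz w hw h => ?_
    · obtain ⟨t, rfl⟩ := key z hz
      rw [hg]
      exact ⟨strip_iff.2 hz.1.2, between_iff.2 hz.2⟩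
    · obtain ⟨t, rfl⟩ := key z hz
      obtain ⟨s, rfl⟩ := key w hw
      rw [hg, hg]
      exact h
  rwa [hg, hg] at h'

theorem arbitrarilyFarPaths : ArbitrarilyFarPaths N (Point N) := by
  intro A hA l m hl hr a b _ _ ha hb hab _
  have hla := (lev_toNode a).trans (isColoredSpace.vLevel_iff.1 ha)
  have hlb := (lev_toNode b).trans (isColoredSpace.vLevel_iff.1 hb)
  -- The finite set `A` and a rising path from `a` to `b` are present at some stage `n`. The path
  -- between `a` and `b` adjoined in step `n + 1` is not connected to `A` on its levels, so it
  -- serves for all distances.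
  obtain ⟨n, hA, hlt⟩ : ∃ n, (∀ x ∈ A, x.1 ∈ Node.stage N n) ∧
      (Node.graph N).Lt (Node.stage N n) (toNode a) (toNode b) := by
    choose g hg using fun x : Point N => Set.mem_iUnion.1 x.2.1
    obtain ⟨B, hB⟩ := (hA.image g).bddAbove
    obtain ⟨n, hn⟩ := Node.exists_stage_lt (beneath_iff.1 hab)
    exact ⟨max B n, fun x hx => Node.stage_mono
      ((hB (Set.mem_image_of_mem g hx)).trans (le_max_left _ _)) (hg x),
      hn.mono (Node.stage_mono (le_max_right _ _))⟩
  have hnew : ∀ j : Fin (m + 1), Node.New N n (toNode a) (toNode b) (l + 1 + (j : ℕ))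
      (.node (n + 1) (toNode a) (toNode b) (l + 1 + (j : ℕ))) := by
    intro j
    have := j.2
    exact ⟨rfl, hlt, by omega, by omega⟩
  let c : Fin (m + 1) → Point N := fun j => ⟨.node (n + 1) (toNode a) (toNode b) (l + 1 + (j : ℕ)),
    Node.stage_subset_space (hnew j).mem, nofun, nofun⟩
  refine ⟨c, fun j => level_iff.2 rfl, ?_, ?_, fun j => ?_, fun x hx hxs j k _ hk => ?_⟩
  · refine (up_iff.2 (?_ : (Node.graph N).up (toNode a) (c 0).1)).1
    have : (Node.graph N).up _ _ := Node.Up.first (n + 1) (toNode a) (toNode b)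
    rw [hla] at this
    simpa [c] using this
  · refine (up_iff.2 (?_ : (Node.graph N).up (c (Fin.last m)).1 (toNode b))).1
    have : (Node.graph N).up _ _ := Node.Up.last (n + 1) (toNode a) (toNode b)
    rw [hlb, show l + m + 2 - 1 = l + 1 + m by ring] at this
    simpa [c] using this
  · have := Node.Up.step (N := N) (n + 1) (toNode a) (toNode b) (l + 1 + (j : ℕ))
    refine adj_iff.2 (.inl ?_)
    change (Node.graph N).up (.node _ _ _ (l + 1 + (j : ℕ))) (.node _ _ _ (l + 1 + ((j + 1 : ℕ) : ℤ)))
    rwa [Nat.cast_succ, ← add_assoc]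
  · refine (hnew j).not_walk (hA x hx) (k := k) ?_
    rw [hla, hlb, show l + m + 2 - 1 = l + m + 1 by ring]
    refine (pathIn_iff_walk.1 hk).map_hom (r' := (Node.graph N).Link) Subtype.val ?_
      fun _ _ _ _ h => h
    exact fun z hz => ⟨z.2.1, strip_iff.1 hz⟩

theorem models_PS : Point N ⊨ PS N :=
  models_PS_iff.2 ⟨isColoredSpace, simplyConnected, arbitrarilyFarPaths⟩

end Point

/-! ### Consistency, completeness and the main theorem -/

theorem isSatisfiable_PS : (PS N).IsSatisfiable :=
  have : Nonempty (Point N) := nonempty_of_models Point.models_PS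
  have := Point.models_PS (N := N)
  Theory.Model.isSatisfiable (Point N)

theorem isComplete_PS : (PS N).IsComplete := by
  refine ⟨isSatisfiable_PS, fun φ => ?_⟩
  by_cases h : Point N ⊨ φ
  · refine .inl (Theory.models_sentence_iff.2 fun K => ?_)
    exact (realize_sentence_iff Point.models_PS K.is_model φ).1 h
  · refine .inr (Theory.models_sentence_iff.2 fun K => ?_)
    rw [Sentence.realize_not, ← realize_sentence_iff Point.models_PS K.is_model φ]
    exact h

end FreePseudospace

theorem theorem4p27 (N : ℕ) (hN : 1 ≤ N) :
    -- partial isomorphisms between finite nice subsets of two models are elementary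
    (∀ (M : Type*) (M' : Type*) [(FreePseudospace.lang N).Structure M]
        [(FreePseudospace.lang N).Structure M'],
      M ⊨ FreePseudospace.PS N → M' ⊨ FreePseudospace.PS N →
      ∀ f : M ≃ₚ[FreePseudospace.lang N] M',
        (f.dom : Set M).Finite →
        FreePseudospace.Nice N (f.dom : Set M) → FreePseudospace.Nice N (f.cod : Set M') →
        FreePseudospace.IsElementary f) ∧
    -- the theory is complete
    (FreePseudospace.PS N).IsComplete ∧
    -- the type of a (possibly infinite) nice set is determined by its quantifier-free type
    (∀ (M : Type*) (M' : Type*) [(FreePseudospace.lang N).Structure M]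
        [(FreePseudospace.lang N).Structure M'],
      M ⊨ FreePseudospace.PS N → M' ⊨ FreePseudospace.PS N →
      ∀ (ι : Type*) (a : ι → M) (a' : ι → M'),
        FreePseudospace.Nice N (Set.range a) → FreePseudospace.Nice N (Set.range a') →
        (∀ φ : (FreePseudospace.lang N).Formula ι, φ.IsQF → (φ.Realize a ↔ φ.Realize a')) →
        ∀ φ : (FreePseudospace.lang N).Formula ι, φ.Realize a ↔ φ.Realize a') := by
  refine ⟨?_, FreePseudospace.isComplete_PS, ?_⟩
  · intro M M' _ _ hM hM' f _ hd hc n φ x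
    have h : FreePseudospace.NiceIso N (fun x : f.dom => (x : M))
        (fun x => (f.toEquiv x : M')) := by
      refine ⟨.of_partialEquiv f, ?_, ?_⟩
      · rwa [show Set.range (fun x : f.dom => (x : M)) = f.dom from Subtype.range_coe]
      · rwa [show Set.range (fun x => (f.toEquiv x : M')) = f.cod from
          (f.toEquiv.surjective.range_comp Subtype.val).trans Subtype.range_coe]
    exact h.realize_formula hM hM' x φ
  · intro M M' _ _ hM hM' ι a a' ha ha' h φ
    exact FreePseudospace.NiceIso.realize_formula hM hM' ⟨.of_isQF h, ha, ha'⟩ id φ
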